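/- **Setting.** Let $\Omega\subset\mathbb R^2$ be a bounded open set whose boundary is a finite union of segments, let $k\ge 1$ and $l=\max\{0,k-2\}$. Let $\Omega_h$ be a finite mesh of $\Omega$ made of compact polygonal elements $P$ (each the closure of its nonempty interior, with $\mathrm{int}\,P\subset\Omega$, pairwise disjoint interiors, and $\overline\Omega=\bigcup_{P\in\Omega_h}P$). The boundary of each element is a union of mesh edges $E$, two edges meet at most at endpoints, and each edge lies either on $\partial\Omega$ or, except possibly for its endpoints, inside $\Omega$. Suppose that for some $\varrho>0$ every $P$ is star-shaped with respect to a ball of radius $\varrho h_P$, where $h_P$ is the diameter of $P$. Let $\Psi\subset H^1(\Omega)\cap C^0(\overline\Omega)$ be a finite-dimensional space such that $\Delta w\in L^2(P)$ for all $w\in\Psi$ and all elements $P$. Set $\widetilde{\mathbb P}_k(P)=\mathbb P_k(P)+\Psi|_P$, $\widetilde{\mathbb P}_k(E)=\mathbb P_k(E)+\Psi|_E$, $\mathbb P^\Delta_l(P)=\mathbb P_l(P)+\Delta\Psi|_P$, and $$\widetilde V_h(P)=\{v\in H^1(P):\ \Delta v\in\mathbb P^\Delta_l(P),\ v|_{\partial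 P}\in C^0(\partial P),\ v|_E\in\widetilde{\mathbb P}_k(E)\ \text{for every edge } E\subset\partial P\},$$ $$\widetilde V_h=\{v\in H^1(\Omega): v|_P\in\widetilde V_h(P)\ \forall P\in\Omega_h\},\qquad \widetilde V_{h,0}=\{v\in\widetilde V_h: v|_{\partial\Omega}=0\},$$ boundary values being traces. Let $\Pi^\Delta_P$ be the $L^2(P)$-orthogonal projector onto $\mathbb P^\Delta_l(P)$, and for $v\in\widetilde V_h(P)$ let $\widetilde\Pi^\nabla_P v\in\widetilde{\mathbb P}_k(P)$ be defined by $\int_P\nabla\widetilde\Pi^\nabla_Pv\cdot\nabla q=\int_P\nabla v\cdot\nabla q$ for all $q\in\widetilde{\mathbb P}_k(P)$ and $\int_P\widetilde\Pi^\nabla_Pv=\int_Pv$. Put $$|||v|||^2=\sum_{P\in\Omega_h}\Big(\|\nabla\widetilde\Pi^\nabla_Pv\|_{L^2(P)}^2+h_P^{-2}\|\Pi^\Delta_P(v-\widetilde\Pi^\nabla_Pv)\|_{L^2(P)}^2+h_P^{-1}\|v-\widetilde\Pi^\nabla_Pv\|_{L^2(\partial P)}^2\Big).$$ **Statement.** 1.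 These objects are well defined: for every element $P$, $\widetilde{\mathbb P}_k(P)\subset\widetilde V_h(P)$, the projections $\widetilde\Pi^\nabla_Pv$ (for $v\in\widetilde V_h(P)$) and $\Pi^\Delta_Pv$ (for $v\in L^2(P)$) exist and are unique, and a function of $H^1(P)$ has at most one trace in $L^2(\partial P)$, where $g\in L^2(\partial P)$ is called the trace of $v\in H^1(P)$ if some sequence of functions smooth on $\mathbb R^2$ converges to $v$ in $H^1(P)$ and to $g$ in $L^2(\partial P)$. 2. $|||\cdot|||$ is a norm on $\widetilde V_{h,0}$. 3. Consequently the discrete scheme is well posed. For each $P$ let $S^P$ be a symmetric positive semi-definite bilinear form on $\widetilde V_h(P)$ such that $S^P(w,v)=0$ for all $w\in\widetilde{\mathbb P}_k(P)$ and $v\in\widetilde V_h(P)$, and such that, for some constants $c,C>0$ and all $P$, $$c\,\big(h_P^{-2}\|\Pi^\Delta_Pv\|_{L^2(P)}^2+h_P^{-1}\|v\|_{L^2(\partial P)}^2\big)\le S^P(v,v)\le C\,\big(h_P^{-2}\|\Pi^\Delta_Pv\|_{L^2(P)}^2+h_P^{-1}\|v\|_{L^2(\partial P)}^2\big)$$ whenever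 $v\in\widetilde V_h(P)$ and $\widetilde\Pi^\nabla_Pv=0$. Let $a_h(u,v)=\sum_P\big(\int_P\nabla\widetilde\Pi^\nabla_Pu\cdot\nabla\widetilde\Pi^\nabla_Pv+S^P(u,v)\big)$. Then for every $f\in L^2(\Omega)$ there is exactly one $u\in\widetilde V_{h,0}$ with $$a_h(u,v)=\sum_{P\in\Omega_h}\int_P(\Pi^\Delta_Pf)\,v\qquad\forall v\in\widetilde V_{h,0},$$ and $|||u|||\le M\|f\|_{L^2(\Omega)}$ with a constant $M$ that does not depend on $f$. -/

import Mathlib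

open MeasureTheory Filter Topology Set
open scoped ContDiff

namespace XVEM

noncomputable section

/-! ### Weak derivatives and traces in the plane -/

/-- The Euclidean plane `ℝ²`. -/
abbrev Plane : Type := EuclideanSpace ℝ (Fin 2)

/-- `φ ∈ C_c^∞(U)`. -/
structure IsTestFunction (U : Set Plane) (φ : Plane → ℝ) : Prop where
  smooth : ContDiff ℝ ∞ φ
  compact : HasCompactSupport φ
  support_subset : tsupport φ ⊆ U

/-- `v ∈ H¹(U)` and `∇v = G` in the sense of distributions on the open set `U`. -/
structure HasWeakGrad (U : Set Plane) (v : Plane → ℝ) (G : Plane → Plane) : Prop where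
  memLp : MemLp v 2 (volume.restrict U)
  memLp_grad : MemLp G 2 (volume.restrict U)
  integral_eq : ∀ φ : Plane → ℝ, IsTestFunction U φ → ∀ i : Fin 2,
    ∫ x in U, v x * gradient φ x i = - ∫ x in U, G x i * φ x

/-- `v ∈ H¹(U)`. -/
def MemH1 (U : Set Plane) (v : Plane → ℝ) : Prop := ∃ G, HasWeakGrad U v G

/-- The weak gradient on `U` of a function of `H¹(U)` (it is unique almost everywhere on `U`). -/
def weakGrad (U : Set Plane) (v : Plane → ℝ) : Plane → Plane :=
  Classical.epsilon (HasWeakGrad U v)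

/-- `v ∈ H¹(U)`, and `Δv = r ∈ L²(U)` in the sense of distributions on `U`. -/
def HasWeakLaplacian (U : Set Plane) (v r : Plane → ℝ) : Prop :=
  ∃ G, HasWeakGrad U v G ∧ MemLp r 2 (volume.restrict U) ∧
    ∀ φ : Plane → ℝ, IsTestFunction U φ →
      ∫ x in U, inner ℝ (G x) (gradient φ x) = - ∫ x in U, r x * φ x

/-- The arc-length measure on the boundary of `U`. -/
def bdryMeasure (U : Set Plane) : Measure Plane := (μH[1]).restrict (frontier U)

/-- `g ∈ L²(∂U)` is the trace on `∂U` of `v ∈ H¹(U)`: some sequence of functions that are smooth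
on the plane converges to `v` in `H¹(U)`, and its restrictions to `∂U` converge to `g` in
`L²(∂U)`. (The trace operator is the continuous extension of the restriction to the boundary.) -/
def HasTrace (U : Set Plane) (v g : Plane → ℝ) : Prop :=
  ∃ G, HasWeakGrad U v G ∧ MemLp g 2 (bdryMeasure U) ∧
    ∃ φ : ℕ → Plane → ℝ, (∀ n, ContDiff ℝ ∞ (φ n)) ∧
      Tendsto (fun n => eLpNorm (φ n - v) 2 (volume.restrict U)) atTop (𝓝 0) ∧
      Tendsto (fun n => eLpNorm (gradient (φ n) - G) 2 (volume.restrict U)) atTop (𝓝 0) ∧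
      Tendsto (fun n => eLpNorm (φ n - g) 2 (bdryMeasure U)) atTop (𝓝 0)

/-- The trace on `∂U` of a function of `H¹(U)`. -/
def trace (U : Set Plane) (v : Plane → ℝ) : Plane → ℝ := Classical.epsilon (HasTrace U v)

/-! ### Polygonal domains and meshes -/

/-- The closed segment with the given pair of endpoints. -/
abbrev seg (e : Plane × Plane) : Set Plane := segment ℝ e.1 e.2

/-- A bounded open set whose boundary is made of finitely many segments. -/
structure IsPolygonalDomain (Ω : Set Plane) : Prop where
  isOpen : IsOpen Ω
  isBounded : Bornology.IsBounded Ω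
  frontier_eq : ∃ s : Finset (Plane × Plane), frontier Ω = ⋃ e ∈ s, seg e

/-- A mesh of `Ω`: finitely many compact polygonal elements with disjoint interiors that cover the
closure of `Ω`, with the set of mesh edges (each given by its two endpoints). The edges meet at
most at their endpoints, the boundary of each element is a union of edges, and each edge is
either a boundary edge or an interior edge. Collinear consecutive edges of an element
(hanging nodes) are allowed. -/
structure PolygonalMesh (Ω : Set Plane) where
  /-- the mesh elements -/
  cells : Finset (Set Plane)
  /-- the mesh edges -/
  edges : Finset (Plane × Plane)
  isCompact : ∀ P ∈ cells, IsCompact P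
  interior_nonempty : ∀ P ∈ cells, (interior P).Nonempty
  closure_interior : ∀ P ∈ cells, closure (interior P) = P
  interior_subset : ∀ P ∈ cells, interior P ⊆ Ω
  disjoint_interior : ∀ P ∈ cells, ∀ Q ∈ cells, P ≠ Q → Disjoint (interior P) (interior Q)
  closure_eq : closure Ω = ⋃ P ∈ cells, P
  edge_ne : ∀ e ∈ edges, e.1 ≠ e.2
  edge_disjoint : ∀ e ∈ edges, ∀ e' ∈ edges, e ≠ e' →
    Disjoint (openSegment ℝ e.1 e.2) (seg e')
  edge_cell : ∀ e ∈ edges, ∃ P ∈ cells, seg e ⊆ frontier P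
  edge_bdry : ∀ e ∈ edges, seg e ⊆ frontier Ω ∨ openSegment ℝ e.1 e.2 ⊆ Ω
  frontier_eq : ∀ P ∈ cells, frontier P = ⋃ e ∈ {e | e ∈ edges ∧ seg e ⊆ frontier P}, seg e

/-- Every element `P` is star-shaped with respect to (each point of) a ball of radius `ϱ h_P`,
with `h_P` the diameter of `P`. -/
def PolygonalMesh.IsRegular {Ω : Set Plane} (𝒯 : PolygonalMesh Ω) (ϱ : ℝ) : Prop :=
  ∀ P ∈ 𝒯.cells, ∃ x, Metric.ball x (ϱ * Metric.diam P) ⊆ P ∧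
    ∀ y ∈ Metric.ball x (ϱ * Metric.diam P), StarConvex ℝ y P

/-! ### Polynomial and enriched spaces

The enrichment space is a space `Ψ` of functions, of which only the values on the closure of `Ω`
matter. Spaces such as `ℙ_k(P) + Ψ(P)` consist of the restrictions to `P` of the members of
`ℙ_k + Ψ`. -/

/-- Evaluation of a polynomial in two variables, as a function on the plane. -/
def evalPoly : MvPolynomial (Fin 2) ℝ →ₗ[ℝ] (Plane → ℝ) :=
  LinearMap.pi fun x => (MvPolynomial.aeval fun i => x i).toLinearMap

/-- Polynomial functions of total degree at most `m`. -/
def polySpace (m : ℕ) : Submodule ℝ (Plane → ℝ) :=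
  (MvPolynomial.restrictTotalDegree (Fin 2) ℝ m).map evalPoly

/-- `ℙ_k + Ψ`. -/
def extPoly (Ψ : Submodule ℝ (Plane → ℝ)) (k : ℕ) : Submodule ℝ (Plane → ℝ) := polySpace k ⊔ Ψ

/-- The regularity of the enrichment space: `Ψ(Ω) ⊆ H¹(Ω) ∩ C⁰(closure Ω)`, and the Laplacian of
each of its members is square-integrable on each element. -/
structure IsEnrichment {Ω : Set Plane} (𝒯 : PolygonalMesh Ω) (Ψ : Submodule ℝ (Plane → ℝ)) :
    Prop where
  memH1 : ∀ w ∈ Ψ, MemH1 Ω w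
  continuousOn : ∀ w ∈ Ψ, ContinuousOn w (closure Ω)
  laplacian : ∀ w ∈ Ψ, ∀ P ∈ 𝒯.cells, ∃ s, HasWeakLaplacian (interior P) w s

/-! Linearity of the notions above, needed to build the discrete spaces. -/

theorem contDiff_gradient_continuous {φ : Plane → ℝ} (h : ContDiff ℝ ∞ φ) :
    Continuous (gradient φ) := by
  have h1 : Continuous (fderiv ℝ φ) := h.continuous_fderiv (by simp)
  exact (InnerProductSpace.toDual ℝ Plane).symm.continuous.comp h1

theorem IsTestFunction.memLp {U : Set Plane} {φ : Plane → ℝ} (h : IsTestFunction U φ)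
    (μ : Measure Plane) [IsFiniteMeasureOnCompacts μ] : MemLp φ 2 μ :=
  h.smooth.continuous.memLp_of_hasCompactSupport h.compact

theorem IsTestFunction.memLp_gradient {U : Set Plane} {φ : Plane → ℝ} (h : IsTestFunction U φ)
    (μ : Measure Plane) [IsFiniteMeasureOnCompacts μ] : MemLp (gradient φ) 2 μ := by
  refine (contDiff_gradient_continuous h.smooth).memLp_of_hasCompactSupport ?_
  exact (h.compact.fderiv (𝕜 := ℝ)).comp_left (map_zero (InnerProductSpace.toDual ℝ Plane).symm)

theorem memLp_coord {μ : Measure Plane} {G : Plane → Plane} (h : MemLp G 2 μ) (i : Fin 2) :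
    MemLp (fun x => G x i) 2 μ :=
  (EuclideanSpace.proj i : Plane →L[ℝ] ℝ).comp_memLp' h

theorem integrable_mul' {μ : Measure Plane} {v w : Plane → ℝ} (h : MemLp v 2 μ)
    (h' : MemLp w 2 μ) : Integrable (fun x => v x * w x) μ :=
  h.integrable_mul h'

theorem integrable_inner {μ : Measure Plane} {G H : Plane → Plane} (h : MemLp G 2 μ)
    (h' : MemLp H 2 μ) : Integrable (fun x => inner ℝ (G x) (H x)) μ := by
  simp only [PiLp.inner_apply, Fin.sum_univ_two]
  exact (integrable_mul' (memLp_coord h' 0) (memLp_coord h 0)).add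
    (integrable_mul' (memLp_coord h' 1) (memLp_coord h 1))

theorem HasWeakGrad.add {U : Set Plane} {v w : Plane → ℝ} {G H : Plane → Plane}
    (hv : HasWeakGrad U v G) (hw : HasWeakGrad U w H) : HasWeakGrad U (v + w) (G + H) := by
  refine ⟨hv.memLp.add hw.memLp, hv.memLp_grad.add hw.memLp_grad, fun φ hφ i => ?_⟩
  have hd := memLp_coord (hφ.memLp_gradient (volume.restrict U)) i
  have hp := hφ.memLp (volume.restrict U)
  simp only [Pi.add_apply, PiLp.add_apply, add_mul]
  rw [integral_add (integrable_mul' hv.memLp hd) (integrable_mul' hw.memLp hd),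
    integral_add (integrable_mul' (memLp_coord hv.memLp_grad i) hp)
      (integrable_mul' (memLp_coord hw.memLp_grad i) hp),
    hv.integral_eq φ hφ i, hw.integral_eq φ hφ i]
  ring

theorem HasWeakGrad.smul {U : Set Plane} {v : Plane → ℝ} {G : Plane → Plane} (c : ℝ)
    (hv : HasWeakGrad U v G) : HasWeakGrad U (c • v) (c • G) := by
  refine ⟨hv.memLp.const_smul c, hv.memLp_grad.const_smul c, fun φ hφ i => ?_⟩
  simp only [Pi.smul_apply, PiLp.smul_apply, smul_eq_mul, mul_assoc]
  rw [integral_const_mul, integral_const_mul, hv.integral_eq φ hφ i]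
  ring

theorem HasWeakGrad.zero (U : Set Plane) : HasWeakGrad U 0 0 :=
  ⟨MemLp.zero, MemLp.zero, fun φ _ i => by simp⟩

theorem HasWeakGrad.congr {U : Set Plane} {v w : Plane → ℝ} {G : Plane → Plane}
    (h : v =ᵐ[volume.restrict U] w) (hv : HasWeakGrad U v G) : HasWeakGrad U w G := by
  refine ⟨hv.memLp.ae_eq h, hv.memLp_grad, fun φ hφ i => ?_⟩
  rw [← hv.integral_eq φ hφ i]
  exact integral_congr_ae (h.mono fun x hx => by simp only [hx])

theorem HasWeakLaplacian.add {U : Set Plane} {v w r s : Plane → ℝ}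
    (hv : HasWeakLaplacian U v r) (hw : HasWeakLaplacian U w s) :
    HasWeakLaplacian U (v + w) (r + s) := by
  obtain ⟨G, hG, hr, h1⟩ := hv
  obtain ⟨H, hH, hs, h2⟩ := hw
  refine ⟨G + H, hG.add hH, hr.add hs, fun φ hφ => ?_⟩
  have hd := hφ.memLp_gradient (volume.restrict U)
  have hp := hφ.memLp (volume.restrict U)
  simp only [Pi.add_apply, inner_add_left, add_mul]
  rw [integral_add (integrable_inner hG.memLp_grad hd) (integrable_inner hH.memLp_grad hd),
    integral_add (integrable_mul' hr hp) (integrable_mul' hs hp), h1 φ hφ, h2 φ hφ]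
  ring

theorem HasWeakLaplacian.smul {U : Set Plane} {v r : Plane → ℝ} (c : ℝ)
    (hv : HasWeakLaplacian U v r) : HasWeakLaplacian U (c • v) (c • r) := by
  obtain ⟨G, hG, hr, h1⟩ := hv
  refine ⟨c • G, hG.smul c, hr.const_smul c, fun φ hφ => ?_⟩
  simp only [Pi.smul_apply, real_inner_smul_left, smul_eq_mul, mul_assoc]
  rw [integral_const_mul, integral_const_mul, h1 φ hφ]
  ring

theorem HasWeakLaplacian.zero (U : Set Plane) : HasWeakLaplacian U 0 0 :=
  ⟨0, HasWeakGrad.zero U, MemLp.zero, fun φ _ => by simp⟩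

theorem HasWeakLaplacian.congr {U : Set Plane} {v w r : Plane → ℝ}
    (h : v =ᵐ[volume.restrict U] w) (hv : HasWeakLaplacian U v r) : HasWeakLaplacian U w r := by
  obtain ⟨G, hG, hr⟩ := hv
  exact ⟨G, hG.congr h, hr⟩

theorem gradient_add_smooth {φ ψ : Plane → ℝ} (h : ContDiff ℝ ∞ φ) (h' : ContDiff ℝ ∞ ψ) :
    gradient (φ + ψ) = gradient φ + gradient ψ := by
  funext x
  simp [gradient, fderiv_add (h.differentiable (by simp) x) (h'.differentiable (by simp) x)]

theorem gradient_smul_smooth {φ : Plane → ℝ} (c : ℝ) (h : ContDiff ℝ ∞ φ) :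
    gradient (c • φ) = c • gradient φ := by
  funext x
  simp [gradient, fderiv_const_smul (h.differentiable (by simp) x) c]

theorem tendsto_eLpNorm_add {F : Type*} [NormedAddCommGroup F] {μ : Measure Plane}
    {φ ψ : ℕ → Plane → F} {v w : Plane → F}
    (h1 : ∀ n, AEStronglyMeasurable (φ n) μ) (h2 : ∀ n, AEStronglyMeasurable (ψ n) μ)
    (hv : AEStronglyMeasurable v μ) (hw : AEStronglyMeasurable w μ)
    (h : Tendsto (fun n => eLpNorm (φ n - v) 2 μ) atTop (𝓝 0))
    (h' : Tendsto (fun n => eLpNorm (ψ n - w) 2 μ) atTop (𝓝 0)) :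
    Tendsto (fun n => eLpNorm ((φ n + ψ n) - (v + w)) 2 μ) atTop (𝓝 0) := by
  refine tendsto_of_tendsto_of_tendsto_of_le_of_le tendsto_const_nhds
    (by simpa using h.add h') (fun n => zero_le) fun n => ?_
  have : (φ n + ψ n) - (v + w) = (φ n - v) + (ψ n - w) := by abel
  rw [this]
  exact eLpNorm_add_le ((h1 n).sub hv) ((h2 n).sub hw) (by norm_num)

theorem tendsto_eLpNorm_smul {F : Type*} [NormedAddCommGroup F] [NormedSpace ℝ F]
    {μ : Measure Plane} {φ : ℕ → Plane → F} {v : Plane → F} (c : ℝ)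
    (h : Tendsto (fun n => eLpNorm (φ n - v) 2 μ) atTop (𝓝 0)) :
    Tendsto (fun n => eLpNorm (c • φ n - c • v) 2 μ) atTop (𝓝 0) := by
  have : ∀ n, eLpNorm (c • φ n - c • v) 2 μ = ‖c‖ₑ * eLpNorm (φ n - v) 2 μ := fun n => by
    rw [← smul_sub, eLpNorm_const_smul]
  simp only [this]
  simpa using ENNReal.Tendsto.const_mul h (Or.inr (by simp))

theorem HasTrace.add {U : Set Plane} {v w g h : Plane → ℝ} (hv : HasTrace U v g)
    (hw : HasTrace U w h) : HasTrace U (v + w) (g + h) := by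
  obtain ⟨G, hG, hg, φ, hφ, a1, a2, a3⟩ := hv
  obtain ⟨H, hH, hh, ψ, hψ, b1, b2, b3⟩ := hw
  refine ⟨G + H, hG.add hH, hg.add hh, fun n => φ n + ψ n, fun n => (hφ n).add (hψ n), ?_, ?_, ?_⟩
  · exact tendsto_eLpNorm_add (fun n => (hφ n).continuous.aestronglyMeasurable)
      (fun n => (hψ n).continuous.aestronglyMeasurable) hG.memLp.1 hH.memLp.1 a1 b1
  · simp only [gradient_add_smooth (hφ _) (hψ _)]
    exact tendsto_eLpNorm_add
      (fun n => (contDiff_gradient_continuous (hφ n)).aestronglyMeasurable)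
      (fun n => (contDiff_gradient_continuous (hψ n)).aestronglyMeasurable)
      hG.memLp_grad.1 hH.memLp_grad.1 a2 b2
  · exact tendsto_eLpNorm_add (fun n => (hφ n).continuous.aestronglyMeasurable)
      (fun n => (hψ n).continuous.aestronglyMeasurable) hg.1 hh.1 a3 b3

theorem HasTrace.smul {U : Set Plane} {v g : Plane → ℝ} (c : ℝ) (hv : HasTrace U v g) :
    HasTrace U (c • v) (c • g) := by
  obtain ⟨G, hG, hg, φ, hφ, a1, a2, a3⟩ := hv
  refine ⟨c • G, hG.smul c, hg.const_smul c, fun n => c • φ n,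
    fun n => contDiff_const.smul (hφ n), tendsto_eLpNorm_smul c a1, ?_, tendsto_eLpNorm_smul c a3⟩
  simp only [gradient_smul_smooth c (hφ _)]
  exact tendsto_eLpNorm_smul c a2

theorem HasTrace.zero (U : Set Plane) : HasTrace U 0 0 := by
  refine ⟨0, HasWeakGrad.zero U, MemLp.zero, fun _ => 0, fun _ => contDiff_const, ?_, ?_, ?_⟩
  · simp
  · have : gradient (0 : Plane → ℝ) = 0 := by
      funext x
      simp [gradient]
    simp [this]
  · simp

theorem HasTrace.congr {U : Set Plane} {v w g : Plane → ℝ}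
    (h : v =ᵐ[volume.restrict U] w) (hv : HasTrace U v g) : HasTrace U w g := by
  obtain ⟨G, hG, hg, φ, hφ, a1, a2, a3⟩ := hv
  refine ⟨G, hG.congr h, hg, φ, hφ, a1.congr fun n => ?_, a2, a3⟩
  exact eLpNorm_congr_ae (h.mono fun x hx => by simp only [Pi.sub_apply, hx])

/-! ### The discrete spaces -/

/-- `ℙ_l(P) + ΔΨ(P)`, as a space of functions of which only the almost everywhere values on the
open set `U = interior P` matter. -/
def extLap (Ψ : Submodule ℝ (Plane → ℝ)) (l : ℕ) (U : Set Plane) : Submodule ℝ (Plane → ℝ) where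
  carrier := {r | ∃ q ∈ polySpace l, ∃ w ∈ Ψ, ∃ s, HasWeakLaplacian U w s ∧ r = q + s}
  add_mem' := by
    rintro _ _ ⟨q, hq, w, hw, s, hs, rfl⟩ ⟨q', hq', w', hw', s', hs', rfl⟩
    exact ⟨q + q', add_mem hq hq', w + w', add_mem hw hw', s + s', hs.add hs',
      add_add_add_comm _ _ _ _⟩
  zero_mem' := ⟨0, zero_mem _, 0, zero_mem _, 0, HasWeakLaplacian.zero U, (add_zero 0).symm⟩
  smul_mem' := by
    rintro c _ ⟨q, hq, w, hw, s, hs, rfl⟩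
    exact ⟨c • q, Submodule.smul_mem _ c hq, c • w, Submodule.smul_mem _ c hw, c • s, hs.smul c,
      smul_add c q s⟩

/-- The local space of the extended virtual element method on the element `P`: functions of
`H¹(P)` with Laplacian in `ℙ_l(P) + ΔΨ(P)`, where `l = max {0, k - 2}` (truncated subtraction),
and with a trace that is continuous on `∂P` and belongs to `ℙ_k(E) + Ψ(E)` on each mesh edge
`E ⊆ ∂P`. Its members are functions on the plane of which only the almost everywhere values on
`P` matter. -/
def localSpace {Ω : Set Plane} (𝒯 : PolygonalMesh Ω) (Ψ : Submodule ℝ (Plane → ℝ)) (k : ℕ)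
    (P : Set Plane) : Submodule ℝ (Plane → ℝ) where
  carrier := {v | (∃ r ∈ extLap Ψ (k - 2) (interior P), HasWeakLaplacian (interior P) v r) ∧
    ∃ g, HasTrace (interior P) v g ∧ ContinuousOn g (frontier P) ∧
      ∀ e ∈ 𝒯.edges, seg e ⊆ frontier P → ∃ q ∈ extPoly Ψ k, EqOn g q (seg e)}
  add_mem' := by
    rintro v v' ⟨⟨r, hr, hv⟩, g, hg, hc, he⟩ ⟨⟨r', hr', hv'⟩, g', hg', hc', he'⟩
    refine ⟨⟨r + r', add_mem hr hr', hv.add hv'⟩, g + g', hg.add hg', hc.add hc', ?_⟩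
    intro e h1 h2
    obtain ⟨q, hq, h3⟩ := he e h1 h2
    obtain ⟨q', hq', h4⟩ := he' e h1 h2
    exact ⟨q + q', add_mem hq hq', fun x hx => by simp [h3 hx, h4 hx]⟩
  zero_mem' := ⟨⟨0, zero_mem _, HasWeakLaplacian.zero _⟩, 0, HasTrace.zero _, continuousOn_const,
    fun _ _ _ => ⟨0, zero_mem _, fun _ _ => rfl⟩⟩
  smul_mem' := by
    rintro c v ⟨⟨r, hr, hv⟩, g, hg, hc, he⟩
    refine ⟨⟨c • r, Submodule.smul_mem _ c hr, hv.smul c⟩, c • g, hg.smul c, hc.const_smul c, ?_⟩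
    intro e h1 h2
    obtain ⟨q, hq, h3⟩ := he e h1 h2
    exact ⟨c • q, Submodule.smul_mem _ c hq, fun x hx => by simp [h3 hx]⟩

theorem localSpace_congr {Ω : Set Plane} (𝒯 : PolygonalMesh Ω) (Ψ : Submodule ℝ (Plane → ℝ))
    (k : ℕ) (P : Set Plane) {v w : Plane → ℝ} (h : v =ᵐ[volume.restrict (interior P)] w)
    (hv : v ∈ localSpace 𝒯 Ψ k P) : w ∈ localSpace 𝒯 Ψ k P := by
  obtain ⟨⟨r, hr, h1⟩, g, hg, h2⟩ := hv
  exact ⟨⟨r, hr, h1.congr h⟩, g, hg.congr h, h2⟩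

/-- `L²(Ω)`. -/
abbrev L2 (Ω : Set Plane) : Type := Lp ℝ 2 (volume.restrict Ω : Measure Plane)

theorem ae_cell {Ω : Set Plane} (𝒯 : PolygonalMesh Ω) {P : Set Plane} (hP : P ∈ 𝒯.cells)
    {v w : Plane → ℝ} (h : v =ᵐ[volume.restrict Ω] w) :
    v =ᵐ[volume.restrict (interior P)] w :=
  h.filter_mono (ae_mono (Measure.restrict_mono (𝒯.interior_subset P hP) le_rfl))

/-- The global space of the extended virtual element method: functions of `H¹(Ω)`, up to almost
everywhere equality, with restriction to each element in the local space. -/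
def globalSpace {Ω : Set Plane} (𝒯 : PolygonalMesh Ω) (Ψ : Submodule ℝ (Plane → ℝ)) (k : ℕ) :
    Submodule ℝ (L2 Ω) where
  carrier := {v | MemH1 Ω v ∧ ∀ P ∈ 𝒯.cells, ⇑v ∈ localSpace 𝒯 Ψ k P}
  add_mem' := by
    rintro v w ⟨⟨G, hG⟩, hv⟩ ⟨⟨H, hH⟩, hw⟩
    exact ⟨⟨G + H, (hG.add hH).congr (Lp.coeFn_add v w).symm⟩, fun P hP =>
      localSpace_congr 𝒯 Ψ k P (ae_cell 𝒯 hP (Lp.coeFn_add v w).symm)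
        (add_mem (hv P hP) (hw P hP))⟩
  zero_mem' :=
    ⟨⟨0, (HasWeakGrad.zero Ω).congr (Lp.coeFn_zero ℝ 2 (volume.restrict Ω)).symm⟩, fun P hP =>
      localSpace_congr 𝒯 Ψ k P (ae_cell 𝒯 hP (Lp.coeFn_zero ℝ 2 (volume.restrict Ω)).symm)
        (zero_mem _)⟩
  smul_mem' := by
    rintro c v ⟨⟨G, hG⟩, hv⟩
    exact ⟨⟨c • G, (hG.smul c).congr (Lp.coeFn_smul c v).symm⟩, fun P hP =>
      localSpace_congr 𝒯 Ψ k P (ae_cell 𝒯 hP (Lp.coeFn_smul c v).symm)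
        (Submodule.smul_mem _ c (hv P hP))⟩

/-- The functions of the global space with zero trace on `∂Ω`. -/
def globalSpaceZero {Ω : Set Plane} (𝒯 : PolygonalMesh Ω) (Ψ : Submodule ℝ (Plane → ℝ)) (k : ℕ) :
    Submodule ℝ (L2 Ω) where
  carrier := {v | v ∈ globalSpace 𝒯 Ψ k ∧ HasTrace Ω v 0}
  add_mem' := by
    rintro v w ⟨hv, hv0⟩ ⟨hw, hw0⟩
    exact ⟨add_mem hv hw, by simpa using (hv0.add hw0).congr (Lp.coeFn_add v w).symm⟩
  zero_mem' :=
    ⟨zero_mem _, (HasTrace.zero Ω).congr (Lp.coeFn_zero ℝ 2 (volume.restrict Ω)).symm⟩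
  smul_mem' := by
    rintro c v ⟨hv, hv0⟩
    exact ⟨Submodule.smul_mem _ c hv, by simpa using (hv0.smul c).congr (Lp.coeFn_smul c v).symm⟩

/-! ### Projectors and the discrete norm -/

/-- `q ∈ ℙ_k(P) + Ψ(P)` is the extended elliptic projection of `v` on the element `P`. -/
structure IsEllProj (Ψ : Submodule ℝ (Plane → ℝ)) (k : ℕ) (P : Set Plane) (v q : Plane → ℝ) :
    Prop where
  mem : q ∈ extPoly Ψ k
  grad_eq : ∀ p ∈ extPoly Ψ k,
    ∫ x in interior P, inner ℝ (weakGrad (interior P) q x) (weakGrad (interior P) p x) =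
      ∫ x in interior P, inner ℝ (weakGrad (interior P) v x) (weakGrad (interior P) p x)
  mean_eq : ∫ x in interior P, q x = ∫ x in interior P, v x

/-- The extended elliptic projector on the element `P`. -/
def ellProj (Ψ : Submodule ℝ (Plane → ℝ)) (k : ℕ) (P : Set Plane) (v : Plane → ℝ) : Plane → ℝ :=
  Classical.epsilon (IsEllProj Ψ k P v)

/-- `r` is the `L²(P)`-orthogonal projection of `v` on `ℙ_l(P) + ΔΨ(P)`. -/
structure IsLapProj (Ψ : Submodule ℝ (Plane → ℝ)) (l : ℕ) (P : Set Plane) (v r : Plane → ℝ) :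
    Prop where
  mem : r ∈ extLap Ψ l (interior P)
  orthogonal : ∀ s ∈ extLap Ψ l (interior P), ∫ x in interior P, (v x - r x) * s x = 0

/-- The `L²(P)`-orthogonal projector on `ℙ_l(P) + ΔΨ(P)`. -/
def lapProj (Ψ : Submodule ℝ (Plane → ℝ)) (l : ℕ) (P : Set Plane) (v : Plane → ℝ) : Plane → ℝ :=
  Classical.epsilon (IsLapProj Ψ l P v)

/-- The sum of the scaled squared norms `h_P⁻² ‖Π v‖²_P + h_P⁻¹ ‖v‖²_∂P`, where `Π` is the
`L²(P)`-orthogonal projector on `ℙ_l(P) + ΔΨ(P)` and `l = max {0, k - 2}`. -/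
def penalty (Ψ : Submodule ℝ (Plane → ℝ)) (k : ℕ) (P : Set Plane) (v : Plane → ℝ) : ℝ :=
  (Metric.diam P ^ 2)⁻¹ * (∫ x in interior P, lapProj Ψ (k - 2) P v x ^ 2) +
    (Metric.diam P)⁻¹ * ∫ x, trace (interior P) v x ^ 2 ∂(bdryMeasure (interior P))

/-- The square of the local discrete seminorm on the element `P`. -/
def localNormSq (Ψ : Submodule ℝ (Plane → ℝ)) (k : ℕ) (P : Set Plane) (v : Plane → ℝ) : ℝ :=
  (∫ x in interior P, ‖weakGrad (interior P) (ellProj Ψ k P v) x‖ ^ 2) +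
    penalty Ψ k P (v - ellProj Ψ k P v)

/-- The global discrete norm. -/
def discreteNorm {Ω : Set Plane} (𝒯 : PolygonalMesh Ω) (Ψ : Submodule ℝ (Plane → ℝ)) (k : ℕ)
    (v : Plane → ℝ) : ℝ :=
  √(∑ P ∈ 𝒯.cells, localNormSq Ψ k P v)

/-! ### The scheme -/

/-- A family of stabilisation terms: symmetric positive semi-definite bilinear forms on the local
spaces that are coercive and bounded on the kernel of the elliptic projector and vanish when one
argument belongs to `ℙ_k(P) + Ψ(P)`. -/
structure IsStabilisation {Ω : Set Plane} (𝒯 : PolygonalMesh Ω) (Ψ : Submodule ℝ (Plane → ℝ))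
    (k : ℕ) (S : ∀ P : Set Plane, LinearMap.BilinForm ℝ (localSpace 𝒯 Ψ k P)) : Prop where
  symm : ∀ P ∈ 𝒯.cells, ∀ u v, S P u v = S P v u
  nonneg : ∀ P ∈ 𝒯.cells, ∀ v, 0 ≤ S P v v
  coercive_bounded : ∃ c > 0, ∃ C > 0, ∀ P ∈ 𝒯.cells, ∀ v : localSpace 𝒯 Ψ k P,
    IsEllProj Ψ k P v 0 → c * penalty Ψ k P v ≤ S P v v ∧ S P v v ≤ C * penalty Ψ k P v
  consistent : ∀ P ∈ 𝒯.cells, ∀ w v : localSpace 𝒯 Ψ k P,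
    (w : Plane → ℝ) ∈ extPoly Ψ k → S P w v = 0

/-- The discrete bilinear form. -/
def discreteForm {Ω : Set Plane} {𝒯 : PolygonalMesh Ω} {Ψ : Submodule ℝ (Plane → ℝ)} {k : ℕ}
    (S : ∀ P : Set Plane, LinearMap.BilinForm ℝ (localSpace 𝒯 Ψ k P))
    (u v : globalSpace 𝒯 Ψ k) : ℝ :=
  ∑ P : 𝒯.cells,
    ((∫ x in interior P.1, inner ℝ (weakGrad (interior P.1) (ellProj Ψ k P (u : L2 Ω)) x)
        (weakGrad (interior P.1) (ellProj Ψ k P (v : L2 Ω)) x)) +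
      S P ⟨(u : L2 Ω), u.2.2 P P.2⟩ ⟨(v : L2 Ω), v.2.2 P P.2⟩)

/-- The discrete right-hand side, with the source term projected on each element. -/
def discreteRhs {Ω : Set Plane} (𝒯 : PolygonalMesh Ω) (Ψ : Submodule ℝ (Plane → ℝ)) (k : ℕ)
    (f v : L2 Ω) : ℝ :=
  ∑ P ∈ 𝒯.cells, ∫ x in interior P, lapProj Ψ (k - 2) P f x * v x

/-- `u` solves the discrete problem with source term `f`. -/
def IsDiscreteSolution {Ω : Set Plane} {𝒯 : PolygonalMesh Ω} {Ψ : Submodule ℝ (Plane → ℝ)}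
    {k : ℕ} (S : ∀ P : Set Plane, LinearMap.BilinForm ℝ (localSpace 𝒯 Ψ k P)) (f : L2 Ω)
    (u : globalSpaceZero 𝒯 Ψ k) : Prop :=
  ∀ v : globalSpaceZero 𝒯 Ψ k,
    discreteForm S ⟨u, u.2.1⟩ ⟨v, v.2.1⟩ = discreteRhs 𝒯 Ψ k f v

end

end XVEM

/-! The discrete norm of `v` is the norm of the image of `v` under a linear map, `discreteMap`, into
a finite product of `L²` spaces. The seminorm axioms are therefore automatic, and what has to be
proved is that this map is injective.

Suppose the discrete norm of `v` vanishes, and let `q` be the elliptic projection of `v` on an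
element `P`. Then ∇q = 0, the trace of v - q on ∂P is zero, and v - q is orthogonal in `L²(P)` to
ℙ_l + ΔΨ, a space that contains Δv. Green's formula gives ∫|∇v|² = ∫∇v·∇(v - q) = -∫Δv (v - q) = 0,
so `v` is constant on every element (`hasWeakGrad_zero_of_localNormSq`). Since `v` lies in `H¹(Ω)`,
the constants of elements that meet inside Ω coincide, and the constant of an element with an edge
on ∂Ω is zero. The open region left over by the elements of constant zero then has a frontier made
of edge endpoints only. A bounded open set of the plane with finite frontier is empty, hence v = 0
(`ae_eq_zero_of_hasTrace_zero`).

Green's formula `PolyCell.green` is proved directly on star-shaped cells. Averaging over the points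
(1 - δ)x + δy, with y in the ball of star-shapedness, stays inside the cell, so smooth functions are
dense without any extension operator. Cone coordinates over an edge, with apex at the centre of the
ball, reduce trace and strip inequalities to one-dimensional estimates along rays. For a function
`u` of zero trace, the norm of `u` on a strip of width δ is O(δ); this balances the gradient O(1/δ)
of a cutoff function, and the remaining factor, the norm of the other field on the strip, tends to
zero.

For the scheme, a function with zero boundary values is determined by its Laplacians and its edge
traces, by the same Green argument, and these data range over a finite-dimensional space. The
discrete form is coercive for the discrete norm, because consistency allows `v` to be replaced by v
- q in the stabilisation. Hence it is injective as a map to the dual, and therefore bijective. The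
bound on the solution uses the equivalence of norms in finite dimension. -/

namespace XVEM

/-! ### Weak gradients and Laplacians: uniqueness, restriction, product rule. -/

section Basics

variable {F : Type*} [NormedAddCommGroup F] {U : Set Plane}

theorem eLpNorm_two_sq {μ : Measure Plane} (f : Plane → F) :
    eLpNorm f 2 μ ^ 2 = ∫⁻ x, ‖f x‖ₑ ^ 2 ∂μ := by
  have h := eLpNorm_nnreal_pow_eq_lintegral (μ := μ) (f := f) (p := 2) (by norm_num)
  simpa using h

theorem abs_integral_inner_le [InnerProductSpace ℝ F] {μ : Measure Plane} {f g : Plane → F}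
    (hf : MemLp f 2 μ) (hg : MemLp g 2 μ) :
    |∫ x, inner ℝ (f x) (g x) ∂μ| ≤ (eLpNorm f 2 μ).toReal * (eLpNorm g 2 μ).toReal := by
  have h1 : ∫ x, inner ℝ (f x) (g x) ∂μ = inner ℝ (hf.toLp f) (hg.toLp g) := by
    rw [L2.inner_def]
    refine integral_congr_ae ?_
    filter_upwards [hf.coeFn_toLp, hg.coeFn_toLp] with x h1 h2
    rw [h1, h2]
  rw [h1, ← Lp.norm_toLp f hf, ← Lp.norm_toLp g hg]
  exact abs_real_inner_le_norm _ _

theorem memLp_integrable_inner [InnerProductSpace ℝ F] {μ : Measure Plane} {f g : Plane → F}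
    (hf : MemLp f 2 μ) (hg : MemLp g 2 μ) : Integrable (fun x => inner ℝ (f x) (g x)) μ := by
  refine (L2.integrable_inner (𝕜 := ℝ) (hf.toLp f) (hg.toLp g)).congr ?_
  filter_upwards [hf.coeFn_toLp, hg.coeFn_toLp] with x h1 h2
  rw [h1, h2]

theorem tendsto_integral_inner [InnerProductSpace ℝ F] {μ : Measure Plane}
    {φ : ℕ → Plane → F} {f g : Plane → F} (hφ : ∀ n, MemLp (φ n) 2 μ)
    (hf : MemLp f 2 μ) (hg : MemLp g 2 μ)
    (h : Tendsto (fun n => eLpNorm (φ n - f) 2 μ) atTop (𝓝 0)) :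
    Tendsto (fun n => ∫ x, inner ℝ (φ n x) (g x) ∂μ) atTop (𝓝 (∫ x, inner ℝ (f x) (g x) ∂μ)) := by
  rw [tendsto_iff_norm_sub_tendsto_zero]
  have h0 : Tendsto (fun n => (eLpNorm (φ n - f) 2 μ).toReal * (eLpNorm g 2 μ).toReal)
      atTop (𝓝 0) := by
    have := ((ENNReal.tendsto_toReal ENNReal.zero_ne_top).comp h).mul_const
      (eLpNorm g 2 μ).toReal
    simpa using this
  refine squeeze_zero (fun n => norm_nonneg _) (fun n => ?_) h0
  have := abs_integral_inner_le ((hφ n).sub hf) hg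
  rw [← integral_sub (memLp_integrable_inner (hφ n) hg) (memLp_integrable_inner hf hg)]
  simpa [inner_sub_left] using this

theorem ae_eq_zero_of_test {μ : Measure Plane} [IsFiniteMeasureOnCompacts μ] {f : Plane → ℝ}
    (hU : IsOpen U) (hf : MemLp f 2 (μ.restrict U))
    (h : ∀ φ, IsTestFunction U φ → ∫ x in U, f x * φ x ∂μ = 0) : f =ᵐ[μ.restrict U] 0 := by
  have h1 := hU.ae_eq_zero_of_integral_contDiff_smul_eq_zero (μ := μ.restrict U) (f := f)
    ((hf.locallyIntegrable (by norm_num)).locallyIntegrableOn U) fun g h1 h2 h3 => by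
      simpa [mul_comm] using h g ⟨h1, h2, h3⟩
  filter_upwards [h1, ae_restrict_mem hU.measurableSet] with x h2 h3 using h2 h3

theorem HasWeakGrad.unique (hU : IsOpen U) {v : Plane → ℝ} {G H : Plane → Plane}
    (hG : HasWeakGrad U v G) (hH : HasWeakGrad U v H) : G =ᵐ[volume.restrict U] H := by
  have key : ∀ i : Fin 2, (fun x => G x i - H x i) =ᵐ[volume.restrict U] 0 := fun i => by
    refine ae_eq_zero_of_test hU ((memLp_coord hG.memLp_grad i).sub (memLp_coord hH.memLp_grad i))
      fun φ hφ => ?_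
    simp only [sub_mul]
    rw [integral_sub (integrable_mul' (memLp_coord hG.memLp_grad i) (hφ.memLp _))
      (integrable_mul' (memLp_coord hH.memLp_grad i) (hφ.memLp _))]
    linarith [hG.integral_eq φ hφ i, hH.integral_eq φ hφ i]
  filter_upwards [key 0, key 1] with x h0 h1
  ext i
  fin_cases i
  · exact sub_eq_zero.1 h0
  · exact sub_eq_zero.1 h1

theorem HasWeakGrad.congr_grad {v : Plane → ℝ} {G H : Plane → Plane}
    (hG : HasWeakGrad U v G) (h : G =ᵐ[volume.restrict U] H) : HasWeakGrad U v H := by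
  refine ⟨hG.memLp, hG.memLp_grad.ae_eq h, fun φ hφ i => ?_⟩
  rw [hG.integral_eq φ hφ i]
  congr 1
  refine integral_congr_ae ?_
  filter_upwards [h] with x hx
  simp only [hx]

theorem hasWeakGrad_weakGrad {v : Plane → ℝ} (h : MemH1 U v) :
    HasWeakGrad U v (weakGrad U v) :=
  Classical.epsilon_spec h

theorem HasWeakGrad.weakGrad_ae (hU : IsOpen U) {v : Plane → ℝ} {G : Plane → Plane}
    (hG : HasWeakGrad U v G) : weakGrad U v =ᵐ[volume.restrict U] G :=
  (hasWeakGrad_weakGrad ⟨G, hG⟩).unique hU hG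

theorem HasWeakLaplacian.memLp {v r : Plane → ℝ} (h : HasWeakLaplacian U v r) :
    MemLp r 2 (volume.restrict U) := h.choose_spec.2.1

theorem HasWeakLaplacian.memH1 {v r : Plane → ℝ} (h : HasWeakLaplacian U v r) :
    MemH1 U v := ⟨_, h.choose_spec.1⟩

theorem HasWeakLaplacian.integral_eq (hU : IsOpen U) {v r : Plane → ℝ} {G : Plane → Plane}
    (h : HasWeakLaplacian U v r) (hG : HasWeakGrad U v G) (φ : Plane → ℝ)
    (hφ : IsTestFunction U φ) :
    ∫ x in U, inner ℝ (G x) (gradient φ x) = - ∫ x in U, r x * φ x := by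
  obtain ⟨G', hG', -, h⟩ := h
  rw [← h φ hφ]
  refine integral_congr_ae ?_
  filter_upwards [hG.unique hU hG'] with x hx
  rw [hx]

theorem HasWeakLaplacian.unique (hU : IsOpen U) {v r s : Plane → ℝ}
    (hr : HasWeakLaplacian U v r) (hs : HasWeakLaplacian U v s) :
    r =ᵐ[volume.restrict U] s := by
  have h : (fun x => r x - s x) =ᵐ[volume.restrict U] 0 := by
    refine ae_eq_zero_of_test hU (hr.memLp.sub hs.memLp) fun φ hφ => ?_
    have hG := hasWeakGrad_weakGrad hr.memH1
    simp only [sub_mul]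
    rw [integral_sub (integrable_mul' hr.memLp (hφ.memLp _))
      (integrable_mul' hs.memLp (hφ.memLp _))]
    linarith [hr.integral_eq hU hG φ hφ, hs.integral_eq hU hG φ hφ]
  filter_upwards [h] with x hx using sub_eq_zero.1 hx

theorem IsTestFunction.eq_zero {φ : Plane → ℝ} (h : IsTestFunction U φ) {x : Plane} (hx : x ∉ U) :
    φ x = 0 := image_eq_zero_of_notMem_tsupport fun h' => hx (h.support_subset h')

theorem IsTestFunction.gradient_eq_zero {φ : Plane → ℝ} (h : IsTestFunction U φ) {x : Plane}
    (hx : x ∉ U) : gradient φ x = 0 := by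
  have : fderiv ℝ φ x = 0 := by
    by_contra h'
    exact hx (h.support_subset (support_fderiv_subset ℝ h'))
  simp [gradient, this]

theorem IsTestFunction.mono {U' : Set Plane} {φ : Plane → ℝ} (h : IsTestFunction U φ)
    (hs : U ⊆ U') : IsTestFunction U' φ :=
  ⟨h.smooth, h.compact, h.support_subset.trans hs⟩

/-- A test function of the smaller set is one of the larger set and vanishes, with its gradient, on
the difference, so the two integral identities are the same. -/
theorem HasWeakGrad.mono {U' : Set Plane} (hU' : IsOpen U') (hs : U ⊆ U') {v : Plane → ℝ}
    {G : Plane → Plane} (hG : HasWeakGrad U' v G) : HasWeakGrad U v G := by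
  have hm : (volume.restrict U : Measure Plane) ≤ volume.restrict U' :=
    Measure.restrict_mono hs le_rfl
  refine ⟨hG.memLp.mono_measure hm, hG.memLp_grad.mono_measure hm, fun φ hφ i => ?_⟩
  have h0 := hG.integral_eq φ (hφ.mono hs) i
  rwa [setIntegral_eq_of_subset_of_forall_sdiff_eq_zero hU'.measurableSet hs fun x hx => by
      simp [hφ.gradient_eq_zero hx.2],
    setIntegral_eq_of_subset_of_forall_sdiff_eq_zero hU'.measurableSet hs fun x hx => by
      simp [hφ.eq_zero hx.2]] at h0

theorem gradient_const_add {φ : Plane → ℝ} (c : ℝ) :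
    gradient (fun x => φ x + c) = gradient φ := by
  funext x
  simp [gradient, fderiv_add_const]

theorem gradient_coord (φ : Plane → ℝ) (x : Plane) (i : Fin 2) :
    gradient φ x i = fderiv ℝ φ x (EuclideanSpace.single i 1) := by
  have h := InnerProductSpace.toDual_symm_apply (𝕜 := ℝ) (x := EuclideanSpace.single i (1 : ℝ))
    (y := fderiv ℝ φ x)
  rw [← h, EuclideanSpace.inner_single_right]
  simp [gradient]

theorem inner_gradient (φ : Plane → ℝ) (x y : Plane) :
    inner ℝ (gradient φ x) y = fderiv ℝ φ x y :=
  InnerProductSpace.toDual_symm_apply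

theorem norm_gradient (φ : Plane → ℝ) (x : Plane) : ‖gradient φ x‖ = ‖fderiv ℝ φ x‖ := by
  simp [gradient]

theorem gradient_mul {φ ψ : Plane → ℝ} {x : Plane} (h : DifferentiableAt ℝ φ x)
    (h' : DifferentiableAt ℝ ψ x) :
    gradient (fun y => φ y * ψ y) x = φ x • gradient ψ x + ψ x • gradient φ x := by
  refine ext_inner_right ℝ fun y => ?_
  rw [inner_gradient, fderiv_fun_mul h h', inner_add_left, real_inner_smul_left,
    real_inner_smul_left, inner_gradient, inner_gradient]
  simp

end Basics

/-! ### Star-shaped cells. -/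

/-- `P` is a compact set, equal to the closure of its interior, and star-shaped with respect to
the ball of centre `x₀` and radius `ρ`. -/
structure StarCell (P : Set Plane) (x₀ : Plane) (ρ : ℝ) : Prop where
  isCompact : IsCompact P
  closure_interior : closure (interior P) = P
  pos : 0 < ρ
  ball_subset : Metric.ball x₀ ρ ⊆ P
  star : ∀ y ∈ Metric.ball x₀ ρ, StarConvex ℝ y P

namespace StarCell

variable {P : Set Plane} {x₀ : Plane} {ρ : ℝ}

/-- As z runs over the ball, the points (1 - δ)p + δz fill a homothetic copy of the ball, which is
open and lies in `P` by star-shapedness. The point p may lie on the frontier; this is what makes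
averages well defined up to the boundary. -/
theorem star_mem_interior (h : StarCell P x₀ ρ) {p y : Plane} (hp : p ∈ P)
    (hy : y ∈ Metric.ball x₀ ρ) {δ : ℝ} (h0 : 0 < δ) (h1 : δ ≤ 1) :
    (1 - δ) • p + δ • y ∈ interior P := by
  have hopen : IsOpen ((fun z : Plane => (1 - δ) • p + δ • z) '' Metric.ball x₀ ρ) := by
    have : (fun z : Plane => (1 - δ) • p + δ • z) =
        (Homeomorph.addLeft ((1 - δ) • p)) ∘ (Homeomorph.smulOfNeZero δ h0.ne') := rfl
    rw [this, image_comp]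
    exact (Homeomorph.addLeft _).isOpenMap _ ((Homeomorph.smulOfNeZero δ h0.ne').isOpenMap _
      Metric.isOpen_ball)
  refine mem_interior.2 ⟨_, ?_, hopen, mem_image_of_mem _ hy⟩
  rintro _ ⟨z, hz, rfl⟩
  have := h.star z hz hp h0.le (sub_nonneg.2 h1) (by ring)
  rwa [add_comm] at this

theorem center_mem_ball (h : StarCell P x₀ ρ) : x₀ ∈ Metric.ball x₀ ρ := Metric.mem_ball_self h.pos

theorem center_mem_interior (h : StarCell P x₀ ρ) : x₀ ∈ interior P :=
  interior_maximal h.ball_subset Metric.isOpen_ball h.center_mem_ball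

theorem isClosed (h : StarCell P x₀ ρ) : IsClosed P := h.isCompact.isClosed

theorem frontier_interior (h : StarCell P x₀ ρ) : frontier (interior P) = frontier P := by
  rw [frontier, frontier, interior_interior, h.closure_interior, h.isClosed.closure_eq]

theorem isFiniteMeasure (h : StarCell P x₀ ρ) :
    IsFiniteMeasure (volume.restrict (interior P) : Measure Plane) :=
  ⟨by
    rw [Measure.restrict_apply_univ]
    exact (measure_mono interior_subset).trans_lt h.isCompact.measure_lt_top⟩

theorem starConvex_interior (h : StarCell P x₀ ρ) : StarConvex ℝ x₀ (interior P) := by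
  intro y hy a b ha hb hab
  rcases ha.eq_or_lt with rfl | ha
  · simpa [show b = 1 by linarith] using hy
  · have := h.star_mem_interior (interior_subset hy) h.center_mem_ball ha (by linarith)
    rwa [show 1 - a = b by linarith, add_comm] at this

theorem isPreconnected_interior (h : StarCell P x₀ ρ) : IsPreconnected (interior P) :=
  (h.starConvex_interior.isPathConnected h.center_mem_interior).isConnected.isPreconnected

theorem memLp_of_continuous {F : Type*} [NormedAddCommGroup F] (h : StarCell P x₀ ρ)
    {f : Plane → F} (hf : ContinuousOn f P) : MemLp f 2 (volume.restrict (interior P)) := by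
  refine MemLp.mono_measure (Measure.restrict_mono interior_subset le_rfl) ?_
  have : IsFiniteMeasure (volume.restrict P : Measure Plane) :=
    ⟨by rw [Measure.restrict_apply_univ]; exact h.isCompact.measure_lt_top⟩
  obtain ⟨C, hC⟩ := h.isCompact.exists_bound_of_continuousOn hf
  refine MemLp.of_bound (hf.aestronglyMeasurable h.isClosed.measurableSet) C ?_
  filter_upwards [ae_restrict_mem h.isClosed.measurableSet] with x hx using hC x hx

end StarCell

/-- Lets the results on cells be applied to small discs inside Ω, which link the constants of
neighbouring elements. -/
theorem starCell_closedBall (x : Plane) {r : ℝ} (hr : 0 < r) :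
    StarCell (Metric.closedBall x r) x r where
  isCompact := isCompact_closedBall x r
  closure_interior := by rw [interior_closedBall x hr.ne', closure_ball x hr.ne']
  pos := hr
  ball_subset := Metric.ball_subset_closedBall
  star := fun y hy => (convex_closedBall x r).starConvex (Metric.ball_subset_closedBall hy)

end XVEM

/-! ### Estimates on rays, and cone coordinates over an edge. -/

namespace XVEM

section Auxiliary

open scoped ENNReal NNReal

theorem enorm_add_sq_le {F : Type*} [SeminormedAddCommGroup F] (x y : F) :
    ‖x + y‖ₑ ^ 2 ≤ 2 * ‖x‖ₑ ^ 2 + 2 * ‖y‖ₑ ^ 2 := by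
  have h : ‖x + y‖₊ ^ 2 ≤ 2 * ‖x‖₊ ^ 2 + 2 * ‖y‖₊ ^ 2 := by
    rw [← NNReal.coe_le_coe]
    push_cast
    nlinarith [norm_add_le x y, norm_nonneg (x + y), sq_nonneg (‖x‖ - ‖y‖), norm_nonneg x,
      norm_nonneg y]
  simp only [enorm_eq_nnnorm]
  exact_mod_cast h

/-- Cauchy–Schwarz against the constant 1. The measure is arbitrary because the inequality serves
both for an interval and for a probability density, where it plays the role of Jensen's inequality.
-/
theorem lintegral_sq_le {α : Type*} [MeasurableSpace α] (μ : Measure α) {g : α → ℝ≥0∞}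
    (hg : AEMeasurable g μ) : (∫⁻ x, g x ∂μ) ^ 2 ≤ μ univ * ∫⁻ x, g x ^ 2 ∂μ := by
  have h := ENNReal.lintegral_mul_le_Lp_mul_Lq μ (p := 2) (q := 2)
    Real.HolderConjugate.two_two hg (aemeasurable_const (b := (1 : ℝ≥0∞)))
  have h2 : (∫⁻ x, g x ∂μ) ≤ (∫⁻ x, g x ^ 2 ∂μ) ^ (1 / 2 : ℝ) * (μ univ) ^ (1 / 2 : ℝ) := by
    simpa using h
  calc (∫⁻ x, g x ∂μ) ^ 2
      ≤ ((∫⁻ x, g x ^ 2 ∂μ) ^ (1 / 2 : ℝ) * (μ univ) ^ (1 / 2 : ℝ)) ^ 2 := by gcongr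
    _ = μ univ * ∫⁻ x, g x ^ 2 ∂μ := by
      rw [mul_pow, ← ENNReal.rpow_natCast, ← ENNReal.rpow_natCast, ← ENNReal.rpow_mul,
        ← ENNReal.rpow_mul]
      norm_num
      rw [mul_comm]

/-- The fundamental theorem of calculus followed by Cauchy–Schwarz. The two points are
interchangeable: a boundary value is controlled by interior values in the trace inequality, and
conversely in the strip inequality. -/
theorem enorm_sq_le_of_hasDerivAt {f f' : ℝ → ℝ} (hf : ∀ t, HasDerivAt f (f' t) t)
    (hc : Continuous f') {a b t t' : ℝ} (ht : t ∈ Icc a b) (ht' : t' ∈ Icc a b) :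
    ‖f t‖ₑ ^ 2 ≤ 2 * ‖f t'‖ₑ ^ 2 +
      2 * (ENNReal.ofReal (b - a) * ∫⁻ u in Ioo a b, ‖f' u‖ₑ ^ 2) := by
  have h1 : f t = f t' + ∫ u in t'..t, f' u := by
    rw [intervalIntegral.integral_eq_sub_of_hasDerivAt (fun x _ => hf x)
      (hc.intervalIntegrable _ _)]
    ring
  have h2 : ‖∫ u in t'..t, f' u‖ₑ ≤ ∫⁻ u in Ioo a b, ‖f' u‖ₑ := by
    rw [intervalIntegral.intervalIntegral_eq_integral_uIoc]
    have : ‖(if t' ≤ t then (1 : ℝ) else -1) • ∫ u in uIoc t' t, f' u‖ₑ =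
        ‖∫ u in uIoc t' t, f' u‖ₑ := by
      split_ifs <;> simp
    rw [this]
    refine (enorm_integral_le_lintegral_enorm _).trans ?_
    rw [← setLIntegral_congr (Ioo_ae_eq_Ioc (a := a) (b := b)).symm]
    refine lintegral_mono_set ?_
    intro x hx
    rw [mem_uIoc] at hx
    rcases hx with hx | hx
    · exact ⟨ht'.1.trans_lt hx.1, hx.2.trans ht.2⟩
    · exact ⟨ht.1.trans_lt hx.1, hx.2.trans ht'.2⟩
  have h3 := lintegral_sq_le (volume.restrict (Ioo a b)) (g := fun u => ‖f' u‖ₑ)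
    hc.enorm.measurable.aemeasurable
  rw [Measure.restrict_apply_univ, Real.volume_Ioo] at h3
  rw [h1]
  refine (enorm_add_sq_le _ _).trans ?_
  gcongr
  exact (by gcongr : ‖∫ u in t'..t, f' u‖ₑ ^ 2 ≤ _).trans h3

/-- The affine parametrisation multiplies one-dimensional Hausdorff measure by the length of the
segment, so arc-length integrals become integrals over the unit interval. -/
theorem restrict_seg_eq {e : Plane × Plane} :
    (μH[1] : Measure Plane).restrict (seg e) = nndist e.1 e.2 •
      (volume.restrict (Icc (0 : ℝ) 1)).map (AffineMap.lineMap e.1 e.2) := by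
  have hc : Continuous (AffineMap.lineMap e.1 e.2 : ℝ →ᵃ[ℝ] Plane) :=
    AffineMap.lineMap_continuous
  ext A hA
  rw [Measure.restrict_apply hA, Measure.smul_apply, Measure.map_apply hc.measurable hA,
    Measure.restrict_apply (hc.measurable hA), ← hausdorffMeasure_real,
    ← hausdorffMeasure_lineMap_image]
  congr 1
  rw [image_preimage_inter, ← segment_eq_image_lineMap]

theorem lintegral_seg {e : Plane × Plane} {f : Plane → ℝ≥0∞} (hf : Measurable f) :
    ∫⁻ x in seg e, f x ∂μH[1] =
      nndist e.1 e.2 * ∫⁻ s in Icc (0 : ℝ) 1, f (AffineMap.lineMap e.1 e.2 s) := by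
  have hc : Continuous (AffineMap.lineMap e.1 e.2 : ℝ →ᵃ[ℝ] Plane) :=
    AffineMap.lineMap_continuous
  rw [restrict_seg_eq, lintegral_smul_measure, lintegral_map hf hc.measurable]
  rfl

/-- The cone over the edge `e` with apex `x₀`, in the coordinates `(s, t)` where `s` runs along
the edge and `t` is the dilation factor. -/
noncomputable def coneMap (x₀ : Plane) (e : Plane × Plane) (z : ℝ × ℝ) : Plane :=
  x₀ + z.2 • (AffineMap.lineMap e.1 e.2 z.1 - x₀)

/-- Twice the signed area of the triangle `x₀ e`. -/
noncomputable def coneDet (x₀ : Plane) (e : Plane × Plane) : ℝ :=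
  (e.1 - x₀) 1 * (e.2 - x₀) 0 - (e.1 - x₀) 0 * (e.2 - x₀) 1

theorem coneMap_apply (x₀ : Plane) (e : Plane × Plane) (z : ℝ × ℝ) (i : Fin 2) :
    coneMap x₀ e z i = x₀ i + z.2 * ((e.1 - x₀) i + z.1 * ((e.2 - x₀) i - (e.1 - x₀) i)) := by
  simp only [coneMap, AffineMap.lineMap_apply, vsub_eq_sub, vadd_eq_add, PiLp.add_apply,
    PiLp.smul_apply, PiLp.sub_apply, smul_eq_mul]
  ring

theorem continuous_coneMap (x₀ : Plane) (e : Plane × Plane) : Continuous (coneMap x₀ e) := by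
  have hc : Continuous (AffineMap.lineMap e.1 e.2 : ℝ →ᵃ[ℝ] Plane) :=
    AffineMap.lineMap_continuous
  unfold coneMap
  fun_prop

/-- Relative to `x₀`, the point has coordinates t(1 - s) and ts in the basis of vectors to the two
endpoints. Cramer's rule recovers both, their sum is t, and t > 0 then gives s. -/
theorem injOn_coneMap {x₀ : Plane} {e : Plane × Plane} (hD : coneDet x₀ e ≠ 0) :
    InjOn (coneMap x₀ e) {z | 0 < z.2} := by
  rintro ⟨s, t⟩ ht ⟨s', t'⟩ - h
  have h0 := congrArg (fun x : Plane => x 0) h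
  have h1 := congrArg (fun x : Plane => x 1) h
  simp only [coneMap_apply] at h0 h1
  have hp : (t * (1 - s) - t' * (1 - s')) * coneDet x₀ e = 0 := by
    unfold coneDet
    linear_combination (e.2 - x₀) 0 * h1 - (e.2 - x₀) 1 * h0
  have hq : (t * s - t' * s') * coneDet x₀ e = 0 := by
    unfold coneDet
    linear_combination (e.1 - x₀) 1 * h0 - (e.1 - x₀) 0 * h1
  have hp := (mul_eq_zero.1 hp).resolve_right hD
  have hq := (mul_eq_zero.1 hq).resolve_right hD
  have htt : t = t' := by linarith
  subst htt
  have ht : 0 < t := ht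
  have : s = s' := by
    have : t * (s - s') = 0 := by linarith
    have := (mul_eq_zero.1 this).resolve_left ht.ne'
    linarith
  rw [this]

/-- Change of variables with Jacobian t times `coneDet`. The plane is first identified with ℝ × ℝ by
a measure-preserving equivalence, so that the determinant is that of an explicit 2 × 2 matrix. -/
theorem lintegral_coneMap_image {x₀ : Plane} {e : Plane × Plane} (hD : coneDet x₀ e ≠ 0)
    {S I : Set ℝ} (hS : MeasurableSet S) (hI : MeasurableSet I) (hpos : ∀ t ∈ I, 0 < t)
    {f : Plane → ℝ≥0∞} (hf : Measurable f) :
    ∫⁻ x in coneMap x₀ e '' (S ×ˢ I), f x =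
      ∫⁻ s in S, ∫⁻ t in I, ENNReal.ofReal (t * |coneDet x₀ e|) * f (coneMap x₀ e (s, t)) := by
  set m : Plane ≃ᵐ ℝ × ℝ := (MeasurableEquiv.toLp 2 (Fin 2 → ℝ)).symm.trans
    MeasurableEquiv.finTwoArrow with hm
  have mp : MeasurePreserving m volume volume :=
    (PiLp.volume_preserving_ofLp (Fin 2)).trans (volume_preserving_finTwoArrow ℝ)
  have hmx : ∀ x, m x = (x 0, x 1) := fun x => rfl
  set Φ : ℝ × ℝ → ℝ × ℝ := fun z => m (coneMap x₀ e z) with hΦ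
  set Φ' : ℝ × ℝ → ℝ × ℝ →L[ℝ] ℝ × ℝ := fun z => LinearMap.toContinuousLinearMap
    (Matrix.toLin (Module.Basis.finTwoProd ℝ) (Module.Basis.finTwoProd ℝ)
      !![z.2 * ((e.2 - x₀) 0 - (e.1 - x₀) 0),
          (e.1 - x₀) 0 + z.1 * ((e.2 - x₀) 0 - (e.1 - x₀) 0);
        z.2 * ((e.2 - x₀) 1 - (e.1 - x₀) 1),
          (e.1 - x₀) 1 + z.1 * ((e.2 - x₀) 1 - (e.1 - x₀) 1)]) with hΦ'
  have hder : ∀ z, HasFDerivAt Φ (Φ' z) z := by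
    intro z
    simp only [hΦ, hmx, hΦ', coneMap_apply]
    rw [Matrix.toLin_finTwoProd_toContinuousLinearMap]
    have k : ∀ i : Fin 2, HasFDerivAt (fun z : ℝ × ℝ => x₀ i +
        z.2 * ((e.1 - x₀) i + z.1 * ((e.2 - x₀) i - (e.1 - x₀) i)))
        ((z.2 * ((e.2 - x₀) i - (e.1 - x₀) i)) • ContinuousLinearMap.fst ℝ ℝ ℝ +
          ((e.1 - x₀) i + z.1 * ((e.2 - x₀) i - (e.1 - x₀) i)) •
            ContinuousLinearMap.snd ℝ ℝ ℝ) z := fun i => by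
      have h1 := ((hasFDerivAt_snd (𝕜 := ℝ) (p := z)).mul (((hasFDerivAt_fst (𝕜 := ℝ)
        (p := z)).mul_const ((e.2 - x₀) i - (e.1 - x₀) i)).const_add
          ((e.1 - x₀) i))).const_add (x₀ i)
      refine h1.congr_fderiv ?_
      ext <;> simp
    exact (k 0).prodMk (k 1)
  have hdet : ∀ z, (Φ' z).det = z.2 * coneDet x₀ e := by
    intro z
    have h1 : (Φ' z).det = _ := (LinearMap.det_toContinuousLinearMap _).trans
      (LinearMap.det_toLin _ _)
    rw [h1, Matrix.det_fin_two_of, coneDet]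
    ring
  have hinj : InjOn Φ (S ×ˢ I) := fun z hz z' hz' h =>
    injOn_coneMap hD (hpos _ hz.2) (hpos _ hz'.2) (m.injective h)
  have himg : coneMap x₀ e '' (S ×ˢ I) = m ⁻¹' (Φ '' (S ×ˢ I)) := by
    ext x
    constructor
    · rintro ⟨z, hz, rfl⟩
      exact ⟨z, hz, rfl⟩
    · rintro ⟨z, hz, h⟩
      exact ⟨z, hz, m.injective h⟩
  have h1 : ∫⁻ x in coneMap x₀ e '' (S ×ˢ I), f x =
      ∫⁻ w in Φ '' (S ×ˢ I), f (m.symm w) := by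
    rw [himg, ← mp.setLIntegral_comp_preimage_emb m.measurableEmbedding]
    simp
  rw [h1, lintegral_image_eq_lintegral_abs_det_fderiv_mul volume (hS.prod hI)
    (fun z _ => (hder z).hasFDerivWithinAt) hinj, Measure.volume_eq_prod, ← Measure.prod_restrict,
    lintegral_prod]
  · refine lintegral_congr fun s => ?_
    refine setLIntegral_congr_fun hI fun t ht => ?_
    simp only [hdet, hΦ, MeasurableEquiv.symm_apply_apply, abs_mul, abs_of_pos (hpos t ht)]
  · have hmeas : Measurable fun z : ℝ × ℝ => ENNReal.ofReal |z.2 * coneDet x₀ e| *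
        f (coneMap x₀ e z) :=
      (by fun_prop : Continuous fun z : ℝ × ℝ =>
        |z.2 * coneDet x₀ e|).measurable.ennreal_ofReal.mul
          (hf.comp (continuous_coneMap x₀ e).measurable)
    simpa only [hdet, hΦ, MeasurableEquiv.symm_apply_apply] using hmeas.aemeasurable


/-- Were the determinant zero, the edge would be collinear with `x₀`. Then either `x₀` lies on the
edge, or one endpoint lies strictly between `x₀` and the other. Either way an interior point would
be on the frontier. -/
theorem StarCell.coneDet_ne_zero {P : Set Plane} {x₀ : Plane} {ρ : ℝ} (hP : StarCell P x₀ ρ)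
    {e : Plane × Plane} (he : e.1 ≠ e.2) (hs : seg e ⊆ frontier P) : coneDet x₀ e ≠ 0 := by
  intro hD
  have hnot : ∀ x ∈ seg e, x ∉ interior P := fun x hx => (hs hx).2
  have hmem : ∀ x ∈ seg e, x ∈ P := fun x hx => hP.isClosed.frontier_subset (hs hx)
  have hb : e.2 - x₀ ≠ 0 := fun h =>
    hnot e.2 (right_mem_segment ℝ _ _) (sub_eq_zero.1 h ▸ hP.center_mem_interior)
  have hb2 : 0 < (e.2 - x₀) 0 ^ 2 + (e.2 - x₀) 1 ^ 2 := by
    have := norm_pos_iff.2 hb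
    have h2 := EuclideanSpace.real_norm_sq_eq (e.2 - x₀)
    rw [Fin.sum_univ_two] at h2
    rw [← h2]
    positivity
  obtain ⟨l, hl⟩ : ∃ l : ℝ, e.1 - x₀ = l • (e.2 - x₀) := by
    -- The coefficient of the orthogonal projection of the first vector on the second; a zero
    -- determinant makes the projection exact.
    refine ⟨((e.1 - x₀) 0 * (e.2 - x₀) 0 + (e.1 - x₀) 1 * (e.2 - x₀) 1) /
      ((e.2 - x₀) 0 ^ 2 + (e.2 - x₀) 1 ^ 2), ?_⟩
    unfold coneDet at hD
    ext i
    rw [PiLp.smul_apply, smul_eq_mul, div_mul_eq_mul_div, eq_div_iff hb2.ne']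
    fin_cases i
    · simp only [Fin.zero_eta]
      linear_combination -(e.2 - x₀) 1 * hD
    · simp only [Fin.mk_one]
      linear_combination (e.2 - x₀) 0 * hD
  have h1 : e.1 = x₀ + l • (e.2 - x₀) := by rw [← hl]; abel
  rcases le_or_gt l 0 with h | h
  · refine hnot x₀ ?_ hP.center_mem_interior
    have hne : (1 - l) ≠ 0 := by linarith
    have hinv : 0 ≤ (1 - l)⁻¹ := inv_nonneg.2 (by linarith)
    refine ⟨(1 - l)⁻¹, -l * (1 - l)⁻¹, hinv, mul_nonneg (by linarith) hinv, ?_, ?_⟩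
    · field_simp
      ring
    · have h2 : (1 - l)⁻¹ * (1 - l) = 1 := inv_mul_cancel₀ hne
      have : (1 - l)⁻¹ • e.1 + (-l * (1 - l)⁻¹) • e.2 = ((1 - l)⁻¹ * (1 - l)) • x₀ := by
        rw [h1]
        module
      rw [this, h2, one_smul]
  rcases lt_trichotomy l 1 with h' | rfl | h'
  · refine hnot e.1 (left_mem_segment ℝ _ _) ?_
    have := hP.star_mem_interior (hmem _ (right_mem_segment ℝ e.1 e.2)) hP.center_mem_ball
      (δ := 1 - l) (by linarith) (by linarith)
    convert this using 1
    rw [h1]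
    module
  · exact he (by rw [h1]; module)
  · refine hnot e.2 (right_mem_segment ℝ _ _) ?_
    have hl0 : l ≠ 0 := h.ne'
    have := hP.star_mem_interior (hmem _ (left_mem_segment ℝ e.1 e.2)) hP.center_mem_ball
      (δ := 1 - l⁻¹) (by linarith [inv_lt_one_of_one_lt₀ h']) (by linarith [inv_pos.2 h])
    convert this using 1
    rw [h1, sub_sub_cancel, smul_add, smul_smul, inv_mul_cancel₀ hl0]
    module

/-- The part of the cone over `e` with apex `x₀` at relative distance less than `τ` from `e`. -/
def sector (x₀ : Plane) (e : Plane × Plane) (τ : ℝ) : Set Plane :=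
  coneMap x₀ e '' (Icc 0 1 ×ˢ Ioo (1 - τ) 1)

theorem lineMap_mem_seg (e : Plane × Plane) {s : ℝ} (hs : s ∈ Icc (0 : ℝ) 1) :
    AffineMap.lineMap e.1 e.2 s ∈ seg e := by
  rw [seg, segment_eq_image_lineMap]
  exact mem_image_of_mem _ hs

theorem StarCell.sector_subset {P : Set Plane} {x₀ : Plane} {ρ : ℝ} (hP : StarCell P x₀ ρ)
    {e : Plane × Plane} (hs : seg e ⊆ frontier P) {τ : ℝ} (hτ : τ ≤ 1) :
    sector x₀ e τ ⊆ interior P := by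
  rintro _ ⟨⟨s, t⟩, ⟨h1, h2⟩, rfl⟩
  have h2 : 1 - τ < t ∧ t < 1 := h2
  have := hP.star_mem_interior (hP.isClosed.frontier_subset (hs (lineMap_mem_seg e h1)))
    hP.center_mem_ball (δ := 1 - t) (by linarith) (by linarith)
  convert this using 1
  simp only [coneMap]
  module

/-- The one-dimensional estimate along the ray with s fixed: the radial derivative is the gradient
applied to a vector of length at most R. -/
theorem enorm_sq_coneMap_le {φ : Plane → ℝ} (hφ : ContDiff ℝ ∞ φ) {x₀ : Plane}
    {e : Plane × Plane} {R : ℝ≥0} {s : ℝ}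
    (hR : ‖(AffineMap.lineMap e.1 e.2 s : Plane) - x₀‖₊ ≤ R)
    {τ t t' : ℝ} (ht : t ∈ Icc (1 - τ) 1) (ht' : t' ∈ Icc (1 - τ) 1) :
    ‖φ (coneMap x₀ e (s, t))‖ₑ ^ 2 ≤ 2 * ‖φ (coneMap x₀ e (s, t'))‖ₑ ^ 2 +
      2 * (ENNReal.ofReal τ * (R ^ 2 * ∫⁻ u in Ioo (1 - τ) 1,
        ‖gradient φ (coneMap x₀ e (s, u))‖ₑ ^ 2)) := by
  set w : Plane := AffineMap.lineMap e.1 e.2 s - x₀ with hw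
  have hder : ∀ u : ℝ, HasDerivAt (fun u => φ (coneMap x₀ e (s, u)))
      (fderiv ℝ φ (coneMap x₀ e (s, u)) w) u := by
    intro u
    have h1 : HasDerivAt (fun u : ℝ => coneMap x₀ e (s, u)) w u := by
      have := ((hasDerivAt_id u).smul_const w).const_add x₀
      simpa [coneMap] using this
    exact (hφ.differentiable (by simp) _).hasFDerivAt.comp_hasDerivAt u h1
  have hcone : Continuous fun u : ℝ => coneMap x₀ e (s, u) :=
    (continuous_coneMap x₀ e).comp (by fun_prop)
  have hcont : Continuous fun u : ℝ => fderiv ℝ φ (coneMap x₀ e (s, u)) w :=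
    ((hφ.continuous_fderiv (by simp)).comp hcone).clm_apply continuous_const
  have h := enorm_sq_le_of_hasDerivAt hder hcont ht ht'
  refine h.trans ?_
  rw [sub_sub_cancel]
  gcongr
  rw [← lintegral_const_mul' _ _ (by simp)]
  refine lintegral_mono fun u => ?_
  have h1 : ‖fderiv ℝ φ (coneMap x₀ e (s, u)) w‖ₑ ≤
      R * ‖gradient φ (coneMap x₀ e (s, u))‖ₑ := by
    have h2 : ‖fderiv ℝ φ (coneMap x₀ e (s, u)) w‖₊ ≤
        R * ‖gradient φ (coneMap x₀ e (s, u))‖₊ := by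
      have h3 := (fderiv ℝ φ (coneMap x₀ e (s, u))).le_opNNNorm w
      have h4 : ‖gradient φ (coneMap x₀ e (s, u))‖₊ = ‖fderiv ℝ φ (coneMap x₀ e (s, u))‖₊ :=
        NNReal.eq (norm_gradient _ _)
      rw [h4, mul_comm]
      exact h3.trans (by gcongr)
    simp only [enorm_eq_nnnorm]
    exact_mod_cast h2
  calc _ ≤ (R * ‖gradient φ (coneMap x₀ e (s, u))‖ₑ) ^ 2 := by gcongr
    _ = _ := mul_pow _ _ _

end Auxiliary

end XVEM

/-! ### Trace and strip inequalities on one edge. -/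

namespace XVEM

section ConeEstimates

open scoped ENNReal NNReal

theorem measurable_sq_enorm {F : Type*} [NormedAddCommGroup F] {f : Plane → F}
    (hf : Continuous f) : Measurable fun x => ‖f x‖ₑ ^ 2 :=
  (hf.enorm.measurable).pow_const 2

/-- The integral over the cone coordinates. -/
noncomputable def coneIntegral (x₀ : Plane) (e : Plane × Plane) (τ : ℝ) (f : Plane → ℝ≥0∞) :
    ℝ≥0∞ :=
  ∫⁻ s in Icc (0 : ℝ) 1, ∫⁻ t in Ioo (1 - τ) 1, f (coneMap x₀ e (s, t))

theorem measurable_coneIntegrand {x₀ : Plane} {e : Plane × Plane} {τ : ℝ} {f : Plane → ℝ≥0∞}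
    (hf : Measurable f) :
    Measurable fun s => ∫⁻ t in Ioo (1 - τ) 1, f (coneMap x₀ e (s, t)) :=
  (hf.comp (continuous_coneMap x₀ e).measurable).lintegral_prod_right'

theorem lintegral_sector {x₀ : Plane} {e : Plane × Plane} (hD : coneDet x₀ e ≠ 0) {τ : ℝ}
    (hτ : τ ≤ 1) {f : Plane → ℝ≥0∞} (hf : Measurable f) :
    ∫⁻ x in sector x₀ e τ, f x = ∫⁻ s in Icc (0 : ℝ) 1, ∫⁻ t in Ioo (1 - τ) 1,
      ENNReal.ofReal (t * |coneDet x₀ e|) * f (coneMap x₀ e (s, t)) :=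
  lintegral_coneMap_image hD measurableSet_Icc measurableSet_Ioo
    (fun t ht => by linarith [ht.1]) hf

theorem lintegral_sector_le {x₀ : Plane} {e : Plane × Plane} (hD : coneDet x₀ e ≠ 0) {τ : ℝ}
    (hτ : τ ≤ 1) {f : Plane → ℝ≥0∞} (hf : Measurable f) :
    ∫⁻ x in sector x₀ e τ, f x ≤ ENNReal.ofReal |coneDet x₀ e| * coneIntegral x₀ e τ f := by
  rw [lintegral_sector hD hτ hf, coneIntegral, ← lintegral_const_mul' _ _ (by simp)]
  refine lintegral_mono fun s => ?_
  rw [← lintegral_const_mul' _ _ (by simp)]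
  refine setLIntegral_mono' measurableSet_Ioo fun t ht => ?_
  gcongr
  exact mul_le_of_le_one_left (abs_nonneg _) ht.2.le

/-- For τ ≤ 1/2 the dilation factor t exceeds 1/2, so the Jacobian is at least half of |`coneDet`|.
Staying away from the apex is what keeps the weight bounded below. -/
theorem coneIntegral_le {x₀ : Plane} {e : Plane × Plane} (hD : coneDet x₀ e ≠ 0) {τ : ℝ}
    (hτ : τ ≤ 1 / 2) {f : Plane → ℝ≥0∞} (hf : Measurable f) :
    coneIntegral x₀ e τ f ≤ (Real.toNNReal (|coneDet x₀ e| / 2))⁻¹ *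
      ∫⁻ x in sector x₀ e τ, f x := by
  have hpos : 0 < |coneDet x₀ e| := abs_pos.2 hD
  have h1 : (Real.toNNReal (|coneDet x₀ e| / 2) : ℝ≥0∞) * coneIntegral x₀ e τ f ≤
      ∫⁻ x in sector x₀ e τ, f x := by
    rw [lintegral_sector hD (by linarith) hf, coneIntegral, ← lintegral_const_mul' _ _ (by simp)]
    refine lintegral_mono fun s => ?_
    rw [← lintegral_const_mul' _ _ (by simp)]
    refine setLIntegral_mono' measurableSet_Ioo fun t ht => ?_
    change ENNReal.ofReal _ * _ ≤ _
    gcongr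
    nlinarith [ht.1]
  have h0 : (Real.toNNReal (|coneDet x₀ e| / 2) : ℝ≥0∞) ≠ 0 := by
    simp only [ne_eq, ENNReal.coe_eq_zero, Real.toNNReal_eq_zero, not_le]
    linarith
  have h2 : Real.toNNReal (|coneDet x₀ e| / 2) ≠ 0 := fun h => h0 (by rw [h]; rfl)
  rwa [ENNReal.coe_inv h2, mul_comm, ← div_eq_mul_inv, ENNReal.le_div_iff_mul_le (Or.inl h0) (Or.inl (by simp)),
    mul_comm]

variable {P : Set Plane} {x₀ : Plane} {ρ : ℝ}

theorem StarCell.exists_radius (hP : StarCell P x₀ ρ) : ∃ R : ℝ≥0, ∀ e : Plane × Plane,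
    seg e ⊆ frontier P → ∀ s ∈ Icc (0 : ℝ) 1,
      ‖(AffineMap.lineMap e.1 e.2 s : Plane) - x₀‖₊ ≤ R := by
  obtain ⟨R, hR⟩ := hP.isCompact.isBounded.subset_closedBall x₀
  refine ⟨R.toNNReal, fun e he s hs => ?_⟩
  have h1 := hR (hP.isClosed.frontier_subset (he (lineMap_mem_seg e hs)))
  rw [Metric.mem_closedBall, dist_eq_norm] at h1
  exact NNReal.coe_le_coe.1 (h1.trans (Real.le_coe_toNNReal R))

/-- The trace inequality on an edge. -/
theorem StarCell.exists_trace_bound (hP : StarCell P x₀ ρ) {e : Plane × Plane}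
    (he : e.1 ≠ e.2) (hs : seg e ⊆ frontier P) : ∃ C : ℝ≥0, ∀ φ : Plane → ℝ, ContDiff ℝ ∞ φ →
      ∫⁻ x in seg e, ‖φ x‖ₑ ^ 2 ∂μH[1] ≤ C * ((∫⁻ x in interior P, ‖φ x‖ₑ ^ 2) +
        ∫⁻ x in interior P, ‖gradient φ x‖ₑ ^ 2) := by
  obtain ⟨R, hR⟩ := hP.exists_radius
  have hD := hP.coneDet_ne_zero he hs
  set k : ℝ≥0 := (Real.toNNReal (|coneDet x₀ e| / 2))⁻¹ with hk
  refine ⟨nndist e.1 e.2 * (4 * (k * (1 + R ^ 2))), fun φ hφ => ?_⟩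
  have hφm := measurable_sq_enorm hφ.continuous
  have hgm := measurable_sq_enorm (contDiff_gradient_continuous hφ)
  have hk2 : ∀ f : Plane → ℝ≥0∞, Measurable f →
      coneIntegral x₀ e (1 / 2) f ≤ k * ∫⁻ x in interior P, f x := fun f hf => by
    refine (coneIntegral_le hD le_rfl hf).trans ?_
    gcongr
    exact hP.sector_subset hs (by norm_num)
  have hpt : ∀ s ∈ Icc (0 : ℝ) 1, ‖φ (AffineMap.lineMap e.1 e.2 s)‖ₑ ^ 2 ≤
      4 * (∫⁻ t in Ioo (1 - 1 / 2 : ℝ) 1, ‖φ (coneMap x₀ e (s, t))‖ₑ ^ 2) +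
        4 * (R ^ 2 * ∫⁻ t in Ioo (1 - 1 / 2 : ℝ) 1, ‖gradient φ (coneMap x₀ e (s, t))‖ₑ ^ 2) := by
    intro s hs
    -- The edge value, at t = 1, is compared with the value at every t in (1/2, 1) and the
    -- comparison is integrated. The interval has length 1/2, hence the factor 2 · 2 = 4 after
    -- division.
    have h1 : ∫⁻ _ in Ioo (1 - 1 / 2 : ℝ) 1, ‖φ (AffineMap.lineMap e.1 e.2 s)‖ₑ ^ 2 ≤
        ∫⁻ t in Ioo (1 - 1 / 2 : ℝ) 1, (2 * ‖φ (coneMap x₀ e (s, t))‖ₑ ^ 2 +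
        2 * (R ^ 2 * ∫⁻ u in Ioo (1 - 1 / 2 : ℝ) 1,
          ‖gradient φ (coneMap x₀ e (s, u))‖ₑ ^ 2)) := by
      refine setLIntegral_mono' measurableSet_Ioo fun t ht => ?_
      have := enorm_sq_coneMap_le hφ (hR e ‹_› s hs) (τ := 1 / 2) (t := 1) (t' := t)
        ⟨by norm_num, le_rfl⟩ (Ioo_subset_Icc_self ht)
      have h2 : coneMap x₀ e (s, 1) = AffineMap.lineMap e.1 e.2 s := by simp [coneMap]
      rw [h2] at this
      refine this.trans (add_le_add le_rfl (mul_le_mul_right (mul_le_of_le_one_left zero_le ?_) _))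
      rw [ENNReal.ofReal_le_one]
      norm_num
    rw [setLIntegral_const, lintegral_add_right _ measurable_const, setLIntegral_const,
      lintegral_const_mul' _ _ (by simp), Real.volume_Ioo, mul_comm,
      show (1 - (1 - 1 / 2) : ℝ) = 2⁻¹ by norm_num, ENNReal.ofReal_inv_of_pos two_pos,
      show ENNReal.ofReal 2 = 2 by simp] at h1
    calc _ = 2 * (2⁻¹ * ‖φ (AffineMap.lineMap e.1 e.2 s)‖ₑ ^ 2) := by
          rw [← mul_assoc, ENNReal.mul_inv_cancel (by simp) (by simp), one_mul]
      _ ≤ 2 * (2 * (∫⁻ t in Ioo (1 - 1 / 2 : ℝ) 1, ‖φ (coneMap x₀ e (s, t))‖ₑ ^ 2) +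
          2 * (R ^ 2 * ∫⁻ t in Ioo (1 - 1 / 2 : ℝ) 1,
            ‖gradient φ (coneMap x₀ e (s, t))‖ₑ ^ 2)) := by
        refine mul_le_mul_right (h1.trans (add_le_add le_rfl ?_)) _
        exact mul_le_of_le_one_right zero_le (by simp)
      _ = _ := by
        rw [mul_add, ← mul_assoc, ← mul_assoc, show (2 * 2 : ℝ≥0∞) = 4 by norm_num]
  rw [lintegral_seg hφm]
  push_cast
  rw [mul_assoc]
  refine mul_le_mul_right ?_ _
  calc _ ≤ ∫⁻ s in Icc (0 : ℝ) 1,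
        (4 * (∫⁻ t in Ioo (1 - 1 / 2 : ℝ) 1, ‖φ (coneMap x₀ e (s, t))‖ₑ ^ 2) +
        4 * (R ^ 2 * ∫⁻ t in Ioo (1 - 1 / 2 : ℝ) 1,
          ‖gradient φ (coneMap x₀ e (s, t))‖ₑ ^ 2)) :=
        setLIntegral_mono' measurableSet_Icc hpt
    _ = 4 * coneIntegral x₀ e (1 / 2) (fun x => ‖φ x‖ₑ ^ 2) +
        4 * (R ^ 2 * coneIntegral x₀ e (1 / 2) (fun x => ‖gradient φ x‖ₑ ^ 2)) := by
        rw [lintegral_add_left ((measurable_coneIntegrand hφm).const_mul 4),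
          lintegral_const_mul' _ _ (by simp), lintegral_const_mul' _ _ (by simp),
          lintegral_const_mul' _ _ (by simp)]
        rfl
    _ ≤ 4 * (k * ∫⁻ x in interior P, ‖φ x‖ₑ ^ 2) +
        4 * (R ^ 2 * (k * ∫⁻ x in interior P, ‖gradient φ x‖ₑ ^ 2)) := by
        gcongr
        · exact hk2 _ hφm
        · exact hk2 _ hgm
    _ ≤ 4 * (k * (1 + R ^ 2)) * (∫⁻ x in interior P, ‖φ x‖ₑ ^ 2) +
        4 * (k * (1 + R ^ 2)) * ∫⁻ x in interior P, ‖gradient φ x‖ₑ ^ 2 := by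
        refine add_le_add ?_ ?_
        · rw [show ∀ a : ℝ≥0∞, 4 * (k * a) = 4 * (k * 1) * a from fun a => by ring]
          gcongr
          exact le_self_add
        · rw [show ∀ a : ℝ≥0∞, 4 * (R ^ 2 * (k * a)) = 4 * (k * R ^ 2) * a from
            fun a => by ring]
          gcongr
          exact le_add_self
    _ = _ := (mul_add _ _ _).symm

/-- The square of the `L²` norm near an edge, in terms of the values on the edge and of the
gradient. -/
theorem StarCell.exists_sector_bound (hP : StarCell P x₀ ρ) {e : Plane × Plane}
    (he : e.1 ≠ e.2) (hs : seg e ⊆ frontier P) : ∃ C : ℝ≥0, ∀ φ : Plane → ℝ, ContDiff ℝ ∞ φ →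
      ∀ τ : ℝ, 0 < τ → τ ≤ 1 / 2 → ∫⁻ x in sector x₀ e τ, ‖φ x‖ₑ ^ 2 ≤
        C * ((∫⁻ x in seg e, ‖φ x‖ₑ ^ 2 ∂μH[1]) +
          ENNReal.ofReal τ ^ 2 * ∫⁻ x in interior P, ‖gradient φ x‖ₑ ^ 2) := by
  obtain ⟨R, hR⟩ := hP.exists_radius
  have hD := hP.coneDet_ne_zero he hs
  set k : ℝ≥0 := (Real.toNNReal (|coneDet x₀ e| / 2))⁻¹ with hk
  set d : ℝ≥0 := Real.toNNReal |coneDet x₀ e|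
  have hd : nndist e.1 e.2 ≠ 0 := by simpa using he
  refine ⟨d * (2 * (nndist e.1 e.2)⁻¹ + 2 * (R ^ 2 * k)), fun φ hφ τ hτ hτ' => ?_⟩
  have hφm := measurable_sq_enorm hφ.continuous
  have hgm := measurable_sq_enorm (contDiff_gradient_continuous hφ)
  have hτ1 : ENNReal.ofReal τ ≤ 1 := ENNReal.ofReal_le_one.2 (by linarith)
  set E := ∫⁻ s in Icc (0 : ℝ) 1, ‖φ (AffineMap.lineMap e.1 e.2 s)‖ₑ ^ 2 with hE
  set Γ := ∫⁻ x in interior P, ‖gradient φ x‖ₑ ^ 2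
  have h1 : coneIntegral x₀ e τ (fun x => ‖gradient φ x‖ₑ ^ 2) ≤ k * Γ := by
    refine (coneIntegral_le hD hτ' hgm).trans ?_
    exact mul_le_mul_right (lintegral_mono_set (hP.sector_subset hs (by linarith))) _
  have h2 : coneIntegral x₀ e τ (fun x => ‖φ x‖ₑ ^ 2) ≤
      2 * E + 2 * (R ^ 2 * k) * (ENNReal.ofReal τ ^ 2 * Γ) := by
    -- Now the interior value at t is compared with the edge value at t = 1. Integration over a
    -- t-interval of length τ contributes one factor τ, and Cauchy–Schwarz on the ray contributes a
    -- second one to the gradient term.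
    calc coneIntegral x₀ e τ (fun x => ‖φ x‖ₑ ^ 2)
        ≤ ∫⁻ s in Icc (0 : ℝ) 1, ENNReal.ofReal τ * (2 * ‖φ (AffineMap.lineMap e.1 e.2 s)‖ₑ ^ 2 +
          2 * (ENNReal.ofReal τ * (R ^ 2 * ∫⁻ u in Ioo (1 - τ) 1,
            ‖gradient φ (coneMap x₀ e (s, u))‖ₑ ^ 2))) := by
          refine setLIntegral_mono' measurableSet_Icc fun s hs' => ?_
          calc _ ≤ ∫⁻ _ in Ioo (1 - τ) 1, (2 * ‖φ (AffineMap.lineMap e.1 e.2 s)‖ₑ ^ 2 +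
              2 * (ENNReal.ofReal τ * (R ^ 2 * ∫⁻ u in Ioo (1 - τ) 1,
                ‖gradient φ (coneMap x₀ e (s, u))‖ₑ ^ 2))) := by
                refine setLIntegral_mono' measurableSet_Ioo fun t ht => ?_
                have := enorm_sq_coneMap_le hφ (hR e hs s hs') (τ := τ) (t := t) (t' := 1)
                  (Ioo_subset_Icc_self ht) ⟨by linarith, le_rfl⟩
                have h2 : coneMap x₀ e (s, 1) = AffineMap.lineMap e.1 e.2 s := by simp [coneMap]
                rwa [h2] at this
            _ = _ := by
                rw [setLIntegral_const, Real.volume_Ioo, sub_sub_cancel, mul_comm]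
      _ = ENNReal.ofReal τ * (2 * E + 2 * (ENNReal.ofReal τ * (R ^ 2 *
          coneIntegral x₀ e τ (fun x => ‖gradient φ x‖ₑ ^ 2)))) := by
          have hm : Measurable fun s : ℝ => ‖φ (AffineMap.lineMap e.1 e.2 s)‖ₑ ^ 2 :=
            hφm.comp (AffineMap.lineMap_continuous (R := ℝ) (p := e.1) (q := e.2)).measurable
          rw [lintegral_const_mul' _ _ (by simp), lintegral_add_left (hm.const_mul 2),
            lintegral_const_mul' _ _ (by simp), lintegral_const_mul' _ _ (by simp),
            lintegral_const_mul' _ _ (by simp), lintegral_const_mul' _ _ (by simp)]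
          rfl
      _ ≤ ENNReal.ofReal τ * (2 * E + 2 * (ENNReal.ofReal τ * (R ^ 2 * (k * Γ)))) := by gcongr
      _ = ENNReal.ofReal τ * (2 * E) + 2 * (R ^ 2 * k) * (ENNReal.ofReal τ ^ 2 * Γ) := by ring
      -- Only the edge term gives up its factor τ, by τ ≤ 1; the gradient term must keep τ².
      _ ≤ _ := by
          exact add_le_add (mul_le_of_le_one_left zero_le hτ1) le_rfl
  have h3 : E = (nndist e.1 e.2 : ℝ≥0∞)⁻¹ * ∫⁻ x in seg e, ‖φ x‖ₑ ^ 2 ∂μH[1] := by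
    rw [lintegral_seg hφm, ← mul_assoc, ENNReal.inv_mul_cancel (by simpa using hd) (by simp),
      one_mul]
  refine (lintegral_sector_le hD (by linarith) hφm).trans ?_
  rw [ENNReal.coe_mul, mul_assoc]
  refine mul_le_mul_right (h2.trans ?_) _
  rw [mul_add, h3]
  push_cast
  rw [ENNReal.coe_inv hd, edist_nndist]
  refine add_le_add ?_ ?_
  · rw [← mul_assoc]
    exact mul_le_mul' le_self_add le_rfl
  · gcongr
    exact le_add_self

end ConeEstimates

end XVEM

/-! ### Averages at contracted points. -/

namespace XVEM

section Averages

open scoped ENNReal NNReal Convolution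

/-- `η` is a smooth probability density, compactly supported in the ball of centre `x₀` and
radius `ρ`. -/
structure IsKernel (η : Plane → ℝ) (x₀ : Plane) (ρ : ℝ) : Prop where
  smooth : ContDiff ℝ ∞ η
  compact : HasCompactSupport η
  nonneg : ∀ y, 0 ≤ η y
  integral_eq_one : ∫ y, η y = 1
  tsupport_subset : tsupport η ⊆ Metric.ball x₀ ρ

theorem exists_isKernel (x₀ : Plane) {ρ : ℝ} (hρ : 0 < ρ) : ∃ η, IsKernel η x₀ ρ := by
  let b : ContDiffBump x₀ := ⟨ρ / 4, ρ / 2, by positivity, by linarith⟩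
  refine ⟨b.normed volume, b.contDiff_normed, b.hasCompactSupport_normed, b.nonneg_normed,
    b.integral_normed, ?_⟩
  rw [b.tsupport_normed_eq]
  exact Metric.closedBall_subset_ball (by change ρ / 2 < ρ; linarith)


variable {E : Type*} [NormedAddCommGroup E]

theorem integrable_affine {F : Plane → E} (hF : Integrable F) (z : Plane) {β : ℝ} (hβ : β ≠ 0) :
    Integrable (fun y : Plane => F (z + β • y)) :=
  (hF.comp_add_left z).comp_smul hβ

variable [NormedSpace ℝ E]

/-- The average of `F` at the points `α x + β y`, where `y` is distributed with density `η`. -/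
noncomputable def avg (η : Plane → ℝ) (α β : ℝ) (F : Plane → E) (x : Plane) : E :=
  ∫ y, η y • F (α • x + β • y)

theorem quasiMeasurePreserving_affine (z : Plane) {β : ℝ} (hβ : β ≠ 0) :
    Measure.QuasiMeasurePreserving (fun y : Plane => z + β • y) volume volume :=
  (measurePreserving_add_left volume z).quasiMeasurePreserving.comp
    (Measure.quasiMeasurePreserving_smul volume hβ)

theorem lintegral_affine (z : Plane) {β : ℝ} (hβ : β ≠ 0) {f : Plane → ℝ≥0∞}
    (hf : Measurable f) :
    ∫⁻ y, f (z + β • y) = ENNReal.ofReal ((β ^ 2)⁻¹) * ∫⁻ w, f w := by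
  have h1 : ∫⁻ y : Plane, f (z + β • y) = ∫⁻ w, f (z + w) ∂(Measure.map (β • ·) volume) :=
    (lintegral_map (hf.comp (measurable_const_add z)) (measurable_const_smul β)).symm
  rw [h1, Measure.map_addHaar_smul volume hβ, lintegral_smul_measure, lintegral_add_left_eq_self]
  simp

theorem integral_affine (F : Plane → E) (z : Plane) (β : ℝ) :
    ∫ y : Plane, F (z + β • y) = (β ^ 2)⁻¹ • ∫ w, F w := by
  have := Measure.integral_comp_smul volume (fun w : Plane => F (z + w)) β
  rw [this, integral_add_left_eq_self]
  simp

variable {η : Plane → ℝ} {x₀ : Plane} {ρ : ℝ}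

theorem avg_congr_ae {F F' : Plane → E} (h : F =ᵐ[volume] F') {α β : ℝ} (hβ : β ≠ 0) :
    avg η α β F = avg η α β F' := by
  funext x
  refine integral_congr_ae ?_
  filter_upwards [(quasiMeasurePreserving_affine (α • x) hβ).ae h] with y hy
  simp only [hy]

theorem IsKernel.eq_zero (hη : IsKernel η x₀ ρ) {y : Plane} (hy : y ∉ Metric.ball x₀ ρ) :
    η y = 0 := image_eq_zero_of_notMem_tsupport fun h => hy (hη.tsupport_subset h)

theorem IsKernel.avg_congr (hη : IsKernel η x₀ ρ) {F F' : Plane → E} {α β : ℝ} {x : Plane}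
    (h : ∀ y ∈ Metric.ball x₀ ρ, F (α • x + β • y) = F' (α • x + β • y)) :
    avg η α β F x = avg η α β F' x := by
  refine integral_congr_ae (ae_of_all _ fun y => ?_)
  by_cases hy : y ∈ Metric.ball x₀ ρ
  · simp only [h y hy]
  · simp only [hη.eq_zero hy, zero_smul]

theorem IsKernel.integrable_smul (hη : IsKernel η x₀ ρ) {F : Plane → E} (hF : Integrable F)
    {β : ℝ} (hβ : β ≠ 0) (z : Plane) : Integrable (fun y => η y • F (z + β • y)) := by
  obtain ⟨C, hC⟩ := hη.compact.exists_bound_of_continuous hη.smooth.continuous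
  exact (integrable_affine hF z hβ).bdd_smul C hη.smooth.continuous.aestronglyMeasurable
    (ae_of_all _ hC)

theorem IsKernel.integrable (hη : IsKernel η x₀ ρ) : Integrable η :=
  hη.smooth.continuous.integrable_of_hasCompactSupport hη.compact

/-- Writing αx + βy as β((α/β)x + y) turns the average into a convolution with the reflected kernel,
evaluated at (α/β)x. Smoothness and the derivative are then inherited from convolutions. -/
theorem avg_eq_convolution (F : Plane → ℝ) {α β : ℝ} (hβ : β ≠ 0) (x : Plane) :
    avg η α β F x = ((fun y => η (-y)) ⋆[ContinuousLinearMap.lsmul ℝ ℝ, volume]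
      (fun z => F (β • z))) ((α / β) • x) := by
  rw [convolution_def, avg, ← integral_neg_eq_self]
  refine integral_congr_ae (ae_of_all _ fun y => ?_)
  simp only [ContinuousLinearMap.lsmul_apply]
  congr 2
  rw [smul_sub, smul_smul, mul_div_cancel₀ _ hβ, smul_neg, sub_eq_add_neg]

theorem IsKernel.contDiff_avg (hη : IsKernel η x₀ ρ) {F : Plane → ℝ} (hF : Integrable F)
    (α : ℝ) {β : ℝ} (hβ : β ≠ 0) : ContDiff ℝ ∞ (avg η α β F) := by
  have h1 : avg η α β F = ((fun y => η (-y)) ⋆[ContinuousLinearMap.lsmul ℝ ℝ, volume]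
      (fun z => F (β • z))) ∘ fun x => (α / β) • x := funext fun x => avg_eq_convolution F hβ x
  rw [h1]
  refine ContDiff.comp ?_ (contDiff_const_smul _)
  refine HasCompactSupport.contDiff_convolution_left _ ?_ (hη.smooth.comp contDiff_neg)
    (hF.comp_smul hβ).locallyIntegrable
  exact hη.compact.comp_homeomorph (Homeomorph.neg Plane)

/-- The derivative falls on the kernel: the sign comes from the reflection and the factor α/β from
the inner dilation. No regularity of F beyond integrability enters. -/
theorem IsKernel.fderiv_avg (hη : IsKernel η x₀ ρ) {F : Plane → ℝ} (hF : Integrable F)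
    (α : ℝ) {β : ℝ} (hβ : β ≠ 0) (x v : Plane) :
    fderiv ℝ (avg η α β F) x v =
      -(α / β) * ∫ y, fderiv ℝ η y v * F (α • x + β • y) := by
  have h1 : avg η α β F = ((fun y => η (-y)) ⋆[ContinuousLinearMap.lsmul ℝ ℝ, volume]
      (fun z => F (β • z))) ∘ fun x => (α / β) • x := funext fun x => avg_eq_convolution F hβ x
  have hcs : HasCompactSupport (fun y => η (-y)) :=
    hη.compact.comp_homeomorph (Homeomorph.neg Plane)
  have hsm : ContDiff ℝ ∞ (fun y => η (-y)) := hη.smooth.comp contDiff_neg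
  have hl : LocallyIntegrable (fun z : Plane => F (β • z)) :=
    (hF.comp_smul hβ).locallyIntegrable
  have h2 := hcs.hasFDerivAt_convolution_left (ContinuousLinearMap.lsmul ℝ ℝ)
    (hsm.of_le (by simp)) hl ((α / β) • x)
  have h3 : HasFDerivAt (fun x : Plane => (α / β) • x) ((α / β) • ContinuousLinearMap.id ℝ Plane)
    x := ((α / β) • ContinuousLinearMap.id ℝ Plane).hasFDerivAt
  have h4 := h2.comp x h3
  rw [h1, h4.fderiv]
  have hcont : Continuous (fderiv ℝ fun y => η (-y)) := hsm.continuous_fderiv (by simp)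
  have h5 := ((hcs.fderiv (𝕜 := ℝ)).convolutionExists_left
    ((ContinuousLinearMap.lsmul ℝ ℝ).precompL Plane) hcont hl ((α / β) • x)).integrable
  rw [ContinuousLinearMap.comp_apply, convolution_def,
    ContinuousLinearMap.integral_apply h5, ← integral_neg_eq_self]
  simp only [_root_.smul_apply, ContinuousLinearMap.id_apply, 
    ContinuousLinearMap.precompL_apply, ContinuousLinearMap.lsmul_apply]
  rw [← integral_const_mul]
  refine integral_congr_ae (ae_of_all _ fun y => ?_)
  have h6 : fderiv ℝ (fun y => η (-y)) (-y) = -fderiv ℝ η y := by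
    have hd : HasFDerivAt (fun z : Plane => -z) (-(ContinuousLinearMap.id ℝ Plane)) (-y) :=
      (hasFDerivAt_id _).neg
    have hη' := (hη.smooth.differentiable (by simp) (- -y)).hasFDerivAt.comp (-y) hd
    rw [neg_neg] at hη'
    rw [show (fun y => η (-y)) = η ∘ fun z => -z from rfl, hη'.fderiv]
    ext
    simp
  simp only [h6, map_smul]
  have h7 : β • ((α / β) • x - -y) = α • x + β • y := by
    rw [smul_sub, smul_smul, mul_div_cancel₀ _ hβ, smul_neg, sub_neg_eq_add]
  rw [h7]
  simp
  ring

end Averages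

end XVEM

/-! ### Smooth approximation on star-shaped cells. -/

namespace XVEM

section SmoothApproximation

open scoped ENNReal NNReal

variable {E : Type*} [NormedAddCommGroup E] [NormedSpace ℝ E]
  {η : Plane → ℝ} {P : Set Plane} {x₀ : Plane} {ρ : ℝ}

theorem StarCell.integrable_indicator {F : Type*} [NormedAddCommGroup F]
    (hP : StarCell P x₀ ρ) {f : Plane → F}
    (hf : MemLp f 2 (volume.restrict (interior P))) :
    Integrable ((interior P).indicator f) := by
  have := hP.isFiniteMeasure
  rw [integrable_indicator_iff isOpen_interior.measurableSet]
  exact hf.integrable (by norm_num)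

/-- The support is the contraction (1 - δ)x + δ supp η, which is inside the interior even when x is
a frontier point. Rescaled kernels are thus admissible in the definition of the weak gradient. -/
theorem IsKernel.isTestFunction (hη : IsKernel η x₀ ρ) (hP : StarCell P x₀ ρ) {δ : ℝ}
    (h0 : 0 < δ) (h1 : δ ≤ 1) {x : Plane} (hx : x ∈ P) :
    IsTestFunction (interior P) fun w => η (δ⁻¹ • (w - (1 - δ) • x)) := by
  have hδ : δ⁻¹ ≠ 0 := inv_ne_zero h0.ne'
  let h : Plane ≃ₜ Plane := (Homeomorph.addRight (-((1 - δ) • x))).trans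
    (Homeomorph.smulOfNeZero δ⁻¹ hδ)
  have hh : (fun w => η (δ⁻¹ • (w - (1 - δ) • x))) = η ∘ h := by
    funext w
    simp [h, sub_eq_add_neg]
  refine ⟨hη.smooth.comp (by fun_prop), ?_, ?_⟩
  · rw [hh]
    exact hη.compact.comp_homeomorph h
  · intro w hw
    rw [hh] at hw
    have hw2 : h w ∈ tsupport η := by
      have := tsupport_comp_subset_preimage η h.continuous hw
      exact this
    have := hP.star_mem_interior hx (hη.tsupport_subset hw2) h0 h1
    convert this using 1
    simp only [h, Homeomorph.trans_apply, Homeomorph.coe_addRight, Homeomorph.smulOfNeZero_apply]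
    rw [smul_inv_smul₀ h0.ne']
    abel

/-- The derivative of the average is an integral of v against the gradient of a rescaled kernel, and
the weak gradient moves it back onto v. The extension of v by zero creates no boundary term, since
that kernel is supported in the interior. -/
theorem IsKernel.gradient_avg (hη : IsKernel η x₀ ρ) (hP : StarCell P x₀ ρ) {v : Plane → ℝ}
    {G : Plane → Plane} (hG : HasWeakGrad (interior P) v G) {δ : ℝ} (h0 : 0 < δ) (h1 : δ ≤ 1)
    {x : Plane} (hx : x ∈ P) :
    gradient (avg η (1 - δ) δ ((interior P).indicator v)) x =
      (1 - δ) • avg η (1 - δ) δ ((interior P).indicator G) x := by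
  have hδ := h0.ne'
  have hU : MeasurableSet (interior P) := isOpen_interior.measurableSet
  have hψ := hη.isTestFunction hP h0 h1 hx
  set ψ : Plane → ℝ := fun w => η (δ⁻¹ • (w - (1 - δ) • x)) with hψd
  have hback : ∀ y : Plane, δ⁻¹ • ((1 - δ) • x + δ • y - (1 - δ) • x) = y := fun y => by
    rw [add_sub_cancel_left, inv_smul_smul₀ hδ]
  ext i
  have hgrad : ∀ w, gradient ψ w i =
      δ⁻¹ * fderiv ℝ η (δ⁻¹ • (w - (1 - δ) • x)) (EuclideanSpace.single i 1) := fun w => by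
    rw [gradient_coord]
    have hd : HasFDerivAt (fun w : Plane => δ⁻¹ • (w - (1 - δ) • x))
        (δ⁻¹ • ContinuousLinearMap.id ℝ Plane) w :=
      ((hasFDerivAt_id (𝕜 := ℝ) w).sub_const ((1 - δ) • x)).const_smul δ⁻¹
    rw [show ψ = η ∘ fun w => δ⁻¹ • (w - (1 - δ) • x) from rfl,
      ((hη.smooth.differentiable (by simp) _).hasFDerivAt.comp w hd).fderiv]
    simp
  -- Substitution of w = (1 - δ)x + δy: the Jacobian in dimension two is δ², and differentiating the
  -- rescaled kernel costs δ⁻¹, which the factor δ undoes.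
  have e1 : ∫ y, fderiv ℝ η y (EuclideanSpace.single i 1) *
      (interior P).indicator v ((1 - δ) • x + δ • y) =
      (δ ^ 2)⁻¹ * (δ * ∫ w in interior P, v w * gradient ψ w i) := by
    have := integral_affine (fun w => fderiv ℝ η (δ⁻¹ • (w - (1 - δ) • x))
      (EuclideanSpace.single i 1) * (interior P).indicator v w) ((1 - δ) • x) δ
    simp only [hback] at this
    rw [this, smul_eq_mul, ← integral_indicator hU, ← integral_const_mul δ]
    congr 2
    funext w
    by_cases hw : w ∈ interior P
    · simp only [indicator_of_mem hw, hgrad]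
      field_simp
    · simp only [indicator_of_notMem hw, mul_zero]
  have e2 : avg η (1 - δ) δ ((interior P).indicator G) x i =
      (δ ^ 2)⁻¹ * ∫ w in interior P, G w i * ψ w := by
    have h3 : ∫ y, η y * ((interior P).indicator G ((1 - δ) • x + δ • y)) i =
        avg η (1 - δ) δ ((interior P).indicator G) x i :=
      (EuclideanSpace.proj i : Plane →L[ℝ] ℝ).integral_comp_comm
        (hη.integrable_smul (hP.integrable_indicator hG.memLp_grad) hδ ((1 - δ) • x))
    rw [← h3]
    have := integral_affine (fun w => η (δ⁻¹ • (w - (1 - δ) • x)) *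
      ((interior P).indicator G w) i) ((1 - δ) • x) δ
    simp only [hback] at this
    rw [this, smul_eq_mul, ← integral_indicator hU]
    congr 2
    funext w
    by_cases hw : w ∈ interior P
    · simp only [indicator_of_mem hw, hψd]
      ring
    · simp [indicator_of_notMem hw]
  rw [gradient_coord, hη.fderiv_avg (hP.integrable_indicator hG.memLp) _ hδ, e1,
    PiLp.smul_apply, smul_eq_mul, e2, hG.integral_eq ψ hψ i]
  field_simp

/-- The averages of a function that is continuous on a star-shaped cell converge uniformly. -/
theorem IsKernel.tendstoUniformlyOn_avg [CompleteSpace E] (hη : IsKernel η x₀ ρ)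
    (hP : StarCell P x₀ ρ) {F : Plane → E} (hF : ContinuousOn F P) {ε : ℝ} (hε : 0 < ε) :
    ∃ δ₀ > 0, ∀ δ, 0 < δ → δ ≤ δ₀ → δ ≤ 1 → ∀ x ∈ P, ‖avg η (1 - δ) δ F x - F x‖ ≤ ε := by
  have huc := hP.isCompact.uniformContinuousOn_of_continuous hF
  obtain ⟨r, hr, hF'⟩ := Metric.uniformContinuousOn_iff.1 huc ε hε
  obtain ⟨D, hD⟩ := (Metric.isBounded_iff.1 hP.isCompact.isBounded)
  have hD0 : 0 ≤ D := (dist_nonneg).trans (hD (interior_subset hP.center_mem_interior)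
    (interior_subset hP.center_mem_interior))
  -- A sample point differs from x by δ(y - x), of length at most δD; D + 1 keeps the denominator
  -- positive.
  refine ⟨r / (2 * (D + 1)), by positivity, fun δ h0 h1 h2 x hx => ?_⟩
  have hpt : ∀ y ∈ Metric.ball x₀ ρ, ‖F ((1 - δ) • x + δ • y) - F x‖ ≤ ε := fun y hy => by
    rw [← dist_eq_norm]
    refine (hF' _ (interior_subset (hP.star_mem_interior hx hy h0 h2)) _ hx ?_).le
    have : (1 - δ) • x + δ • y - x = δ • (y - x) := by module
    rw [dist_eq_norm, this, norm_smul, Real.norm_of_nonneg h0.le, ← dist_eq_norm]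
    have h3 := hD (hP.ball_subset hy) hx
    rw [le_div_iff₀ (by positivity)] at h1
    nlinarith
  have hcF : ∀ y, η y • F ((1 - δ) • x + δ • y) = η y • (F ((1 - δ) • x + δ • y) - F x) +
      η y • F x := fun y => by rw [smul_sub, sub_add_cancel]
  have hint : Integrable fun y => η y • (F ((1 - δ) • x + δ • y) - F x) := by
    -- F is only continuous on `P`, so integrability is checked on the compact support of the
    -- kernel, where every sample point lies in `P`.
    refine (integrableOn_iff_integrable_of_support_subset (s := tsupport η) ?_).1 ?_
    · intro y hy
      refine subset_tsupport _ fun h => hy ?_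
      simp [h]
    · refine ContinuousOn.integrableOn_compact hη.compact ?_
      refine hη.smooth.continuous.continuousOn.smul (ContinuousOn.sub ?_ continuousOn_const)
      exact hF.comp (by fun_prop) fun y hy =>
        interior_subset (hP.star_mem_interior hx (hη.tsupport_subset hy) h0 h2)
  have h4 : avg η (1 - δ) δ F x - F x = ∫ y, η y • (F ((1 - δ) • x + δ • y) - F x) := by
    unfold avg
    simp only [hcF]
    rw [integral_add hint (hη.integrable.smul_const _), integral_smul_const, hη.integral_eq_one,
      one_smul, add_sub_cancel_right]
  rw [h4]
  calc _ ≤ ∫ y, η y * ε := by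
        refine norm_integral_le_of_norm_le (hη.integrable.mul_const ε) (ae_of_all _ fun y => ?_)
        rw [norm_smul, Real.norm_of_nonneg (hη.nonneg y)]
        by_cases hy : y ∈ Metric.ball x₀ ρ
        · exact mul_le_mul_of_nonneg_left (hpt y hy) (hη.nonneg y)
        · simp [hη.eq_zero hy]
    _ = ε := by rw [integral_mul_const, hη.integral_eq_one, one_mul]

end SmoothApproximation

end XVEM

namespace XVEM

section SmoothApproximation

open scoped ENNReal NNReal

variable {E : Type*} [NormedAddCommGroup E] [NormedSpace ℝ E]
  {η : Plane → ℝ} {P : Set Plane} {x₀ : Plane} {ρ : ℝ}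

theorem IsKernel.stronglyMeasurable_avg (hη : IsKernel η x₀ ρ) {F : Plane → E}
    (hF : StronglyMeasurable F) (α β : ℝ) : StronglyMeasurable (avg η α β F) := by
  have h1 : StronglyMeasurable fun p : Plane × Plane => η p.2 • F (α • p.1 + β • p.2) :=
    (hη.smooth.continuous.comp continuous_snd).stronglyMeasurable.smul
      (hF.comp_measurable (by fun_prop))
  exact h1.integral_prod_right'

/-- Jensen's inequality for the density η, then Tonelli. For fixed y the map x ↦ αx + βy is a
dilation by α, so the constant depends on α only and is uniform as β tends to zero. -/
theorem IsKernel.lintegral_avg_le (hη : IsKernel η x₀ ρ) {F : Plane → E}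
    (hF : StronglyMeasurable F) {α β : ℝ} (hα : α ≠ 0) :
    ∫⁻ x, ‖avg η α β F x‖ₑ ^ 2 ≤ ENNReal.ofReal ((α ^ 2)⁻¹) * ∫⁻ x, ‖F x‖ₑ ^ 2 := by
  have hηm : Measurable fun y => ENNReal.ofReal (η y) :=
    hη.smooth.continuous.measurable.ennreal_ofReal
  have hη1 : ∫⁻ y, ENNReal.ofReal (η y) = 1 := by
    rw [← ofReal_integral_eq_lintegral_ofReal hη.integrable (ae_of_all _ hη.nonneg),
      hη.integral_eq_one, ENNReal.ofReal_one]
  have hFm : Measurable fun x => ‖F x‖ₑ := hF.enorm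
  have hpt : ∀ x, ‖avg η α β F x‖ₑ ^ 2 ≤
      ∫⁻ y, ENNReal.ofReal (η y) * ‖F (α • x + β • y)‖ₑ ^ 2 := by
    intro x
    have hm : Measurable fun y => ‖F (α • x + β • y)‖ₑ := hFm.comp (by fun_prop)
    have h1 := lintegral_sq_le (volume.withDensity fun y => ENNReal.ofReal (η y))
      hm.aemeasurable
    rw [withDensity_apply _ MeasurableSet.univ, Measure.restrict_univ, hη1, one_mul,
      lintegral_withDensity_eq_lintegral_mul _ hηm hm,
      lintegral_withDensity_eq_lintegral_mul _ hηm (hm.pow_const 2)] at h1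
    refine le_trans ?_ h1
    gcongr
    refine (enorm_integral_le_lintegral_enorm _).trans (lintegral_mono fun y => ?_)
    rw [enorm_smul, Real.enorm_of_nonneg (hη.nonneg y)]
    rfl
  calc _ ≤ ∫⁻ x, ∫⁻ y, ENNReal.ofReal (η y) * ‖F (α • x + β • y)‖ₑ ^ 2 := lintegral_mono hpt
    _ = ∫⁻ y, ∫⁻ x, ENNReal.ofReal (η y) * ‖F (α • x + β • y)‖ₑ ^ 2 := by
      refine lintegral_lintegral_swap ?_
      refine Measurable.aemeasurable ?_
      exact (hηm.comp measurable_snd).mul ((hFm.comp (by fun_prop)).pow_const 2)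
    _ = ∫⁻ y, ENNReal.ofReal (η y) * (ENNReal.ofReal ((α ^ 2)⁻¹) * ∫⁻ x, ‖F x‖ₑ ^ 2) := by
      refine lintegral_congr fun y => ?_
      rw [lintegral_const_mul' _ _ (by simp), ← lintegral_affine (β • y) hα (hFm.pow_const 2)]
      simp only [add_comm]
    _ = _ := by rw [lintegral_mul_const _ hηm, hη1, one_mul]

theorem IsKernel.eLpNorm_avg_le (hη : IsKernel η x₀ ρ) {F : Plane → E}
    (hF : StronglyMeasurable F) {α β : ℝ} (hα : 1 / 2 ≤ α) :
    eLpNorm (avg η α β F) 2 volume ≤ 2 * eLpNorm F 2 volume := by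
  rw [← ENNReal.pow_le_pow_left_iff two_ne_zero, mul_pow, eLpNorm_two_sq, eLpNorm_two_sq]
  refine (hη.lintegral_avg_le hF (by linarith)).trans ?_
  gcongr
  rw [show (2 : ℝ≥0∞) ^ 2 = ENNReal.ofReal 4 by norm_num]
  refine ENNReal.ofReal_le_ofReal ?_
  rw [inv_le_comm₀ (by positivity) (by norm_num)]
  nlinarith

/-- Density argument: averages are bounded in `L²` by the factor 2 as long as α ≥ 1/2, and for a
compactly supported continuous function they converge uniformly on `P`, a set of finite measure. -/
theorem IsKernel.tendsto_eLpNorm_avg [CompleteSpace E] (hη : IsKernel η x₀ ρ)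
    (hP : StarCell P x₀ ρ) {F : Plane → E} (hF : MemLp F 2 volume) (hFi : Integrable F)
    {δ : ℕ → ℝ} (h0 : ∀ n, 0 < δ n) (h1 : ∀ n, δ n ≤ 1 / 2) (hδ : Tendsto δ atTop (𝓝 0)) :
    Tendsto (fun n => eLpNorm (avg η (1 - δ n) (δ n) F - F) 2 (volume.restrict (interior P)))
      atTop (𝓝 0) := by
  have hfin := hP.isFiniteMeasure
  -- Tonelli requires genuine measurability. Averages do not see the change of representative,
  -- because affine maps with β ≠ 0 pull null sets back to null sets.
  set F' := hF.1.mk F with hF'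
  have hFF' : F =ᵐ[volume] F' := hF.1.ae_eq_mk
  have hF's : StronglyMeasurable F' := hF.1.stronglyMeasurable_mk
  have hF'L : MemLp F' 2 volume := hF.ae_eq hFF'
  have hF'i : Integrable F' := hFi.congr hFF'
  have hred : ∀ n, eLpNorm (avg η (1 - δ n) (δ n) F - F) 2 (volume.restrict (interior P)) =
      eLpNorm (avg η (1 - δ n) (δ n) F' - F') 2 (volume.restrict (interior P)) := fun n => by
    rw [avg_congr_ae hFF' (h0 n).ne']
    refine eLpNorm_congr_ae ?_
    filter_upwards [ae_restrict_of_ae hFF'] with x hx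
    simp only [Pi.sub_apply, hx]
  simp only [hred]
  rw [ENNReal.tendsto_nhds_zero]
  intro ε hε
  obtain ⟨r, hr0, hrε⟩ := ENNReal.lt_iff_exists_nnreal_btwn.1 hε
  have hr0 : 0 < r := by exact_mod_cast hr0
  obtain ⟨g, hgc, hgε, hgcont, hgL⟩ := hF'L.exists_hasCompactSupport_eLpNorm_sub_le
    (by norm_num) (ε := ((r / 4 : ℝ≥0) : ℝ≥0∞)) (by simpa using hr0.ne')
  have hgi : Integrable g := hgcont.integrable_of_hasCompactSupport hgc
  set m : ℝ≥0∞ := (volume.restrict (interior P) : Measure Plane) univ ^ (2 : ℝ≥0∞).toReal⁻¹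
    with hm
  have hmfin : m ≠ ⊤ := ENNReal.rpow_ne_top_of_nonneg (inv_nonneg.2 ENNReal.toReal_nonneg)
    (measure_ne_top _ _)
  have hr4 : (0 : ℝ) < r / 4 := by positivity
  obtain ⟨δ₀, hδ₀, hunif⟩ := hη.tendstoUniformlyOn_avg hP hgcont.continuousOn
    (show 0 < (r / 4 : ℝ) / (m.toReal + 1) by positivity)
  filter_upwards [hδ.eventually (gt_mem_nhds hδ₀)] with n hn
  have hsm := hη.stronglyMeasurable_avg (hF's.sub hgcont.stronglyMeasurable) (1 - δ n) (δ n)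
  have hsg := hη.stronglyMeasurable_avg hgcont.stronglyMeasurable (1 - δ n) (δ n)
  have hsplit : avg η (1 - δ n) (δ n) F' - F' = avg η (1 - δ n) (δ n) (F' - g) +
      (avg η (1 - δ n) (δ n) g - g) - (F' - g) := by
    have : avg η (1 - δ n) (δ n) F' =
        avg η (1 - δ n) (δ n) (F' - g) + avg η (1 - δ n) (δ n) g := by
      funext x
      simp only [avg, Pi.add_apply]
      rw [← integral_add (hη.integrable_smul (hF'i.sub hgi) (h0 n).ne' _)
        (hη.integrable_smul hgi (h0 n).ne' _)]
      refine integral_congr_ae (ae_of_all _ fun y => ?_)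
      simp only [Pi.sub_apply, smul_sub, sub_add_cancel]
    rw [this]
    abel
  have e1 : eLpNorm (avg η (1 - δ n) (δ n) (F' - g)) 2 (volume.restrict (interior P)) ≤
      2 * ((r / 4 : ℝ≥0) : ℝ≥0∞) :=
    (eLpNorm_mono_measure _ Measure.restrict_le_self).trans
      ((hη.eLpNorm_avg_le (hF's.sub hgcont.stronglyMeasurable) (by linarith [h1 n])).trans
        (by gcongr))
  have e2 : eLpNorm (avg η (1 - δ n) (δ n) g - g) 2 (volume.restrict (interior P)) ≤
      ((r / 4 : ℝ≥0) : ℝ≥0∞) := by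
    refine (eLpNorm_le_of_ae_bound (C := (r / 4 : ℝ) / (m.toReal + 1)) ?_).trans ?_
    · filter_upwards [ae_restrict_mem isOpen_interior.measurableSet] with x hx
      exact hunif (δ n) (h0 n) hn.le (by linarith [h1 n]) x (interior_subset hx)
    · have hmul : ∀ c, m * ENNReal.ofReal c = ENNReal.ofReal (m.toReal * c) := fun c => by
        rw [ENNReal.ofReal_mul ENNReal.toReal_nonneg, ENNReal.ofReal_toReal hmfin]
      rw [← hm, hmul, ← ENNReal.ofReal_coe_nnreal]
      refine ENNReal.ofReal_le_ofReal ?_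
      push_cast
      rw [mul_div_assoc', div_le_iff₀ (by positivity)]
      nlinarith [ENNReal.toReal_nonneg (a := m)]
  have e3 : eLpNorm (F' - g) 2 (volume.restrict (interior P)) ≤ ((r / 4 : ℝ≥0) : ℝ≥0∞) :=
    (eLpNorm_mono_measure _ Measure.restrict_le_self).trans hgε
  rw [hsplit]
  calc _ ≤ eLpNorm (avg η (1 - δ n) (δ n) (F' - g)) 2 (volume.restrict (interior P)) +
        eLpNorm (avg η (1 - δ n) (δ n) g - g) 2 (volume.restrict (interior P)) +
        eLpNorm (F' - g) 2 (volume.restrict (interior P)) := by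
        refine (eLpNorm_sub_le (hsm.add (hsg.sub hgcont.stronglyMeasurable)).aestronglyMeasurable
          (hF's.sub hgcont.stronglyMeasurable).aestronglyMeasurable (by norm_num)).trans ?_
        gcongr
        exact eLpNorm_add_le hsm.aestronglyMeasurable
          (hsg.sub hgcont.stronglyMeasurable).aestronglyMeasurable (by norm_num)
    _ ≤ 2 * ((r / 4 : ℝ≥0) : ℝ≥0∞) + ((r / 4 : ℝ≥0) : ℝ≥0∞) + ((r / 4 : ℝ≥0) : ℝ≥0∞) := by
        gcongr
    _ = r := by
        norm_cast
        rw [← NNReal.coe_inj]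
        push_cast
        ring
    _ ≤ ε := hrε.le

theorem StarCell.memLp_indicator {F : Type*} [NormedAddCommGroup F] {f : Plane → F}
    (hf : MemLp f 2 (volume.restrict (interior P))) :
    MemLp ((interior P).indicator f) 2 volume :=
  (memLp_indicator_iff_restrict isOpen_interior.measurableSet).2 hf

/-- Functions that are smooth on the plane are dense in `H¹` of a star-shaped cell. The
approximation is uniform for continuous functions, and it preserves vanishing gradients. -/
theorem StarCell.exists_smooth_approx (hP : StarCell P x₀ ρ) {v : Plane → ℝ} {G : Plane → Plane}
    (hG : HasWeakGrad (interior P) v G) : ∃ φ : ℕ → Plane → ℝ, (∀ n, ContDiff ℝ ∞ (φ n)) ∧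
      Tendsto (fun n => eLpNorm (φ n - v) 2 (volume.restrict (interior P))) atTop (𝓝 0) ∧
      Tendsto (fun n => eLpNorm (gradient (φ n) - G) 2 (volume.restrict (interior P)))
        atTop (𝓝 0) ∧
      (ContinuousOn v P → ∀ ε > 0, ∀ᶠ n in atTop, ∀ x ∈ P, ‖φ n x - v x‖ ≤ ε) ∧
      (G =ᵐ[volume.restrict (interior P)] 0 → ∀ n, ∀ x ∈ interior P, gradient (φ n) x = 0) := by
  obtain ⟨η, hη⟩ := exists_isKernel x₀ hP.pos
  have hU : MeasurableSet (interior P) := isOpen_interior.measurableSet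
  -- The shift by 2 gives δ ≤ 1/2, so that the contraction factor 1 - δ is at least 1/2.
  set δ : ℕ → ℝ := fun n => 1 / ((n : ℝ) + 2) with hδd
  have h0 : ∀ n, 0 < δ n := fun n => by positivity
  have h1 : ∀ n, δ n ≤ 1 / 2 := fun n => by
    refine one_div_le_one_div_of_le two_pos ?_
    have : (0 : ℝ) ≤ n := n.cast_nonneg
    linarith
  have hδ : Tendsto δ atTop (𝓝 0) := by
    have := (tendsto_const_div_atTop_nhds_zero_nat (1 : ℝ)).comp (tendsto_add_atTop_nat 2)
    refine this.congr fun n => ?_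
    simp [hδd]
  have hgr : ∀ n, ∀ x ∈ interior P,
      gradient (avg η (1 - δ n) (δ n) ((interior P).indicator v)) x =
        (1 - δ n) • avg η (1 - δ n) (δ n) ((interior P).indicator G) x := fun n x hx =>
    hη.gradient_avg hP hG (h0 n) (by linarith [h1 n]) (interior_subset hx)
  have hind : ∀ {F : Type} [NormedAddCommGroup F] (f : Plane → F),
      (interior P).indicator f =ᵐ[volume.restrict (interior P)] f := fun f =>
    indicator_ae_eq_restrict hU
  refine ⟨fun n => avg η (1 - δ n) (δ n) ((interior P).indicator v), fun n =>
    hη.contDiff_avg (hP.integrable_indicator hG.memLp) _ (h0 n).ne', ?_, ?_, ?_, ?_⟩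
  · refine (hη.tendsto_eLpNorm_avg hP (memLp_indicator hG.memLp)
      (hP.integrable_indicator hG.memLp) h0 h1 hδ).congr fun n => eLpNorm_congr_ae ?_
    filter_upwards [hind v] with x hx
    simp only [Pi.sub_apply, hx]
  · have hl := hη.tendsto_eLpNorm_avg hP (memLp_indicator hG.memLp_grad)
      (hP.integrable_indicator hG.memLp_grad) h0 h1 hδ
    have hm : ∀ n, AEStronglyMeasurable (avg η (1 - δ n) (δ n) ((interior P).indicator G))
        (volume.restrict (interior P)) := fun n => by
      have h2 := (memLp_indicator (P := P) hG.memLp_grad).1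
      rw [avg_congr_ae h2.ae_eq_mk (h0 n).ne']
      exact (hη.stronglyMeasurable_avg h2.stronglyMeasurable_mk _ _).aestronglyMeasurable
    -- The gradient of the approximant is (1 - δ) times an average of G; the second summand is the
    -- error caused by the factor 1 - δ.
    have hb : Tendsto (fun n => eLpNorm (avg η (1 - δ n) (δ n) ((interior P).indicator G) -
        (interior P).indicator G) 2 (volume.restrict (interior P)) +
        ENNReal.ofReal (δ n) * eLpNorm G 2 (volume.restrict (interior P))) atTop (𝓝 0) := by
      have h2 : Tendsto (fun n => ENNReal.ofReal (δ n) *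
          eLpNorm G 2 (volume.restrict (interior P))) atTop (𝓝 0) := by
        have := ENNReal.Tendsto.mul_const (ENNReal.tendsto_ofReal hδ)
          (Or.inr hG.memLp_grad.2.ne)
        simpa using this
      simpa using hl.add h2
    refine tendsto_of_tendsto_of_tendsto_of_le_of_le tendsto_const_nhds hb (fun n => zero_le)
      fun n => ?_
    have e1 : gradient (avg η (1 - δ n) (δ n) ((interior P).indicator v)) - G
        =ᵐ[volume.restrict (interior P)] (1 - δ n) • (avg η (1 - δ n) (δ n)
          ((interior P).indicator G) - (interior P).indicator G) - δ n • G := by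
      filter_upwards [hind G, ae_restrict_mem hU] with x hx hxU
      simp only [Pi.sub_apply, Pi.smul_apply, hx, hgr n x hxU]
      module
    have hGi : AEStronglyMeasurable ((interior P).indicator G) (volume.restrict (interior P)) :=
      hG.memLp_grad.1.congr (hind G).symm
    refine (eLpNorm_congr_ae e1).le.trans ((eLpNorm_sub_le (((hm n).sub hGi).const_smul _)
      (hG.memLp_grad.1.const_smul _) (by norm_num)).trans ?_)
    rw [eLpNorm_const_smul, eLpNorm_const_smul, Real.enorm_of_nonneg (h0 n).le,
      Real.enorm_of_nonneg (by linarith [h1 n])]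
    refine add_le_add (mul_le_of_le_one_left zero_le ?_) le_rfl
    exact ENNReal.ofReal_le_one.2 (by linarith [h0 n])
  · intro hc ε hε
    obtain ⟨δ₀, hδ₀, hunif⟩ := hη.tendstoUniformlyOn_avg hP hc hε
    filter_upwards [hδ.eventually (gt_mem_nhds hδ₀)] with n hn x hx
    have h2 : avg η (1 - δ n) (δ n) ((interior P).indicator v) x =
        avg η (1 - δ n) (δ n) v x := hη.avg_congr fun y hy =>
      indicator_of_mem (hP.star_mem_interior hx hy (h0 n) (by linarith [h1 n])) _
    rw [h2]
    exact hunif _ (h0 n) hn.le (by linarith [h1 n]) x hx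
  · intro hz n x hx
    have h2 : (interior P).indicator G =ᵐ[volume] 0 := by
      have h3 := (ae_restrict_iff' hU).1 hz
      filter_upwards [h3] with y hy
      by_cases hyU : y ∈ interior P
      · rw [indicator_of_mem hyU, hy hyU]
      · rw [indicator_of_notMem hyU]
        rfl
    rw [hgr n x hx, avg_congr_ae h2 (h0 n).ne']
    simp [avg]

end SmoothApproximation

end XVEM

/-! ### Cutoff functions, and functions of zero gradient. -/

namespace XVEM

open scoped ENNReal NNReal

section Cutoff

variable {P : Set Plane} {x₀ : Plane} {ρ : ℝ}

/-- The dilation of `P` by the factors `t ≤ 1 - τ` with centre `x₀`. -/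
def core (P : Set Plane) (x₀ : Plane) (τ : ℝ) : Set Plane :=
  (fun z : Plane × ℝ => x₀ + z.2 • (z.1 - x₀)) '' (P ×ˢ Icc 0 (1 - τ))

theorem StarCell.isCompact_core (hP : StarCell P x₀ ρ) (τ : ℝ) : IsCompact (core P x₀ τ) :=
  (hP.isCompact.prod isCompact_Icc).image (by fun_prop)

/-- An interior point can be pushed away from `x₀` by a factor s > 1 without leaving `P`, so it is
the dilate by s⁻¹ of a point of `P`. Hence the cores exhaust the interior as τ tends to zero. -/
theorem exists_forall_mem_core {x : Plane} (hx : x ∈ interior P) :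
    
    ∃ τ₀ > 0, ∀ τ ≤ τ₀, x ∈ core P x₀ τ := by
  have hc : Continuous fun s : ℝ => x₀ + s • (x - x₀) := by fun_prop
  have h1 : ∀ᶠ s in 𝓝 (1 : ℝ), x₀ + s • (x - x₀) ∈ interior P :=
    hc.continuousAt.eventually (by simpa using isOpen_interior.mem_nhds hx)
  have h2 : ∀ᶠ s in 𝓝[>] (1 : ℝ), x₀ + s • (x - x₀) ∈ interior P := h1.filter_mono inf_le_left
  obtain ⟨s, hs, hs1⟩ := (h2.and self_mem_nhdsWithin).exists
  have hs1 : 1 < s := hs1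
  have hs0 : s ≠ 0 := by linarith
  refine ⟨1 - s⁻¹, by linarith [inv_lt_one_of_one_lt₀ hs1], fun τ hτ => ?_⟩
  refine ⟨(x₀ + s • (x - x₀), s⁻¹), ⟨interior_subset hs, by positivity, by simp; linarith⟩, ?_⟩
  simp only
  rw [add_sub_cancel_left, inv_smul_smul₀ hs0, add_sub_cancel]

/-- Smooth cutoff functions on a star-shaped cell. -/
theorem StarCell.exists_cutoff (hP : StarCell P x₀ ρ) : ∃ C : ℝ≥0, ∀ δ : ℝ, 0 < δ → δ ≤ 1 / 4 →
    ∃ χ : Plane → ℝ, IsTestFunction (interior P) χ ∧ (∀ x, 0 ≤ χ x) ∧ (∀ x, χ x ≤ 1) ∧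
      (∀ x ∈ core P x₀ (2 * δ), χ x = 1) ∧ ∀ x, ‖gradient χ x‖ ≤ C / δ := by
  obtain ⟨η, hη⟩ := exists_isKernel x₀ hP.pos
  have hηd : Integrable fun y => ‖fderiv ℝ η y‖ :=
    ((hη.smooth.continuous_fderiv (by simp)).norm).integrable_of_hasCompactSupport
      (hη.compact.fderiv (𝕜 := ℝ)).norm
  set K : ℝ := ∫ y, ‖fderiv ℝ η y‖ with hK
  have hK0 : 0 ≤ K := integral_nonneg fun y => norm_nonneg _
  refine ⟨⟨2 * K, by positivity⟩, fun δ h0 h1 => ?_⟩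
  have hPm : MeasurableSet P := hP.isClosed.measurableSet
  -- The cutoff at x is the η-average of the indicator of `P` at the points (1 + δ)x - δy. The
  -- outward dilation is what makes it vanish before the frontier is reached.
  set F : Plane → ℝ := P.indicator fun _ => 1 with hF
  have hFi : Integrable F := (integrable_indicator_iff hPm).2
    (integrableOn_const hP.isCompact.measure_lt_top.ne)
  have hF0 : ∀ x, 0 ≤ F x := fun x => indicator_nonneg (fun _ _ => zero_le_one) x
  have hF1 : ∀ x, F x ≤ 1 := fun x => indicator_le_self' (fun _ _ => zero_le_one) x
  have hδ : -δ ≠ 0 := by linarith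
  have hint : ∀ x : Plane, Integrable fun y => η y • F ((1 + δ) • x + (-δ) • y) := fun x =>
    hη.integrable_smul hFi hδ _
  have hsm := hη.contDiff_avg hFi (1 + δ) hδ
  set χ := avg η (1 + δ) (-δ) F with hχ
  -- If (1 + δ)x - δy is a point w of `P`, then x = (w + δy)/(1 + δ) is a convex combination with
  -- positive weight on a ball point, hence interior. The set of such x is compact and contains the
  -- support.
  set T : Set Plane := (fun z : Plane × Plane => (1 + δ)⁻¹ • (z.1 + δ • z.2)) '' (P ×ˢ tsupport η)
    with hT
  have hTc : IsCompact T := (hP.isCompact.prod hη.compact).image (by fun_prop)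
  have hTU : T ⊆ interior P := by
    rintro _ ⟨⟨w, y⟩, ⟨hw, hy⟩, rfl⟩
    have := hP.star_mem_interior hw (hη.tsupport_subset hy) (δ := δ / (1 + δ)) (by positivity)
      (by rw [div_le_one (by positivity)]; linarith)
    convert this using 1
    simp only [smul_add, smul_smul]
    congr 2
    · field_simp
      ring
    · field_simp
  have hsupp : tsupport χ ⊆ T := by
    refine closure_minimal (fun x hx => ?_) hTc.isClosed
    by_contra hxT
    refine hx ?_
    refine (integral_congr_ae (ae_of_all _ fun y => ?_)).trans (integral_zero _ _)
    by_cases hy : y ∈ tsupport η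
    · have : (1 + δ) • x + (-δ) • y ∉ P := fun h => hxT ⟨(_, y), ⟨h, hy⟩, by
        simp only
        rw [neg_smul, neg_add_cancel_right, inv_smul_smul₀ (by linarith)]⟩
      simp only [F, indicator_of_notMem this, smul_zero]
    · simp [image_eq_zero_of_notMem_tsupport hy]
  refine ⟨χ, ⟨hsm, hTc.of_isClosed_subset (isClosed_tsupport _) hsupp, hsupp.trans hTU⟩,
    fun x => ?_, fun x => ?_, fun x hx => ?_, fun x => ?_⟩
  · exact integral_nonneg fun y => mul_nonneg (hη.nonneg y) (hF0 _)
  · rw [← hη.integral_eq_one]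
    exact integral_mono (hint x) hη.integrable fun y =>
      mul_le_of_le_one_right (hη.nonneg y) (hF1 _)
  · rw [← hη.integral_eq_one]
    obtain ⟨⟨p, t⟩, ⟨hp, ht0, ht1⟩, rfl⟩ := hx
    simp only at hp ht0 ht1
    refine integral_congr_ae (ae_of_all _ fun y => ?_)
    by_cases hy : y ∈ Metric.ball x₀ ρ
    -- For x = x₀ + t(p - x₀), put β = 1 - (1 + δ)t. The sample point equals (1 - β)p + βq with q =
    -- x₀ + (δ/β)(x₀ - y). Since t ≤ 1 - 2δ gives δ ≤ β, the point q stays in the ball and the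
    -- sample point lies in `P`.
    · have hβ : δ ≤ 1 - (1 + δ) * t := by nlinarith
      have hβ0 : 0 < 1 - (1 + δ) * t := by linarith
      have hq : x₀ + (δ / (1 - (1 + δ) * t)) • (x₀ - y) ∈ Metric.ball x₀ ρ := by
        rw [mem_ball_iff_norm, add_sub_cancel_left, norm_smul,
          Real.norm_of_nonneg (by positivity)]
        rw [Metric.mem_ball, dist_comm, dist_eq_norm] at hy
        refine lt_of_le_of_lt (mul_le_of_le_one_left (norm_nonneg _) ?_) hy
        rwa [div_le_one hβ0]
      have hmem := interior_subset (hP.star_mem_interior hp hq hβ0 (by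
        have : 0 ≤ (1 + δ) * t := by positivity
        linarith))
      have : (1 + δ) • (x₀ + t • (p - x₀)) + (-δ) • y ∈ P := by
        convert hmem using 1
        rw [smul_add (1 - (1 + δ) * t), smul_smul, mul_div_cancel₀ _ hβ0.ne']
        module
      simp only [F, indicator_of_mem this, smul_eq_mul, mul_one]
    · simp [hη.eq_zero hy]
  · rw [norm_gradient]
    change _ ≤ 2 * K / δ
    refine ContinuousLinearMap.opNorm_le_bound _ (by positivity) fun v => ?_
    rw [hη.fderiv_avg hFi _ hδ, norm_mul]
    have e1 : ‖-((1 + δ) / -δ)‖ ≤ 2 / δ := by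
      rw [div_neg, neg_neg, Real.norm_of_nonneg (by positivity)]
      gcongr
      linarith
    have e2 : ‖∫ y, fderiv ℝ η y v * F ((1 + δ) • x + (-δ) • y)‖ ≤ K * ‖v‖ := by
      rw [hK, ← integral_mul_const]
      refine norm_integral_le_of_norm_le (hηd.mul_const _) (ae_of_all _ fun y => ?_)
      rw [norm_mul]
      refine (mul_le_of_le_one_right (norm_nonneg _) ?_).trans ((fderiv ℝ η y).le_opNorm v)
      rw [Real.norm_of_nonneg (hF0 _)]
      exact hF1 _
    calc _ ≤ 2 / δ * (K * ‖v‖) := by gcongr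
      _ = _ := by ring

end Cutoff

/-- The smooth approximants have exactly zero gradient on the connected interior, so they are
constants there; an almost everywhere convergent subsequence has a constant limit. -/
theorem StarCell.ae_eq_const {P : Set Plane} {x₀ : Plane} {ρ : ℝ} (hP : StarCell P x₀ ρ)
    {v : Plane → ℝ} {G : Plane → Plane} (hG : HasWeakGrad (interior P) v G)
    (h : G =ᵐ[volume.restrict (interior P)] 0) :
    ∃ c : ℝ, v =ᵐ[volume.restrict (interior P)] fun _ => c := by
  obtain ⟨φ, hφ, hv, -, -, hz⟩ := hP.exists_smooth_approx hG
  have hconst : ∀ n, ∀ x ∈ interior P, φ n x = φ n x₀ := fun n x hx => by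
    refine isOpen_interior.is_const_of_fderiv_eq_zero (𝕜 := ℝ) hP.isPreconnected_interior
      ((hφ n).differentiable (by simp)).differentiableOn (fun y hy => ?_) hx
      hP.center_mem_interior
    change fderiv ℝ (φ n) y = 0
    rw [← norm_eq_zero, ← norm_gradient, hz h n y hy, norm_zero]
  obtain ⟨ns, hns, hae⟩ := (tendstoInMeasure_of_tendsto_eLpNorm two_ne_zero
    (fun n => (hφ n).continuous.aestronglyMeasurable) hG.memLp.1 hv).exists_seq_tendsto_ae
  have hae' : ∀ᵐ x ∂(volume.restrict (interior P)),
      Tendsto (fun i => φ (ns i) x₀) atTop (𝓝 (v x)) := by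
    filter_upwards [hae, ae_restrict_mem isOpen_interior.measurableSet] with x hx hxU
    exact hx.congr fun i => hconst _ x hxU
  have : (ae (volume.restrict (interior P) : Measure Plane)).NeBot := by
    rw [ae_restrict_neBot]
    exact (isOpen_interior.measure_pos _ ⟨x₀, hP.center_mem_interior⟩).ne'
  obtain ⟨x₁, hx₁⟩ := hae'.exists
  refine ⟨v x₁, ?_⟩
  filter_upwards [hae'] with x hx using tendsto_nhds_unique hx hx₁

end XVEM

/-! ### Polygonal cells and uniqueness of traces. -/

namespace XVEM

open scoped ENNReal NNReal

/-- A star-shaped cell whose boundary is the union of the segments `Es`. -/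
structure PolyCell (P : Set Plane) (x₀ : Plane) (ρ : ℝ) (Es : Finset (Plane × Plane)) : Prop
    extends StarCell P x₀ ρ where
  edge_ne : ∀ e ∈ Es, e.1 ≠ e.2
  edge_subset : ∀ e ∈ Es, seg e ⊆ frontier P
  frontier_eq : frontier P = ⋃ e ∈ Es, seg e

theorem lintegral_biUnion_finset_le {α ι : Type*} [MeasurableSpace α] (μ : Measure α)
    (s : Finset ι) (A : ι → Set α) (f : α → ℝ≥0∞) :
    ∫⁻ x in ⋃ i ∈ s, A i, f x ∂μ ≤ ∑ i ∈ s, ∫⁻ x in A i, f x ∂μ := by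
  refine (lintegral_mono' (Measure.restrict_biUnion_le s.countable_toSet) le_rfl).trans ?_
  rw [lintegral_sum_measure, tsum_fintype]
  exact (Finset.sum_coe_sort s fun i => ∫⁻ x in A i, f x ∂μ).le

theorem tendsto_eLpNorm_of_sub {F : Type*} [NormedAddCommGroup F] {μ : Measure Plane}
    {φ : ℕ → Plane → F} {f : Plane → F} (hφ : ∀ n, AEStronglyMeasurable (φ n) μ)
    (hf : MemLp f 2 μ) (h : Tendsto (fun n => eLpNorm (φ n - f) 2 μ) atTop (𝓝 0)) :
    Tendsto (fun n => eLpNorm (φ n) 2 μ) atTop (𝓝 (eLpNorm f 2 μ)) := by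
  have h1 : Tendsto (fun n => eLpNorm f 2 μ - eLpNorm (φ n - f) 2 μ) atTop
      (𝓝 (eLpNorm f 2 μ)) := by
    simpa using ENNReal.Tendsto.sub tendsto_const_nhds h (Or.inl hf.2.ne)
  have h2 : Tendsto (fun n => eLpNorm f 2 μ + eLpNorm (φ n - f) 2 μ) atTop
      (𝓝 (eLpNorm f 2 μ)) := by
    simpa using h.const_add (eLpNorm f 2 μ)
  refine tendsto_of_tendsto_of_tendsto_of_le_of_le h1 h2 (fun n => ?_) fun n => ?_
  · rw [tsub_le_iff_right]
    have h3 := eLpNorm_sub_le (hφ n) ((hφ n).sub hf.1) (p := 2) (by norm_num)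
    rwa [sub_sub_cancel] at h3
  · have h3 := eLpNorm_add_le hf.1 ((hφ n).sub hf.1) (p := 2) (by norm_num)
    rwa [add_sub_cancel] at h3

theorem gradient_sub_smooth {φ ψ : Plane → ℝ} (h : ContDiff ℝ ∞ φ) (h' : ContDiff ℝ ∞ ψ) :
    gradient (φ - ψ) = gradient φ - gradient ψ := by
  funext x
  simp [gradient, fderiv_sub (h.differentiable (by simp) x) (h'.differentiable (by simp) x)]

variable {P : Set Plane} {x₀ : Plane} {ρ : ℝ} {Es : Finset (Plane × Plane)}

/-- The ray from `x₀` through x starts in the interior at x and leaves the bounded set `P`, so by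
connectedness it meets the frontier at some factor s, and s > 1. If 1/s were at most 1 - τ, then x
would belong to the core. -/
theorem StarCell.exists_frontier_of_notMem_core (hP : StarCell P x₀ ρ) {x : Plane}
    (hx : x ∈ interior P) {τ : ℝ} (hτ : τ ≤ 1) (hxc : x ∉ core P x₀ τ) :
    ∃ p ∈ frontier P, ∃ t ∈ Ioo (1 - τ) 1, x = x₀ + t • (p - x₀) := by
  have hne : x ≠ x₀ := fun h => hxc ⟨(x₀, 0), ⟨interior_subset hP.center_mem_interior, le_rfl,
    by simpa using hτ⟩, by simp [h]⟩
  have hpos : 0 < ‖x - x₀‖ := norm_pos_iff.2 (sub_ne_zero.2 hne)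
  set γ : ℝ → Plane := fun s => x₀ + s • (x - x₀) with hγ
  have hγc : Continuous γ := by fun_prop
  obtain ⟨R, hR⟩ := hP.isCompact.isBounded.subset_closedBall x₀
  have hpre : IsPreconnected (γ '' Ici 1) := isPreconnected_Ici.image γ hγc.continuousOn
  obtain ⟨p, ⟨s, hs, rfl⟩, hp⟩ : ∃ p ∈ γ '' Ici 1, p ∈ frontier P := by
    by_contra! hno
    have hcov : γ '' Ici 1 ⊆ interior P ∪ Pᶜ := fun p hp => by
      by_contra h
      rw [mem_union, not_or, mem_compl_iff, not_not] at h
      exact hno p hp ⟨subset_closure h.2, h.1⟩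
    obtain ⟨q, -, hq1, hq2⟩ := hpre _ _ isOpen_interior hP.isClosed.isOpen_compl hcov
      ⟨x, ⟨1, by simp, by simp [hγ]⟩, hx⟩
      ⟨γ (max 1 ((R + 1) / ‖x - x₀‖)), ⟨_, mem_Ici.2 (le_max_left _ _), rfl⟩, fun hmem => by
        have h1 := hR hmem
        rw [mem_closedBall_iff_norm, hγ] at h1
        simp only [add_sub_cancel_left, norm_smul, Real.norm_eq_abs] at h1
        have h2 : (R + 1) / ‖x - x₀‖ ≤ |max 1 ((R + 1) / ‖x - x₀‖)| :=
          (le_max_right _ _).trans (le_abs_self _)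
        rw [div_le_iff₀ hpos] at h2
        linarith⟩
    exact hq2 (interior_subset hq1)
  have hs1 : s ≠ 1 := by
    rintro rfl
    exact hp.2 (by simpa [hγ] using hx)
  have hs2 : 1 < s := lt_of_le_of_ne hs hs1.symm
  have hs0 : s ≠ 0 := by linarith
  have hxe : x = x₀ + s⁻¹ • (γ s - x₀) := by
    simp only [hγ]
    rw [add_sub_cancel_left, inv_smul_smul₀ hs0, add_sub_cancel]
  refine ⟨γ s, hp, s⁻¹, ⟨?_, inv_lt_one_of_one_lt₀ hs2⟩, hxe⟩
  by_contra! h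
  exact hxc ⟨(γ s, s⁻¹), ⟨hP.isClosed.frontier_subset hp, by positivity, h⟩, hxe.symm⟩

namespace PolyCell

theorem bdryMeasure_eq (hP : PolyCell P x₀ ρ Es) :
    bdryMeasure (interior P) = μH[1].restrict (⋃ e ∈ Es, seg e) := by
  rw [bdryMeasure, hP.frontier_interior, hP.frontier_eq]

theorem restrict_seg_le (hP : PolyCell P x₀ ρ Es) {e : Plane × Plane} (he : e ∈ Es) :
    μH[1].restrict (seg e) ≤ bdryMeasure (interior P) := by
  rw [hP.bdryMeasure_eq]
  exact Measure.restrict_mono (subset_biUnion_of_mem (u := fun e => seg e) he) le_rfl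

theorem ae_bdry_iff (hP : PolyCell P x₀ ρ Es) {p : Plane → Prop} :
    (∀ᵐ x ∂bdryMeasure (interior P), p x) ↔ ∀ e ∈ Es, ∀ᵐ x ∂μH[1].restrict (seg e), p x := by
  rw [hP.bdryMeasure_eq, ae_restrict_biUnion_finset_iff]

theorem isFiniteMeasure_bdry (hP : PolyCell P x₀ ρ Es) :
    IsFiniteMeasure (bdryMeasure (interior P)) := by
  refine ⟨?_⟩
  rw [hP.bdryMeasure_eq, Measure.restrict_apply_univ]
  refine (measure_biUnion_finset_le _ _).trans_lt (ENNReal.sum_lt_top.2 fun e _ => ?_)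
  rw [hausdorffMeasure_segment]
  exact edist_lt_top _ _

theorem diff_core_subset (hP : PolyCell P x₀ ρ Es) {τ : ℝ} (hτ : τ ≤ 1) :
    interior P \ core P x₀ τ ⊆ ⋃ e ∈ Es, sector x₀ e τ := by
  rintro x ⟨hx, hxc⟩
  obtain ⟨p, hp, t, ht, rfl⟩ := hP.exists_frontier_of_notMem_core hx hτ hxc
  rw [hP.frontier_eq] at hp
  obtain ⟨e, he, hpe⟩ := mem_iUnion₂.1 hp
  rw [seg, segment_eq_image_lineMap] at hpe
  obtain ⟨s, hs, rfl⟩ := hpe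
  exact mem_iUnion₂.2 ⟨e, he, (s, t), ⟨hs, ht⟩, rfl⟩

/-- The square of the `L²` norm near the boundary, in terms of the boundary values and of the
gradient. -/
theorem exists_strip_bound (hP : PolyCell P x₀ ρ Es) : ∃ C : ℝ≥0, ∀ φ : Plane → ℝ,
    ContDiff ℝ ∞ φ → ∀ τ : ℝ, 0 < τ → τ ≤ 1 / 2 →
      eLpNorm φ 2 (volume.restrict (interior P \ core P x₀ τ)) ^ 2 ≤
        C * (eLpNorm φ 2 (bdryMeasure (interior P)) ^ 2 +
          ENNReal.ofReal τ ^ 2 * eLpNorm (gradient φ) 2 (volume.restrict (interior P)) ^ 2) := by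
  have h : ∀ e ∈ Es, ∃ C : ℝ≥0, ∀ φ : Plane → ℝ, ContDiff ℝ ∞ φ →
      ∀ τ : ℝ, 0 < τ → τ ≤ 1 / 2 → ∫⁻ x in sector x₀ e τ, ‖φ x‖ₑ ^ 2 ≤
        C * ((∫⁻ x in seg e, ‖φ x‖ₑ ^ 2 ∂μH[1]) +
          ENNReal.ofReal τ ^ 2 * ∫⁻ x in interior P, ‖gradient φ x‖ₑ ^ 2) := fun e he =>
    hP.toStarCell.exists_sector_bound (hP.edge_ne e he) (hP.edge_subset e he)
  choose! C hC using h
  refine ⟨∑ e ∈ Es, C e, fun φ hφ τ h0 h1 => ?_⟩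
  rw [eLpNorm_two_sq, eLpNorm_two_sq, eLpNorm_two_sq]
  calc _ ≤ ∫⁻ x in ⋃ e ∈ Es, sector x₀ e τ, ‖φ x‖ₑ ^ 2 :=
        lintegral_mono_set (hP.diff_core_subset (by linarith))
    _ ≤ ∑ e ∈ Es, ∫⁻ x in sector x₀ e τ, ‖φ x‖ₑ ^ 2 := lintegral_biUnion_finset_le _ _ _ _
    _ ≤ ∑ e ∈ Es, C e * ((∫⁻ x, ‖φ x‖ₑ ^ 2 ∂bdryMeasure (interior P)) +
          ENNReal.ofReal τ ^ 2 * ∫⁻ x in interior P, ‖gradient φ x‖ₑ ^ 2) := by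
        refine Finset.sum_le_sum fun e he => (hC e he φ hφ τ h0 h1).trans ?_
        gcongr
        exact hP.restrict_seg_le he
    _ = _ := by
        rw [← Finset.sum_mul]
        push_cast
        rfl

/-- The trace inequality in sequential form: convergence to zero in `H¹` forces convergence to zero
on each edge. -/
theorem tendsto_eLpNorm_seg (hP : PolyCell P x₀ ρ Es) {e : Plane × Plane} (he : e ∈ Es)
    {χ : ℕ → Plane → ℝ} (hχ : ∀ n, ContDiff ℝ ∞ (χ n))
    (h1 : Tendsto (fun n => eLpNorm (χ n) 2 (volume.restrict (interior P))) atTop (𝓝 0))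
    (h2 : Tendsto (fun n => eLpNorm (gradient (χ n)) 2 (volume.restrict (interior P)))
      atTop (𝓝 0)) :
    Tendsto (fun n => eLpNorm (χ n) 2 (μH[1].restrict (seg e))) atTop (𝓝 0) := by
  obtain ⟨C, hC⟩ := hP.toStarCell.exists_trace_bound (hP.edge_ne e he) (hP.edge_subset e he)
  have h3 : Tendsto (fun n => (C : ℝ≥0∞) * (eLpNorm (χ n) 2 (volume.restrict (interior P)) ^ 2 +
      eLpNorm (gradient (χ n)) 2 (volume.restrict (interior P)) ^ 2)) atTop (𝓝 0) := by
    have := ENNReal.Tendsto.const_mul (a := (C : ℝ≥0∞))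
      ((ENNReal.Tendsto.pow (n := 2) h1).add (ENNReal.Tendsto.pow (n := 2) h2)) (Or.inr (by simp))
    simpa using this
  have h4 : Tendsto (fun n => eLpNorm (χ n) 2 (μH[1].restrict (seg e)) ^ 2) atTop (𝓝 0) := by
    refine tendsto_of_tendsto_of_tendsto_of_le_of_le tendsto_const_nhds h3 (fun n => zero_le)
      fun n => ?_
    simp only [eLpNorm_two_sq]
    exact hC _ (hχ n)
  have h5 := h4.ennrpow_const (1 / 2 : ℝ)
  rw [ENNReal.zero_rpow_of_pos (by norm_num)] at h5
  refine h5.congr fun n => ?_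
  rw [← ENNReal.rpow_natCast, ← ENNReal.rpow_mul]
  norm_num

/-- Traces are unique. -/
theorem hasTrace_unique (hP : PolyCell P x₀ ρ Es) {v g g' : Plane → ℝ}
    (h : HasTrace (interior P) v g) (h' : HasTrace (interior P) v g') :
    g =ᵐ[bdryMeasure (interior P)] g' := by
  obtain ⟨G, hG, hg, φ, hφ, a1, a2, a3⟩ := h
  obtain ⟨G', hG', hg', ψ, hψ, b1, b2, b3⟩ := h'
  have hm : ∀ {F : Type} [NormedAddCommGroup F] {f : ℕ → Plane → F} {v : Plane → F}
      {μ : Measure Plane}, Tendsto (fun n => eLpNorm (f n - v) 2 μ) atTop (𝓝 0) →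
      Tendsto (fun n => eLpNorm (v - f n) 2 μ) atTop (𝓝 0) := fun h =>
    h.congr fun n => eLpNorm_sub_comm _ _ _ _
  have hGG : G =ᵐ[volume.restrict (interior P)] G' := hG.unique isOpen_interior hG'
  -- The two approximating sequences have the same limit in `H¹`, so their difference tends to zero
  -- there and therefore on each edge.
  have c1 : Tendsto (fun n => eLpNorm (φ n - ψ n) 2 (volume.restrict (interior P)))
      atTop (𝓝 0) := by
    refine tendsto_of_tendsto_of_tendsto_of_le_of_le tendsto_const_nhds
      (by simpa using a1.add (hm b1)) (fun n => zero_le) fun n => ?_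
    rw [← sub_add_sub_cancel (φ n) v (ψ n)]
    exact eLpNorm_add_le ((hφ n).continuous.aestronglyMeasurable.sub hG.memLp.1)
      (hG.memLp.1.sub (hψ n).continuous.aestronglyMeasurable) (by norm_num)
  have c2 : Tendsto (fun n => eLpNorm (gradient (φ n - ψ n)) 2 (volume.restrict (interior P)))
      atTop (𝓝 0) := by
    refine tendsto_of_tendsto_of_tendsto_of_le_of_le tendsto_const_nhds
      (by simpa using a2.add (hm b2)) (fun n => zero_le) fun n => ?_
    have hgr := gradient_sub_smooth (hφ n) (hψ n)
    have : gradient (φ n - ψ n) =ᵐ[volume.restrict (interior P)]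
        (gradient (φ n) - G) + (G' - gradient (ψ n)) := by
      filter_upwards [hGG] with x hx
      simp [hgr, hx]
    rw [eLpNorm_congr_ae this]
    exact eLpNorm_add_le ((contDiff_gradient_continuous (hφ n)).aestronglyMeasurable.sub
      hG.memLp_grad.1) (hG'.memLp_grad.1.sub
      (contDiff_gradient_continuous (hψ n)).aestronglyMeasurable) (by norm_num)
  refine hP.ae_bdry_iff.2 fun e he => ?_
  have hle := hP.restrict_seg_le he
  have c3 : Tendsto (fun n => eLpNorm (φ n - ψ n) 2 (μH[1].restrict (seg e))) atTop (𝓝 0) :=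
    hP.tendsto_eLpNorm_seg he (fun n => (hφ n).sub (hψ n)) c1 c2
  have mono : ∀ {f : ℕ → Plane → ℝ},
      Tendsto (fun n => eLpNorm (f n) 2 (bdryMeasure (interior P))) atTop (𝓝 0) →
      Tendsto (fun n => eLpNorm (f n) 2 (μH[1].restrict (seg e))) atTop (𝓝 0) := fun h =>
    tendsto_of_tendsto_of_tendsto_of_le_of_le tendsto_const_nhds h (fun n => zero_le) fun n =>
      eLpNorm_mono_measure _ hle
  have hgm := hg.1.mono_measure hle
  have hgm' := hg'.1.mono_measure hle
  have hz : eLpNorm (g - g') 2 (μH[1].restrict (seg e)) = 0 := by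
    refine le_antisymm (ge_of_tendsto' (x := atTop) (f := fun n : ℕ =>
      eLpNorm (g - φ n) 2 (μH[1].restrict (seg e)) +
      eLpNorm (φ n - ψ n) 2 (μH[1].restrict (seg e)) +
      eLpNorm (ψ n - g') 2 (μH[1].restrict (seg e))) ?_ fun n => ?_) zero_le
    · simpa using ((mono (hm a3)).add c3).add (mono b3)
    · have e1 : g - g' = (g - φ n) + (φ n - ψ n) + (ψ n - g') := by abel
      rw [e1]
      have m1 := (hφ n).continuous.aestronglyMeasurable (μ := μH[1].restrict (seg e))
      have m2 := (hψ n).continuous.aestronglyMeasurable (μ := μH[1].restrict (seg e))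
      refine (eLpNorm_add_le ((hgm.sub m1).add (m1.sub m2)) (m2.sub hgm') (by norm_num)).trans ?_
      gcongr
      exact eLpNorm_add_le (hgm.sub m1) (m1.sub m2) (by norm_num)
  rw [eLpNorm_eq_zero_iff (hgm.sub hgm') (by norm_num)] at hz
  filter_upwards [hz] with x hx using sub_eq_zero.1 hx

end PolyCell

end XVEM

/-! ### Green's formula for functions of zero trace. -/

namespace XVEM

open scoped ENNReal NNReal

variable {P : Set Plane} {x₀ : Plane} {ρ : ℝ} {Es : Finset (Plane × Plane)}

theorem memLp_bdd_smul {F : Type*} [NormedAddCommGroup F] [NormedSpace ℝ F]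
    {μ : Measure Plane} {χ : Plane → ℝ} (hχ : Continuous χ) {C : ℝ} (hC : ∀ x, ‖χ x‖ ≤ C)
    {f : Plane → F} (hf : MemLp f 2 μ) : MemLp (fun x => χ x • f x) 2 μ := by
  refine (hf.const_smul C).mono (hχ.aestronglyMeasurable.smul hf.1) (ae_of_all _ fun x => ?_)
  simp only [norm_smul, Pi.smul_apply]
  gcongr
  exact (hC x).trans (le_abs_self C)

/-- The bound near the boundary for a function of zero trace. -/
theorem PolyCell.exists_strip_bound_of_hasTrace (hP : PolyCell P x₀ ρ Es) : ∃ C : ℝ≥0,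
    ∀ (u : Plane → ℝ) (H : Plane → Plane), HasWeakGrad (interior P) u H →
      HasTrace (interior P) u 0 → ∀ τ : ℝ, 0 < τ → τ ≤ 1 / 2 →
        eLpNorm u 2 (volume.restrict (interior P \ core P x₀ τ)) ≤
          C * (ENNReal.ofReal τ * eLpNorm H 2 (volume.restrict (interior P))) := by
  obtain ⟨C, hC⟩ := hP.exists_strip_bound
  -- The strip bound is for squares, and C ≤ (C + 1)² avoids a square root.
  refine ⟨C + 1, fun u H hH hu τ h0 h1 => ?_⟩
  obtain ⟨G, hG, -, φ, hφ, a1, a2, a3⟩ := hu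
  have hle : (volume.restrict (interior P \ core P x₀ τ) : Measure Plane) ≤
      volume.restrict (interior P) := Measure.restrict_mono sdiff_subset le_rfl
  have hGH : G =ᵐ[volume.restrict (interior P)] H := hG.unique isOpen_interior hH
  have a1' : Tendsto (fun n => eLpNorm (φ n - u) 2
      (volume.restrict (interior P \ core P x₀ τ))) atTop (𝓝 0) :=
    tendsto_of_tendsto_of_tendsto_of_le_of_le tendsto_const_nhds a1 (fun n => zero_le) fun n =>
      eLpNorm_mono_measure _ hle
  have l1 := ENNReal.Tendsto.pow (n := 2) (tendsto_eLpNorm_of_sub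
    (fun n => (hφ n).continuous.aestronglyMeasurable) (hH.memLp.mono_measure hle) a1')
  have l2 := ENNReal.Tendsto.pow (n := 2) (tendsto_eLpNorm_of_sub (fun n =>
    (contDiff_gradient_continuous (hφ n)).aestronglyMeasurable) hG.memLp_grad a2)
  have l3 : Tendsto (fun n => eLpNorm (φ n) 2 (bdryMeasure (interior P)) ^ 2) atTop (𝓝 0) := by
    have := ENNReal.Tendsto.pow (n := 2) a3
    simpa using this
  have l4 : Tendsto (fun n => (C : ℝ≥0∞) * (eLpNorm (φ n) 2 (bdryMeasure (interior P)) ^ 2 +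
      ENNReal.ofReal τ ^ 2 * eLpNorm (gradient (φ n)) 2 (volume.restrict (interior P)) ^ 2))
      atTop (𝓝 (C * (0 + ENNReal.ofReal τ ^ 2 *
        eLpNorm G 2 (volume.restrict (interior P)) ^ 2))) :=
    ENNReal.Tendsto.const_mul (l3.add (ENNReal.Tendsto.const_mul l2
      (Or.inr (by simp)))) (Or.inr (by simp))
  have l5 := le_of_tendsto_of_tendsto' l1 l4 fun n => hC _ (hφ n) τ h0 h1
  rw [zero_add, eLpNorm_congr_ae hGH, ← mul_pow] at l5
  rw [← ENNReal.pow_le_pow_left_iff two_ne_zero, mul_pow]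
  refine l5.trans (mul_le_mul_left ?_ _)
  norm_cast
  nlinarith [zero_le (a := C)]

/-- Dominated convergence: every interior point belongs to all cores with τ small, so the indicators
of the strips tend to zero pointwise. -/
theorem StarCell.tendsto_eLpNorm_strip (hP : StarCell P x₀ ρ) {G : Plane → Plane}
    (hG : MemLp G 2 (volume.restrict (interior P))) {τ : ℕ → ℝ} (hτ : Tendsto τ atTop (𝓝 0)) :
    Tendsto (fun n => eLpNorm G 2 (volume.restrict (interior P \ core P x₀ (τ n)))) atTop
      (𝓝 0) := by
  have hm : ∀ n, MeasurableSet (core P x₀ (τ n))ᶜ := fun n =>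
    (hP.isCompact_core _).isClosed.isOpen_compl.measurableSet
  have h1 : Tendsto (fun n => ∫⁻ x in interior P, (core P x₀ (τ n))ᶜ.indicator
      (fun x => ‖G x‖ₑ ^ 2) x) atTop (𝓝 (∫⁻ _ in interior P, 0)) := by
    refine tendsto_lintegral_of_dominated_convergence' (fun x => ‖G x‖ₑ ^ 2)
      (fun n => (hG.1.enorm.pow_const 2).indicator (hm n))
      (fun n => ae_of_all _ fun x => indicator_le_self _ _ x) ?_ ?_
    · rw [← eLpNorm_two_sq]
      exact ENNReal.pow_ne_top hG.2.ne
    · filter_upwards [ae_restrict_mem isOpen_interior.measurableSet] with x hx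
      obtain ⟨τ₀, h0, h⟩ := exists_forall_mem_core hx
      refine tendsto_const_nhds.congr' ?_
      filter_upwards [hτ.eventually (gt_mem_nhds h0)] with n hn
      rw [indicator_of_notMem]
      exact fun h' => h' (h _ hn.le)
  have h2 : Tendsto (fun n => eLpNorm G 2 (volume.restrict (interior P \ core P x₀ (τ n))) ^ 2)
      atTop (𝓝 0) := by
    rw [lintegral_zero] at h1
    refine h1.congr fun n => ?_
    rw [eLpNorm_two_sq, lintegral_indicator (hm n), Measure.restrict_restrict (hm n), sdiff_eq,
      inter_comm]
  have h5 := h2.ennrpow_const (1 / 2 : ℝ)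
  rw [ENNReal.zero_rpow_of_pos (by norm_num)] at h5
  refine h5.congr fun n => ?_
  rw [← ENNReal.rpow_natCast, ← ENNReal.rpow_mul]
  norm_num

/-- Green's formula for a function of zero trace. -/
theorem PolyCell.green (hP : PolyCell P x₀ ρ Es) {u r : Plane → ℝ} {H G : Plane → Plane}
    (hH : HasWeakGrad (interior P) u H) (hu : HasTrace (interior P) u 0)
    (hG : MemLp G 2 (volume.restrict (interior P)))
    (hr : MemLp r 2 (volume.restrict (interior P)))
    (hdiv : ∀ φ, IsTestFunction (interior P) φ →
      ∫ x in interior P, inner ℝ (G x) (gradient φ x) = - ∫ x in interior P, r x * φ x) :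
    ∫ x in interior P, inner ℝ (G x) (H x) = - ∫ x in interior P, r x * u x := by
  obtain ⟨C₁, hC₁⟩ := hP.exists_strip_bound_of_hasTrace
  obtain ⟨C₂, hC₂⟩ := hP.toStarCell.exists_cutoff
  have hstrip := fun τ h0 h1 => hC₁ u H hH hu τ h0 h1
  obtain ⟨G₀, hG₀, -, φ, hφ, a1, a2, -⟩ := hu
  have hGH : H =ᵐ[volume.restrict (interior P)] G₀ := hH.unique isOpen_interior hG₀
  have hU : MeasurableSet (interior P) := isOpen_interior.measurableSet
  -- the identity tested with `χ u`
  have step : ∀ χ : Plane → ℝ, IsTestFunction (interior P) χ →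
      (∫ x in interior P, χ x * inner ℝ (G x) (H x)) +
        (∫ x in interior P, inner ℝ (G x) (u x • gradient χ x)) =
      - ∫ x in interior P, χ x * (r x * u x) := by
    intro χ hχ
    obtain ⟨C, hC⟩ := hχ.compact.exists_bound_of_continuous hχ.smooth.continuous
    have hχg := contDiff_gradient_continuous hχ.smooth
    obtain ⟨C', hC'⟩ := (hχ.compact.fderiv (𝕜 := ℝ)).exists_bound_of_continuous
      (hχ.smooth.continuous_fderiv (by simp))
    have hχG : MemLp (fun x => χ x • G x) 2 (volume.restrict (interior P)) :=
      memLp_bdd_smul hχ.smooth.continuous hC hG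
    have hχr : MemLp (fun x => χ x • r x) 2 (volume.restrict (interior P)) :=
      memLp_bdd_smul hχ.smooth.continuous hC hr
    have hGχ : MemLp (fun x => (inner ℝ (G x) (gradient χ x) : ℝ)) 2
        (volume.restrict (interior P)) := by
      refine (hG.const_smul C').norm.mono (hG.1.inner hχg.aestronglyMeasurable)
        (ae_of_all _ fun x => ?_)
      rw [norm_norm, Pi.smul_apply, norm_smul, mul_comm]
      refine (norm_inner_le_norm _ _).trans ?_
      gcongr
      rw [norm_gradient]
      exact (hC' x).trans (le_abs_self _)
    have hφm : ∀ n, MemLp (φ n) 2 (volume.restrict (interior P)) := fun n =>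
      hP.memLp_of_continuous (hφ n).continuous.continuousOn
    have hφg : ∀ n, MemLp (gradient (φ n)) 2 (volume.restrict (interior P)) := fun n =>
      hP.memLp_of_continuous (contDiff_gradient_continuous (hφ n)).continuousOn
    have t1 := tendsto_integral_inner hφg hG₀.memLp_grad hχG a2
    have t2 := tendsto_integral_inner hφm hH.memLp hGχ a1
    have t3 := tendsto_integral_inner hφm hH.memLp hχr a1
    have heq : ∀ n, (∫ x in interior P, inner ℝ (gradient (φ n) x) (χ x • G x)) +
        (∫ x in interior P, inner ℝ (φ n x) (inner ℝ (G x) (gradient χ x))) =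
        - ∫ x in interior P, inner ℝ (φ n x) (χ x • r x) := by
      intro n
      -- The product of an approximant of u with χ is an admissible test function, whereas χu need
      -- not be smooth; the identity for χu follows in the limit.
      have htest : IsTestFunction (interior P) (fun x => φ n x * χ x) :=
        ⟨(hφ n).mul hχ.smooth, hχ.compact.mul_left,
          (closure_mono (Function.support_mul_subset_right _ _)).trans hχ.support_subset⟩
      have h1 := hdiv _ htest
      have e1 : ∫ x in interior P, inner ℝ (G x) (gradient (fun x => φ n x * χ x) x) =
          (∫ x in interior P, inner ℝ (gradient (φ n) x) (χ x • G x)) +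
          ∫ x in interior P, inner ℝ (φ n x) (inner ℝ (G x) (gradient χ x)) := by
        rw [← integral_add (memLp_integrable_inner (hφg n) hχG)
          (memLp_integrable_inner (hφm n) hGχ)]
        refine integral_congr_ae (ae_of_all _ fun x => ?_)
        simp only
        rw [gradient_mul ((hφ n).differentiable (by simp) x)
          (hχ.smooth.differentiable (by simp) x), inner_add_right, real_inner_smul_right,
          real_inner_smul_right, real_inner_smul_right, real_inner_comm (gradient (φ n) x)]
        simp only [RCLike.inner_apply, conj_trivial]
        ring
      rw [e1] at h1
      rw [h1]
      congr 1
      refine integral_congr_ae (ae_of_all _ fun x => ?_)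
      simp only [RCLike.inner_apply, conj_trivial, smul_eq_mul]
      ring
    have := tendsto_nhds_unique (t1.add t2) (t3.neg.congr fun n => (heq n).symm)
    convert this using 2
    · refine integral_congr_ae ?_
      filter_upwards [hGH] with x hx
      rw [hx, real_inner_smul_right, real_inner_comm]
    · refine integral_congr_ae (ae_of_all _ fun x => ?_)
      simp only [RCLike.inner_apply, conj_trivial, real_inner_smul_right]
      ring
    · refine integral_congr_ae (ae_of_all _ fun x => ?_)
      simp only [RCLike.inner_apply, conj_trivial, smul_eq_mul]
      ring
  -- a sequence of cutoff functions
  set δ : ℕ → ℝ := fun n => 1 / ((n : ℝ) + 4) with hδd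
  have h0 : ∀ n, 0 < δ n := fun n => by positivity
  -- Required by the construction of the cutoff; it also makes the strip width 2δ at most 1/2, as
  -- the strip bound demands.
  have h1 : ∀ n, δ n ≤ 1 / 4 := fun n => by
    refine one_div_le_one_div_of_le (by norm_num) ?_
    have : (0 : ℝ) ≤ n := n.cast_nonneg
    linarith
  have hδ : Tendsto δ atTop (𝓝 0) := by
    have := (tendsto_const_div_atTop_nhds_zero_nat (1 : ℝ)).comp (tendsto_add_atTop_nat 4)
    refine this.congr fun n => ?_
    simp [hδd]
  have hδ2 : Tendsto (fun n => 2 * δ n) atTop (𝓝 0) := by simpa using hδ.const_mul 2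
  choose χ hχt hχ0 hχ1 hχc hχg using fun n => hC₂ (δ n) (h0 n) (h1 n)
  have hdct : ∀ f : Plane → ℝ, Integrable f (volume.restrict (interior P)) →
      Tendsto (fun n => ∫ x in interior P, χ n x * f x) atTop (𝓝 (∫ x in interior P, f x)) := by
    intro f hf
    refine tendsto_integral_of_dominated_convergence (fun x => ‖f x‖)
      (fun n => (hχt n).smooth.continuous.aestronglyMeasurable.mul hf.1) hf.norm
      (fun n => ae_of_all _ fun x => ?_) ?_
    · rw [norm_mul, Real.norm_of_nonneg (hχ0 n x)]
      exact mul_le_of_le_one_left (norm_nonneg _) (hχ1 n x)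
    · filter_upwards [ae_restrict_mem hU] with x hx
      obtain ⟨τ₀, hτ₀, h⟩ := exists_forall_mem_core hx
      refine tendsto_const_nhds.congr' ?_
      filter_upwards [hδ2.eventually (gt_mem_nhds hτ₀)] with n hn
      rw [hχc n x (h _ hn.le), one_mul]
  have l1 := hdct _ (memLp_integrable_inner hG hH.memLp_grad)
  have l3 := (hdct _ (integrable_mul' hr hH.memLp)).neg
  -- The commutator term lives on the strip, where the gradient of χ is O(1/δ) and the norm of u is
  -- O(δ). Their product stays below K, while the norm of G on the strip tends to zero.
  have l2 : Tendsto (fun n => ∫ x in interior P, inner ℝ (G x) (u x • gradient (χ n) x))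
      atTop (𝓝 0) := by
    set K : ℝ≥0∞ := C₂ * (C₁ * (2 * eLpNorm H 2 (volume.restrict (interior P)))) with hK
    have hKfin : K ≠ ⊤ := ENNReal.mul_ne_top (by simp) (ENNReal.mul_ne_top (by simp)
      (ENNReal.mul_ne_top (by simp) hH.memLp_grad.2.ne))
    have hb : Tendsto (fun n => (eLpNorm G 2 (volume.restrict
        (interior P \ core P x₀ (2 * δ n)))).toReal * K.toReal) atTop (𝓝 0) := by
      have := ((ENNReal.tendsto_toReal ENNReal.zero_ne_top).comp
        (hP.tendsto_eLpNorm_strip hG hδ2)).mul_const K.toReal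
      simpa using this
    refine squeeze_zero_norm (fun n => ?_) hb
    set S := interior P \ core P x₀ (2 * δ n) with hS
    have hle : (volume.restrict S : Measure Plane) ≤ volume.restrict (interior P) :=
      Measure.restrict_mono sdiff_subset le_rfl
    have hz : ∀ x ∈ interior P \ S, inner ℝ (G x) (u x • gradient (χ n) x) = 0 := by
      rintro x ⟨hx, hxS⟩
      have hxc : x ∈ core P x₀ (2 * δ n) := by
        by_contra h
        exact hxS ⟨hx, h⟩
      -- The core is closed, so χ = 1 on it does not give local constancy at its frontier; but χ
      -- attains its maximum there, which suffices for a zero gradient.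
      have hmax : IsLocalMax (χ n) x := Eventually.of_forall fun y => by
        rw [hχc n x hxc]
        exact hχ1 n y
      rw [show gradient (χ n) x = 0 by simp [gradient, hmax.fderiv_eq_zero], smul_zero,
        inner_zero_right]
    rw [setIntegral_eq_of_subset_of_forall_sdiff_eq_zero hU sdiff_subset hz]
    have hbound : eLpNorm (fun x => u x • gradient (χ n) x) 2 (volume.restrict S) ≤ K := by
      have e1 : eLpNorm (fun x => u x • gradient (χ n) x) 2 (volume.restrict S) ≤
          Real.toNNReal (C₂ / δ n) • eLpNorm u 2 (volume.restrict S) := by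
        refine eLpNorm_le_nnreal_smul_eLpNorm_of_ae_le_mul (ae_of_all _ fun x => ?_) 2
        rw [← NNReal.coe_le_coe]
        push_cast
        rw [norm_smul, mul_comm]
        gcongr
        exact (hχg n x).trans (Real.le_coe_toNNReal _)
      refine e1.trans ?_
      rw [ENNReal.smul_def, smul_eq_mul]
      refine (mul_le_mul_right (hstrip (2 * δ n) (by linarith [h0 n]) (by linarith [h1 n])) _).trans
        (le_of_eq ?_)
      have e2 : ((C₂ / δ n).toNNReal : ℝ≥0∞) * ENNReal.ofReal (2 * δ n) = C₂ * 2 := by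
        change ENNReal.ofReal _ * _ = _
        rw [← ENNReal.ofReal_mul (by have := h0 n; positivity)]
        have : (C₂ : ℝ) / δ n * (2 * δ n) = C₂ * 2 := by
          have := (h0 n).ne'
          field_simp
        rw [this, ENNReal.ofReal_mul (by positivity)]
        simp
      calc _ = (((C₂ / δ n).toNNReal : ℝ≥0∞) * ENNReal.ofReal (2 * δ n)) *
            (C₁ * eLpNorm H 2 (volume.restrict (interior P))) := by ring
        _ = _ := by rw [e2, hK]; ring
    have hmem : MemLp (fun x => u x • gradient (χ n) x) 2 (volume.restrict S) :=
      ⟨(hH.memLp.1.mono_measure hle).smul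
        (contDiff_gradient_continuous (hχt n).smooth).aestronglyMeasurable,
        hbound.trans_lt hKfin.lt_top⟩
    refine (abs_integral_inner_le (hG.mono_measure hle) hmem).trans ?_
    gcongr
  have := tendsto_nhds_unique (l1.add l2) (l3.congr fun n => (step _ (hχt n)).symm)
  rwa [add_zero] at this

end XVEM

/-! ### Polynomials, and traces of continuous functions. -/

namespace XVEM

open scoped ENNReal NNReal

section Polynomials

open MvPolynomial

theorem totalDegree_pderiv_le (i : Fin 2) (p : MvPolynomial (Fin 2) ℝ) :
    (pderiv i p).totalDegree ≤ p.totalDegree - 1 := by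
  conv_lhs => rw [p.as_sum, map_sum]
  refine totalDegree_finsetSum_le fun s hs => ?_
  rw [pderiv_monomial]
  by_cases h : s i = 0
  · simp [h]
  · refine (totalDegree_monomial_le _ _).trans ?_
    have h1 := le_totalDegree hs
    have h2 : ∀ t : Fin 2 →₀ ℕ, (t.sum fun _ e => e) = t 0 + t 1 := fun t => by
      rw [Finsupp.sum_fintype _ _ fun _ => rfl, Fin.sum_univ_two]
    have h3 : ∀ t : Fin 2 →₀ ℕ, (t.sum fun _ => id) = t 0 + t 1 := fun t => by
      rw [Finsupp.sum_fintype _ _ fun _ => rfl, Fin.sum_univ_two]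
      rfl
    rw [h2] at h1
    rw [h3]
    fin_cases i <;> simp at h ⊢ <;> omega

theorem evalPoly_apply (p : MvPolynomial (Fin 2) ℝ) (x : Plane) :
    evalPoly p x = aeval (fun i => x i) p := rfl

theorem hasFDerivAt_evalPoly (p : MvPolynomial (Fin 2) ℝ) (x : Plane) :
    HasFDerivAt (evalPoly p) (∑ i, evalPoly (pderiv i p) x •
      (EuclideanSpace.proj i : Plane →L[ℝ] ℝ)) x := by
  induction p using MvPolynomial.induction_on with
  | C a =>
    have : evalPoly (C a) = fun _ => a := by
      funext y
      simp [evalPoly_apply]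
    rw [this]
    refine (hasFDerivAt_const a x).congr_fderiv ?_
    simp
  | add p q hp hq =>
    rw [map_add]
    refine (hp.add hq).congr_fderiv ?_
    simp only [map_add, Pi.add_apply, add_smul, Finset.sum_add_distrib]
  | mul_X p n hp =>
    have : evalPoly (p * X n) = fun y => evalPoly p y * y n := by
      funext y
      simp [evalPoly_apply]
    rw [this]
    have hn : HasFDerivAt (fun y : Plane => y n) (EuclideanSpace.proj n : Plane →L[ℝ] ℝ) x :=
      (EuclideanSpace.proj n : Plane →L[ℝ] ℝ).hasFDerivAt
    refine (hp.mul hn).congr_fderiv ?_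
    have key : ∀ i, evalPoly (pderiv i (p * X n)) x =
        x n * evalPoly (pderiv i p) x + evalPoly p x * (Pi.single i 1 : Fin 2 → ℝ) n := by
      intro i
      rw [Derivation.leibniz, pderiv_X, map_add]
      simp only [evalPoly_apply, Pi.add_apply, smul_eq_mul, map_mul, aeval_X]
      by_cases h : i = n
      · subst h
        simp
        ring
      · simp [Ne.symm h]
    simp only [key, add_smul, Finset.sum_add_distrib, mul_smul, ← Finset.smul_sum]
    rw [add_comm]
    congr 2
    fin_cases n <;> simp

theorem contDiff_evalPoly (p : MvPolynomial (Fin 2) ℝ) : ContDiff ℝ ∞ (evalPoly p) := by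
  induction p using MvPolynomial.induction_on with
  | C a =>
    have : evalPoly (C a) = fun _ => a := by
      funext y
      simp [evalPoly_apply]
    rw [this]
    exact contDiff_const
  | add p q hp hq => rw [map_add]; exact hp.add hq
  | mul_X p n hp =>
    have : evalPoly (p * X n) = fun y => evalPoly p y * y n := by
      funext y
      simp [evalPoly_apply]
    rw [this]
    exact hp.mul (EuclideanSpace.proj n : Plane →L[ℝ] ℝ).contDiff

theorem gradient_evalPoly (p : MvPolynomial (Fin 2) ℝ) (x : Plane) (i : Fin 2) :
    gradient (evalPoly p) x i = evalPoly (pderiv i p) x := by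
  rw [gradient_coord, (hasFDerivAt_evalPoly p x).fderiv]
  fin_cases i <;> simp [Fin.sum_univ_two]

theorem mem_polySpace {m : ℕ} {q : Plane → ℝ} :
    q ∈ polySpace m ↔ ∃ p : MvPolynomial (Fin 2) ℝ, p.totalDegree ≤ m ∧ evalPoly p = q := by
  simp [polySpace, Submodule.mem_map, mem_restrictTotalDegree]

theorem const_mem_polySpace (m : ℕ) (c : ℝ) : (fun _ => c) ∈ polySpace m :=
  mem_polySpace.2 ⟨C c, by simp, by funext x; simp [evalPoly_apply]⟩

theorem contDiff_of_mem_polySpace {m : ℕ} {q : Plane → ℝ} (hq : q ∈ polySpace m) :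
    ContDiff ℝ ∞ q := by
  obtain ⟨p, -, rfl⟩ := mem_polySpace.1 hq
  exact contDiff_evalPoly p

instance finite_polySpace (m : ℕ) : Module.Finite ℝ (polySpace m) := by
  unfold polySpace
  infer_instance

instance finite_extPoly (Ψ : Submodule ℝ (Plane → ℝ)) [FiniteDimensional ℝ Ψ] (k : ℕ) :
    Module.Finite ℝ (extPoly Ψ k) := by
  unfold extPoly
  infer_instance

end Polynomials

theorem integral_mul_gradient {U : Set Plane} {f φ : Plane → ℝ}
    (hf : ContDiff ℝ ∞ f) (hφ : IsTestFunction U φ) (i : Fin 2) :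
    ∫ x in U, f x * gradient φ x i = - ∫ x in U, gradient f x i * φ x := by
  have e1 : ∫ x in U, f x * gradient φ x i = ∫ x, f x * gradient φ x i :=
    setIntegral_eq_integral_of_forall_compl_eq_zero fun x hx => by
      simp [hφ.gradient_eq_zero hx]
  have e2 : ∫ x in U, gradient f x i * φ x = ∫ x, gradient f x i * φ x :=
    setIntegral_eq_integral_of_forall_compl_eq_zero fun x hx => by
      simp [hφ.eq_zero hx]
  rw [e1, e2]
  simp only [gradient_coord]
  have c1 : Continuous fun x => fderiv ℝ f x (EuclideanSpace.single i 1) :=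
    (hf.continuous_fderiv (by simp)).clm_apply continuous_const
  have c2 : Continuous fun x => fderiv ℝ φ x (EuclideanSpace.single i 1) :=
    (hφ.smooth.continuous_fderiv (by simp)).clm_apply continuous_const
  refine integral_mul_fderiv_eq_neg_fderiv_mul_of_integrable ?_ ?_ ?_
    (fun x _ => hf.differentiable (by simp) x) (fun x _ => hφ.smooth.differentiable (by simp) x)
  · exact (c1.mul hφ.smooth.continuous).integrable_of_hasCompactSupport hφ.compact.mul_left
  · exact (hf.continuous.mul c2).integrable_of_hasCompactSupport
      ((hφ.compact.fderiv_apply (𝕜 := ℝ) (EuclideanSpace.single i (1 : ℝ))).mul_left)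
  · exact (hf.continuous.mul hφ.smooth.continuous).integrable_of_hasCompactSupport
      hφ.compact.mul_left

variable {P : Set Plane} {x₀ : Plane} {ρ : ℝ} {Es : Finset (Plane × Plane)}

theorem StarCell.hasWeakGrad_of_contDiff (hP : StarCell P x₀ ρ) {f : Plane → ℝ}
    (hf : ContDiff ℝ ∞ f) : HasWeakGrad (interior P) f (gradient f) :=
  ⟨hP.memLp_of_continuous hf.continuous.continuousOn,
    hP.memLp_of_continuous (contDiff_gradient_continuous hf).continuousOn,
    fun _ hφ i => integral_mul_gradient hf hφ i⟩

/-- Each differentiation lowers the degree by one, with truncation at zero. For m ≤ 1 the Laplacian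
is zero, which the truncated difference m - 2 = 0 accommodates. -/
theorem StarCell.exists_laplacian_poly (hP : StarCell P x₀ ρ) {m : ℕ} {q : Plane → ℝ}
    (hq : q ∈ polySpace m) : ∃ r ∈ polySpace (m - 2), HasWeakLaplacian (interior P) q r := by
  obtain ⟨p, hp, rfl⟩ := mem_polySpace.1 hq
  have hgc := contDiff_gradient_continuous (contDiff_evalPoly p)
  refine ⟨evalPoly (∑ i, MvPolynomial.pderiv i (MvPolynomial.pderiv i p)),
    mem_polySpace.2 ⟨_, ?_, rfl⟩, gradient (evalPoly p),
    hP.hasWeakGrad_of_contDiff (contDiff_evalPoly p),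
    hP.memLp_of_continuous (contDiff_evalPoly _).continuous.continuousOn, fun φ hφ => ?_⟩
  · refine MvPolynomial.totalDegree_finsetSum_le fun i _ => ?_
    have h1 := totalDegree_pderiv_le i p
    have h2 := totalDegree_pderiv_le i (MvPolynomial.pderiv i p)
    omega
  · have h1 := fun i : Fin 2 => integral_mul_gradient
      (contDiff_evalPoly (MvPolynomial.pderiv i p)) hφ i
    simp only [gradient_evalPoly] at h1
    have hi : ∀ q, MemLp (evalPoly q) 2 (volume.restrict (interior P)) := fun q =>
      hP.memLp_of_continuous (contDiff_evalPoly q).continuous.continuousOn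
    have hgi := fun i => memLp_coord (hφ.memLp_gradient (volume.restrict (interior P))) i
    have hφi := hφ.memLp (volume.restrict (interior P))
    simp only [PiLp.inner_apply, Fin.sum_univ_two, RCLike.inner_apply, conj_trivial,
      gradient_evalPoly, map_add, Pi.add_apply, add_mul]
    rw [integral_add (integrable_mul' (hgi 0) (hi _)) (integrable_mul' (hgi 1) (hi _)),
      integral_add (integrable_mul' (hi _) hφi) (integrable_mul' (hi _) hφi)]
    have e : ∀ i, ∫ x in interior P, gradient φ x i * evalPoly (MvPolynomial.pderiv i p) x =
        ∫ x in interior P, evalPoly (MvPolynomial.pderiv i p) x * gradient φ x i := fun i =>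
      integral_congr_ae (ae_of_all _ fun x => mul_comm _ _)
    rw [e, e, h1, h1]
    ring

/-- The trace of a function that is continuous up to the boundary is its restriction. -/
theorem PolyCell.hasTrace_self (hP : PolyCell P x₀ ρ Es) {v : Plane → ℝ} {G : Plane → Plane}
    (hG : HasWeakGrad (interior P) v G) (hv : ContinuousOn v P) :
    HasTrace (interior P) v v := by
  have := hP.isFiniteMeasure_bdry
  obtain ⟨φ, hφ, a1, a2, a3, -⟩ := hP.exists_smooth_approx hG
  have hfr : frontier P ⊆ P := hP.isClosed.frontier_subset
  have hms : MeasurableSet (frontier P) := isClosed_frontier.measurableSet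
  have hβ : bdryMeasure (interior P) = μH[1].restrict (frontier P) := by
    rw [bdryMeasure, hP.frontier_interior]
  have hmeas : AEStronglyMeasurable v (bdryMeasure (interior P)) := by
    rw [hβ]
    exact (hv.mono hfr).aestronglyMeasurable hms
  have hmem : ∀ᵐ x ∂bdryMeasure (interior P), x ∈ P := by
    rw [hβ]
    filter_upwards [ae_restrict_mem hms] with x hx using hfr hx
  obtain ⟨C, hC⟩ := hP.isCompact.exists_bound_of_continuousOn hv
  refine ⟨G, hG, MemLp.of_bound hmeas C (hmem.mono fun x hx => hC x hx), φ, hφ, a1, a2, ?_⟩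
  set m : ℝ≥0∞ := bdryMeasure (interior P) univ ^ (2 : ℝ≥0∞).toReal⁻¹ with hm
  have hmfin : m ≠ ⊤ := ENNReal.rpow_ne_top_of_nonneg (inv_nonneg.2 ENNReal.toReal_nonneg)
    (measure_ne_top _ _)
  rw [ENNReal.tendsto_nhds_zero]
  intro ε hε
  obtain ⟨r, hr0, hrε⟩ := ENNReal.lt_iff_exists_nnreal_btwn.1 hε
  have hr0 : 0 < r := by exact_mod_cast hr0
  -- The approximants converge uniformly on `P`, frontier included, and the boundary has finite
  -- length, so they also converge in `L²` of the boundary.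
  filter_upwards [a3 hv ((r : ℝ) / (m.toReal + 1)) (by positivity)] with n hn
  refine (eLpNorm_le_of_ae_bound (C := (r : ℝ) / (m.toReal + 1))
    (hmem.mono fun x hx => hn x hx)).trans (le_trans ?_ hrε.le)
  rw [← hm, ← ENNReal.ofReal_coe_nnreal]
  have hmul : ∀ c, m * ENNReal.ofReal c = ENNReal.ofReal (m.toReal * c) := fun c => by
    rw [ENNReal.ofReal_mul ENNReal.toReal_nonneg, ENNReal.ofReal_toReal hmfin]
  rw [hmul]
  refine ENNReal.ofReal_le_ofReal ?_
  rw [mul_div_assoc', div_le_iff₀ (by positivity)]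
  nlinarith [ENNReal.toReal_nonneg (a := m), r.coe_nonneg]

end XVEM

/-! ### Mesh elements as polygonal cells; existence and uniqueness of the elliptic projection. -/

namespace XVEM

open scoped ENNReal NNReal

section Mesh

variable {Ω : Set Plane} {𝒯 : PolygonalMesh Ω}

theorem PolygonalMesh.IsRegular.polyCell {ϱ : ℝ} (h : 𝒯.IsRegular ϱ) (hϱ : 0 < ϱ)
    {P : Set Plane} (hP : P ∈ 𝒯.cells) : ∃ x₀ ρ Es, PolyCell P x₀ ρ Es ∧
      ∀ e, e ∈ Es ↔ e ∈ 𝒯.edges ∧ seg e ⊆ frontier P := by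
  classical
  obtain ⟨x, hx, hs⟩ := h P hP
  have hdiam : 0 < Metric.diam P := by
    obtain ⟨z, hz⟩ := 𝒯.interior_nonempty P hP
    exact Metric.diam_pos (infinite_of_mem_nhds z (mem_interior_iff_mem_nhds.1 hz)).nontrivial
      (𝒯.isCompact P hP).isBounded
  refine ⟨x, ϱ * Metric.diam P, 𝒯.edges.filter fun e => seg e ⊆ frontier P, ?_, by simp⟩
  exact {
    isCompact := 𝒯.isCompact P hP
    closure_interior := 𝒯.closure_interior P hP
    pos := by positivity
    ball_subset := hx
    star := hs
    edge_ne := fun e he => 𝒯.edge_ne e (Finset.mem_filter.1 he).1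
    edge_subset := fun e he => (Finset.mem_filter.1 he).2
    frontier_eq := (𝒯.frontier_eq P hP).trans (by ext z; simp) }

end Mesh

section Projections

variable {Ω : Set Plane} {𝒯 : PolygonalMesh Ω} {Ψ : Submodule ℝ (Plane → ℝ)}
  {P : Set Plane} {x₀ : Plane} {ρ : ℝ} {Es : Finset (Plane × Plane)} {k : ℕ}

theorem IsEnrichment.continuousOn_extPoly (hΨ : IsEnrichment 𝒯 Ψ) (hP : P ∈ 𝒯.cells)
    {q : Plane → ℝ} (hq : q ∈ extPoly Ψ k) : ContinuousOn q P := by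
  have hsub : P ⊆ closure Ω := by
    rw [𝒯.closure_eq]
    exact subset_biUnion_of_mem (u := fun P : Set Plane => P) (Finset.mem_coe.2 hP)
  obtain ⟨p, hp, w, hw, rfl⟩ := Submodule.mem_sup.1 hq
  exact (contDiff_of_mem_polySpace hp).continuous.continuousOn.add
    ((hΨ.continuousOn w hw).mono hsub)

theorem IsEnrichment.exists_laplacian (hΨ : IsEnrichment 𝒯 Ψ) (hP : P ∈ 𝒯.cells)
    (hc : StarCell P x₀ ρ) {q : Plane → ℝ} (hq : q ∈ extPoly Ψ k) :
    ∃ r ∈ extLap Ψ (k - 2) (interior P), HasWeakLaplacian (interior P) q r := by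
  obtain ⟨p, hp, w, hw, rfl⟩ := Submodule.mem_sup.1 hq
  obtain ⟨r, hr, hpr⟩ := hc.exists_laplacian_poly hp
  obtain ⟨s, hs⟩ := hΨ.laplacian w hw P hP
  exact ⟨r + s, ⟨r, hr, w, hw, s, hs, rfl⟩, hpr.add hs⟩

theorem IsEnrichment.hasTrace_self (hΨ : IsEnrichment 𝒯 Ψ) (hP : P ∈ 𝒯.cells)
    (hc : PolyCell P x₀ ρ Es) {q : Plane → ℝ} (hq : q ∈ extPoly Ψ k) :
    HasTrace (interior P) q q := by
  obtain ⟨r, -, hr⟩ := hΨ.exists_laplacian hP hc.toStarCell hq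
  obtain ⟨G, hG⟩ := hr.memH1
  exact hc.hasTrace_self hG (hΨ.continuousOn_extPoly hP hq)

theorem IsEnrichment.mem_localSpace (hΨ : IsEnrichment 𝒯 Ψ) (hP : P ∈ 𝒯.cells)
    (hc : PolyCell P x₀ ρ Es) {q : Plane → ℝ} (hq : q ∈ extPoly Ψ k) :
    q ∈ localSpace 𝒯 Ψ k P :=
  ⟨hΨ.exists_laplacian hP hc.toStarCell hq, q, hΨ.hasTrace_self hP hc hq,
    (hΨ.continuousOn_extPoly hP hq).mono hc.isClosed.frontier_subset,
    fun _ _ _ => ⟨q, hq, fun _ _ => rfl⟩⟩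

theorem memH1_of_mem_localSpace {v : Plane → ℝ} (hv : v ∈ localSpace 𝒯 Ψ k P) :
    MemH1 (interior P) v := hv.1.choose_spec.2.memH1

theorem const_mem_extPoly (c : ℝ) : (fun _ => c) ∈ extPoly Ψ k :=
  Submodule.mem_sup_left (const_mem_polySpace k c)

theorem weakGrad_add {U : Set Plane} (hU : IsOpen U) {v w : Plane → ℝ} (hv : MemH1 U v)
    (hw : MemH1 U w) : weakGrad U (v + w) =ᵐ[volume.restrict U] weakGrad U v + weakGrad U w :=
  ((hasWeakGrad_weakGrad hv).add (hasWeakGrad_weakGrad hw)).weakGrad_ae hU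

theorem weakGrad_smul {U : Set Plane} (hU : IsOpen U) {v : Plane → ℝ} (c : ℝ) (hv : MemH1 U v) :
    weakGrad U (c • v) =ᵐ[volume.restrict U] c • weakGrad U v :=
  ((hasWeakGrad_weakGrad hv).smul c).weakGrad_ae hU

theorem MemH1.smul {U : Set Plane} {v : Plane → ℝ} (c : ℝ) (hv : MemH1 U v) :
    MemH1 U (c • v) := ⟨_, hv.choose_spec.smul c⟩

theorem integral_inner_toLp {F : Type*} [NormedAddCommGroup F] [InnerProductSpace ℝ F]
    {μ : Measure Plane} {f g : Plane → F} (hf : MemLp f 2 μ) (hg : MemLp g 2 μ) :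
    ∫ x, inner ℝ (f x) (g x) ∂μ = inner ℝ (hf.toLp f) (hg.toLp g) := by
  rw [L2.inner_def]
  refine integral_congr_ae ?_
  filter_upwards [hf.coeFn_toLp, hg.coeFn_toLp] with x h1 h2
  rw [h1, h2]

theorem ae_eq_zero_of_integral_norm_sq {F : Type*} [NormedAddCommGroup F]
    {μ : Measure Plane} {f : Plane → F} (hf : MemLp f 2 μ) (h : ∫ x, ‖f x‖ ^ 2 ∂μ = 0) :
    f =ᵐ[μ] 0 := by
  have hi : Integrable (fun x => ‖f x‖ ^ 2) μ := hf.norm.integrable_sq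
  rw [integral_eq_zero_iff_of_nonneg (fun x => by positivity) hi] at h
  filter_upwards [h] with x hx
  simpa using hx

/-- The gradient, as a linear map on a space of functions of `H¹(U)`. -/
noncomputable def gradLp {U : Set Plane} (hU : IsOpen U) (V : Submodule ℝ (Plane → ℝ))
    (hV : ∀ v ∈ V, MemH1 U v) : V →ₗ[ℝ] Lp Plane 2 (volume.restrict U : Measure Plane) where
  toFun v := (hasWeakGrad_weakGrad (hV v v.2)).memLp_grad.toLp _
  map_add' v w := by
    rw [← MemLp.toLp_add]
    exact MemLp.toLp_congr _ _ (weakGrad_add hU (hV v v.2) (hV w w.2))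
  map_smul' c v := by
    rw [RingHom.id_apply, ← MemLp.toLp_const_smul]
    exact MemLp.toLp_congr _ _ (weakGrad_smul hU c (hV v v.2))

/-- The weak gradient of v is projected orthogonally on the finite-dimensional space of gradients of
ℙ_k + Ψ. A preimage is then corrected by a constant, which belongs to ℙ_k, to obtain the right mean.
-/
theorem exists_isEllProj (hΨ : IsEnrichment 𝒯 Ψ) [FiniteDimensional ℝ Ψ] (hP : P ∈ 𝒯.cells)
    (hc : PolyCell P x₀ ρ Es) {v : Plane → ℝ} (hv : MemH1 (interior P) v) :
    ∃ q, IsEllProj Ψ k P v q := by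
  have hU : IsOpen (interior P) := isOpen_interior
  have hfin := hc.isFiniteMeasure
  have hV : ∀ q ∈ extPoly Ψ k, MemH1 (interior P) q := fun q hq =>
    memH1_of_mem_localSpace (hΨ.mem_localSpace hP hc hq)
  set A := gradLp hU (extPoly Ψ k) hV with hA
  have hgv := (hasWeakGrad_weakGrad hv).memLp_grad
  obtain ⟨q₀, hq₀⟩ : ∃ q₀, A q₀ = (LinearMap.range A).starProjection (hgv.toLp _) :=
    LinearMap.mem_range.1 (Submodule.starProjection_apply_mem _ _)
  have horth : ∀ p, inner ℝ (A q₀) (A p) = inner ℝ (hgv.toLp _) (A p) := fun p => by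
    rw [hq₀]
    have := Submodule.starProjection_inner_eq_zero (K := LinearMap.range A)
      (hgv.toLp _) (A p) (LinearMap.mem_range_self A p)
    rw [inner_sub_left, sub_eq_zero] at this
    exact this.symm
  set m : ℝ := (volume (interior P)).toReal with hm
  have hm0 : m ≠ 0 := by
    rw [hm, ENNReal.toReal_ne_zero]
    refine ⟨(hU.measure_pos _ ⟨x₀, hc.center_mem_interior⟩).ne', ?_⟩
    exact ((measure_mono interior_subset).trans_lt hc.isCompact.measure_lt_top).ne
  set c : ℝ := ((∫ x in interior P, v x) - ∫ x in interior P, (q₀ : Plane → ℝ) x) / m with hcd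
  have hq₀i : Integrable (q₀ : Plane → ℝ) (volume.restrict (interior P)) :=
    (hasWeakGrad_weakGrad (hV _ q₀.2)).memLp.integrable (by norm_num)
  refine ⟨(q₀ : Plane → ℝ) + fun _ => c, add_mem q₀.2 (const_mem_extPoly c), fun p hp => ?_, ?_⟩
  · have h1 : weakGrad (interior P) ((q₀ : Plane → ℝ) + fun _ => c) =ᵐ[volume.restrict (interior P)]
        weakGrad (interior P) q₀ := by
      have h2 := hc.hasWeakGrad_of_contDiff (contDiff_const (c := c) (𝕜 := ℝ) (n := ∞))
      have h3 : gradient (fun _ : Plane => c) = 0 := by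
        funext x
        simp [gradient]
      rw [h3] at h2
      have h4 := (hasWeakGrad_weakGrad (hV _ q₀.2)).add h2
      rw [add_zero] at h4
      exact h4.weakGrad_ae hU
    have hgq := (hasWeakGrad_weakGrad (hV _ q₀.2)).memLp_grad
    have hgp := (hasWeakGrad_weakGrad (hV _ hp)).memLp_grad
    have h5 : ∫ x in interior P, inner ℝ (weakGrad (interior P) q₀ x) (weakGrad (interior P) p x) =
        ∫ x in interior P, inner ℝ (weakGrad (interior P) v x) (weakGrad (interior P) p x) := by
      rw [integral_inner_toLp hgq hgp, integral_inner_toLp hgv hgp]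
      exact horth ⟨p, hp⟩
    rw [← h5]
    refine integral_congr_ae ?_
    filter_upwards [h1] with x hx
    rw [hx]
  · simp only [Pi.add_apply]
    rw [integral_add hq₀i (integrable_const _), integral_const, measureReal_def,
      Measure.restrict_apply_univ, ← hm, hcd, smul_eq_mul, mul_div_cancel₀ _ hm0]
    ring

/-- A function of `ℙ_k(P) + Ψ(P)` of zero gradient is constant on `P`. -/
theorem exists_eqOn_const (hΨ : IsEnrichment 𝒯 Ψ) (hP : P ∈ 𝒯.cells)
    (hc : PolyCell P x₀ ρ Es) {q : Plane → ℝ} (hq : q ∈ extPoly Ψ k)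
    (h : weakGrad (interior P) q =ᵐ[volume.restrict (interior P)] 0) :
    ∃ c : ℝ, EqOn q (fun _ => c) P := by
  have hG := hasWeakGrad_weakGrad (memH1_of_mem_localSpace (hΨ.mem_localSpace hP hc hq))
  obtain ⟨c, hcst⟩ := hc.ae_eq_const hG h
  refine ⟨c, ?_⟩
  have hcont := hΨ.continuousOn_extPoly hP hq
  have h1 : EqOn q (fun _ => c) (interior P) :=
    Measure.eqOn_open_of_ae_eq hcst isOpen_interior (hcont.mono interior_subset)
      continuousOn_const
  exact h1.of_subset_closure hcont continuousOn_const interior_subset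
    hc.closure_interior.symm.subset

/-- The difference, tested with itself, has zero gradient, so it is constant, and its mean is zero.
Continuity makes the equality hold at every point of `P`. -/
theorem IsEllProj.eqOn (hΨ : IsEnrichment 𝒯 Ψ) (hP : P ∈ 𝒯.cells)
    (hc : PolyCell P x₀ ρ Es) {v q q' : Plane → ℝ} (hq : IsEllProj Ψ k P v q)
    (hq' : IsEllProj Ψ k P v q') : EqOn q q' P := by
  have hU : IsOpen (interior P) := isOpen_interior
  have hfin := hc.isFiniteMeasure
  have hH : ∀ q ∈ extPoly Ψ k, MemH1 (interior P) q := fun q hq =>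
    memH1_of_mem_localSpace (hΨ.mem_localSpace hP hc hq)
  have hd : q - q' ∈ extPoly Ψ k := sub_mem hq.mem hq'.mem
  have hg := hasWeakGrad_weakGrad (hH _ hq.mem)
  have hg' := hasWeakGrad_weakGrad (hH _ hq'.mem)
  have hgd := hasWeakGrad_weakGrad (hH _ hd)
  have hsub : weakGrad (interior P) (q - q') =ᵐ[volume.restrict (interior P)]
      weakGrad (interior P) q - weakGrad (interior P) q' := by
    have h1 := hg.add (hg'.smul (-1))
    rw [neg_one_smul, neg_one_smul, ← sub_eq_add_neg, ← sub_eq_add_neg] at h1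
    exact h1.weakGrad_ae hU
  have hz : ∫ x in interior P, ‖weakGrad (interior P) (q - q') x‖ ^ 2 = 0 := by
    have e : ∫ x in interior P, ‖weakGrad (interior P) (q - q') x‖ ^ 2 =
        ∫ x in interior P, (inner ℝ (weakGrad (interior P) q x)
            (weakGrad (interior P) (q - q') x) -
          inner ℝ (weakGrad (interior P) q' x) (weakGrad (interior P) (q - q') x)) := by
      refine integral_congr_ae ?_
      filter_upwards [hsub] with x hx
      rw [← inner_sub_left, ← real_inner_self_eq_norm_sq]
      congr 1
    rw [e, integral_sub (memLp_integrable_inner hg.memLp_grad hgd.memLp_grad)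
      (memLp_integrable_inner hg'.memLp_grad hgd.memLp_grad), hq.grad_eq _ hd, hq'.grad_eq _ hd,
      sub_self]
  obtain ⟨c, hcst⟩ := exists_eqOn_const hΨ hP hc hd
    (ae_eq_zero_of_integral_norm_sq hgd.memLp_grad hz)
  have hmean : ∫ x in interior P, (q - q') x = 0 := by
    simp only [Pi.sub_apply]
    rw [integral_sub (hg.memLp.integrable (by norm_num)) (hg'.memLp.integrable (by norm_num)),
      hq.mean_eq, hq'.mean_eq, sub_self]
  rw [setIntegral_congr_fun hU.measurableSet (hcst.mono interior_subset), integral_const,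
    smul_eq_mul, mul_eq_zero] at hmean
  have hc0 : c = 0 := by
    refine hmean.resolve_left ?_
    rw [measureReal_def, Measure.restrict_apply_univ, ← ne_eq, ENNReal.toReal_ne_zero]
    refine ⟨(hU.measure_pos _ ⟨x₀, hc.center_mem_interior⟩).ne', ?_⟩
    exact ((measure_mono interior_subset).trans_lt hc.isCompact.measure_lt_top).ne
  intro x hx
  have := hcst hx
  rw [hc0] at this
  exact sub_eq_zero.1 this

end Projections

end XVEM

/-! ### Linear maps into L² given by their graphs; the Laplacian projector; linearity of the
projections. -/

namespace XVEM

open scoped ENNReal NNReal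

section LinearRelations

variable {V F : Type*} [AddCommGroup V] [Module ℝ V] [NormedAddCommGroup F] [NormedSpace ℝ F]
  {μ : Measure Plane}

/-- The graph of a linear map into `L²(μ)`, with functions in place of their classes. -/
structure IsLpGraph (μ : Measure Plane) (R : V → (Plane → F) → Prop) : Prop where
  exists_rel : ∀ v, ∃ g, R v g
  memLp : ∀ v g, R v g → MemLp g 2 μ
  unique : ∀ v g g', R v g → R v g' → g =ᵐ[μ] g'
  add : ∀ v w g h, R v g → R w h → R (v + w) (g + h)
  smul : ∀ (c : ℝ) v g, R v g → R (c • v) (c • g)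

variable {R : V → (Plane → F) → Prop}

/-- The linear map with the given graph. -/
noncomputable def IsLpGraph.toLp (h : IsLpGraph μ R) : V →ₗ[ℝ] Lp F 2 μ where
  toFun v := (h.memLp v _ (h.exists_rel v).choose_spec).toLp _
  map_add' v w := by
    rw [← MemLp.toLp_add]
    exact MemLp.toLp_congr _ _ (h.unique _ _ _ (h.exists_rel _).choose_spec
      (h.add _ _ _ _ (h.exists_rel v).choose_spec (h.exists_rel w).choose_spec))
  map_smul' c v := by
    rw [RingHom.id_apply, ← MemLp.toLp_const_smul]
    exact MemLp.toLp_congr _ _ (h.unique _ _ _ (h.exists_rel _).choose_spec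
      (h.smul _ _ _ (h.exists_rel v).choose_spec))

/-- Any related function represents the value. Projections and traces picked by `Classical.epsilon`
are not linear as functions, yet they may be inserted here into a map whose linearity comes from the
relation. -/
theorem IsLpGraph.toLp_eq (h : IsLpGraph μ R) {v : V} {g : Plane → F} (hg : R v g) :
    h.toLp v = (h.memLp v g hg).toLp g :=
  MemLp.toLp_congr (h.memLp v _ (h.exists_rel v).choose_spec) _
    (h.unique _ _ _ (h.exists_rel v).choose_spec hg)

theorem IsLpGraph.coeFn_toLp (h : IsLpGraph μ R) {v : V} {g : Plane → F} (hg : R v g) :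
    h.toLp v =ᵐ[μ] g := by
  rw [h.toLp_eq hg]
  exact (h.memLp v g hg).coeFn_toLp

theorem IsLpGraph.norm_toLp_sq {F : Type*} [NormedAddCommGroup F] [InnerProductSpace ℝ F]
    {R : V → (Plane → F) → Prop} (h : IsLpGraph μ R) {v : V} {g : Plane → F} (hg : R v g) :
    ‖h.toLp v‖ ^ 2 = ∫ x, ‖g x‖ ^ 2 ∂μ := by
  rw [← real_inner_self_eq_norm_sq, h.toLp_eq hg, ← integral_inner_toLp]
  simp only [real_inner_self_eq_norm_sq]

end LinearRelations

section LapProj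

variable {Ω : Set Plane} {𝒯 : PolygonalMesh Ω} {Ψ : Submodule ℝ (Plane → ℝ)}
  {P : Set Plane} {x₀ : Plane} {ρ : ℝ} {l : ℕ}

theorem StarCell.isLpGraph_polySpace (hc : StarCell P x₀ ρ) (l : ℕ) :
    IsLpGraph (volume.restrict (interior P)) fun (q : polySpace l) (g : Plane → ℝ) => g = q where
  exists_rel q := ⟨q, rfl⟩
  memLp q g hg := hg ▸
    hc.memLp_of_continuous (contDiff_of_mem_polySpace q.2).continuous.continuousOn
  unique q g g' hg hg' := by rw [hg, hg']
  add := by rintro v w _ _ rfl rfl; rfl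
  smul := by rintro c v _ rfl; rfl

theorem IsEnrichment.isLpGraph_laplacian (hΨ : IsEnrichment 𝒯 Ψ) (hP : P ∈ 𝒯.cells) :
    IsLpGraph (volume.restrict (interior P)) fun (w : Ψ) (s : Plane → ℝ) =>
      HasWeakLaplacian (interior P) w s where
  exists_rel w := hΨ.laplacian w w.2 P hP
  memLp _ _ h := h.memLp
  unique _ _ _ h h' := h.unique isOpen_interior h'
  add _ _ _ _ h h' := h.add h'
  smul c _ _ h := h.smul c

/-- The space `ℙ_l(P) + ΔΨ(P)` as a subspace of `L²(P)`. -/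
noncomputable def extLapLp (hΨ : IsEnrichment 𝒯 Ψ) (hP : P ∈ 𝒯.cells) (hc : StarCell P x₀ ρ)
    (l : ℕ) : Submodule ℝ (Lp ℝ 2 (volume.restrict (interior P) : Measure Plane)) :=
  LinearMap.range (hc.isLpGraph_polySpace l).toLp ⊔
    LinearMap.range (hΨ.isLpGraph_laplacian hP).toLp

/-- The function space `extLap` contains every function vanishing almost everywhere on the cell, so
it is infinite-dimensional. Its classes in `L²` form a finite-dimensional space, and this is where
an orthogonal projector exists. -/
instance finite_extLapLp [FiniteDimensional ℝ Ψ] (hΨ : IsEnrichment 𝒯 Ψ) (hP : P ∈ 𝒯.cells)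
    (hc : StarCell P x₀ ρ) (l : ℕ) : FiniteDimensional ℝ (extLapLp hΨ hP hc l) := by
  unfold extLapLp
  infer_instance

theorem StarCell.memLp_of_mem_extLap (hc : StarCell P x₀ ρ) {r : Plane → ℝ}
    (hr : r ∈ extLap Ψ l (interior P)) : MemLp r 2 (volume.restrict (interior P)) := by
  obtain ⟨q, hq, w, hw, s, hs, rfl⟩ := hr
  exact (hc.memLp_of_continuous
    (contDiff_of_mem_polySpace hq).continuous.continuousOn).add hs.memLp

theorem toLp_mem_extLapLp (hΨ : IsEnrichment 𝒯 Ψ) (hP : P ∈ 𝒯.cells) (hc : StarCell P x₀ ρ)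
    {r : Plane → ℝ} (hr : r ∈ extLap Ψ l (interior P)) :
    (hc.memLp_of_mem_extLap hr).toLp r ∈ extLapLp hΨ hP hc l := by
  obtain ⟨q, hq, w, hw, s, hs, rfl⟩ := hr
  have e1 := (hc.isLpGraph_polySpace l).toLp_eq (v := ⟨q, hq⟩) rfl
  have e2 := (hΨ.isLpGraph_laplacian hP).toLp_eq (v := ⟨w, hw⟩) hs
  refine Submodule.mem_sup.2 ⟨_, LinearMap.mem_range_self _ ⟨q, hq⟩, _,
    LinearMap.mem_range_self _ ⟨w, hw⟩, ?_⟩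
  rw [e1, e2, ← MemLp.toLp_add]

theorem exists_of_mem_extLapLp (hΨ : IsEnrichment 𝒯 Ψ) (hP : P ∈ 𝒯.cells)
    (hc : StarCell P x₀ ρ) {f : Lp ℝ 2 (volume.restrict (interior P) : Measure Plane)}
    (hf : f ∈ extLapLp hΨ hP hc l) :
    ∃ r ∈ extLap Ψ l (interior P), f =ᵐ[volume.restrict (interior P)] r := by
  obtain ⟨_, ⟨q, rfl⟩, _, ⟨w, rfl⟩, rfl⟩ := Submodule.mem_sup.1 hf
  obtain ⟨s, hs⟩ := hΨ.laplacian w w.2 P hP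
  refine ⟨q + s, ⟨q, q.2, w, w.2, s, hs, rfl⟩, (Lp.coeFn_add _ _).trans ?_⟩
  exact ((hc.isLpGraph_polySpace l).coeFn_toLp rfl).add
    ((hΨ.isLpGraph_laplacian hP).coeFn_toLp hs)

theorem exists_isLapProj (hΨ : IsEnrichment 𝒯 Ψ) [FiniteDimensional ℝ Ψ] (hP : P ∈ 𝒯.cells)
    (hc : StarCell P x₀ ρ) {v : Plane → ℝ} (hv : MemLp v 2 (volume.restrict (interior P))) :
    ∃ r, IsLapProj Ψ l P v r := by
  set K := extLapLp hΨ hP hc l with hK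
  obtain ⟨r, hr, hpr⟩ := exists_of_mem_extLapLp hΨ hP hc
    (Submodule.starProjection_apply_mem K (hv.toLp v))
  refine ⟨r, hr, fun s hs => ?_⟩
  have hrL := hc.memLp_of_mem_extLap hr
  have hsL := hc.memLp_of_mem_extLap hs
  have h1 := Submodule.starProjection_inner_eq_zero (K := K) (hv.toLp v) _
    (toLp_mem_extLapLp hΨ hP hc hs)
  have h2 : K.starProjection (hv.toLp v) = hrL.toLp r := by
    refine Lp.ext (hpr.trans hrL.coeFn_toLp.symm)
  rw [h2, ← MemLp.toLp_sub, ← integral_inner_toLp] at h1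
  rw [← h1]
  refine integral_congr_ae (ae_of_all _ fun x => ?_)
  simp [mul_comm]

theorem IsLapProj.memLp (hc : StarCell P x₀ ρ) {v r : Plane → ℝ} (h : IsLapProj Ψ l P v r) :
    MemLp r 2 (volume.restrict (interior P)) := hc.memLp_of_mem_extLap h.mem

theorem integrable_sub_mul {μ : Measure Plane} {v r t : Plane → ℝ} (hv : MemLp v 2 μ)
    (hr : MemLp r 2 μ) (ht : MemLp t 2 μ) : Integrable (fun x => (v x - r x) * t x) μ :=
  integrable_mul' (hv.sub hr) ht

theorem IsLapProj.unique (hc : StarCell P x₀ ρ) {v r r' : Plane → ℝ}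
    (hv : MemLp v 2 (volume.restrict (interior P))) (h : IsLapProj Ψ l P v r)
    (h' : IsLapProj Ψ l P v r') : r =ᵐ[volume.restrict (interior P)] r' := by
  have hd : r - r' ∈ extLap Ψ l (interior P) := sub_mem h.mem h'.mem
  have hdL := hc.memLp_of_mem_extLap hd
  have hz : ∫ x in interior P, ‖(r - r') x‖ ^ 2 = 0 := by
    have e : ∫ x in interior P, ‖(r - r') x‖ ^ 2 = ∫ x in interior P,
        ((v x - r' x) * (r - r') x - (v x - r x) * (r - r') x) := by
      refine integral_congr_ae (ae_of_all _ fun x => ?_)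
      simp only [Pi.sub_apply, Real.norm_eq_abs, sq_abs]
      ring
    rw [e, integral_sub (integrable_sub_mul hv (h'.memLp hc) hdL)
      (integrable_sub_mul hv (h.memLp hc) hdL), h.orthogonal _ hd, h'.orthogonal _ hd, sub_zero]
  filter_upwards [ae_eq_zero_of_integral_norm_sq hdL hz] with x hx
  exact sub_eq_zero.1 hx

theorem IsLapProj.add (hc : StarCell P x₀ ρ) {v w r s : Plane → ℝ}
    (hv : MemLp v 2 (volume.restrict (interior P)))
    (hw : MemLp w 2 (volume.restrict (interior P)))
    (h : IsLapProj Ψ l P v r) (h' : IsLapProj Ψ l P w s) :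
    IsLapProj Ψ l P (v + w) (r + s) := by
  refine ⟨add_mem h.mem h'.mem, fun t ht => ?_⟩
  have htL := hc.memLp_of_mem_extLap ht
  have e : ∫ x in interior P, ((v + w) x - (r + s) x) * t x =
      ∫ x in interior P, ((v x - r x) * t x + (w x - s x) * t x) :=
    integral_congr_ae (ae_of_all _ fun x => by simp only [Pi.add_apply]; ring)
  rw [e, integral_add (integrable_sub_mul hv (h.memLp hc) htL)
      (integrable_sub_mul hw (h'.memLp hc) htL), h.orthogonal _ ht, h'.orthogonal _ ht, add_zero]

theorem IsLapProj.smul {v r : Plane → ℝ} (c : ℝ) (h : IsLapProj Ψ l P v r) :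
    IsLapProj Ψ l P (c • v) (c • r) := by
  refine ⟨Submodule.smul_mem _ c h.mem, fun t ht => ?_⟩
  have e : ∫ x in interior P, ((c • v) x - (c • r) x) * t x =
      ∫ x in interior P, c * ((v x - r x) * t x) :=
    integral_congr_ae (ae_of_all _ fun x => by simp only [Pi.smul_apply, smul_eq_mul]; ring)
  rw [e, integral_const_mul, h.orthogonal _ ht, mul_zero]

theorem IsLapProj.congr {v w r : Plane → ℝ} (h : IsLapProj Ψ l P v r)
    (hvw : v =ᵐ[volume.restrict (interior P)] w) : IsLapProj Ψ l P w r := by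
  refine ⟨h.mem, fun t ht => ?_⟩
  rw [← h.orthogonal t ht]
  exact integral_congr_ae (hvw.mono fun x hx => by simp only [hx])

end LapProj

section EllProj

variable {Ω : Set Plane} {𝒯 : PolygonalMesh Ω} {Ψ : Submodule ℝ (Plane → ℝ)}
  {P : Set Plane} {x₀ : Plane} {ρ : ℝ} {Es : Finset (Plane × Plane)} {k : ℕ}

theorem memH1_of_mem_extPoly (hΨ : IsEnrichment 𝒯 Ψ) (hP : P ∈ 𝒯.cells)
    (hc : StarCell P x₀ ρ) {q : Plane → ℝ} (hq : q ∈ extPoly Ψ k) : MemH1 (interior P) q :=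
  (hΨ.exists_laplacian hP hc hq).choose_spec.2.memH1

theorem IsEllProj.add (hΨ : IsEnrichment 𝒯 Ψ) (hP : P ∈ 𝒯.cells) (hc : StarCell P x₀ ρ)
    {v w q p : Plane → ℝ} (hv : MemH1 (interior P) v) (hw : MemH1 (interior P) w)
    (h : IsEllProj Ψ k P v q) (h' : IsEllProj Ψ k P w p) :
    IsEllProj Ψ k P (v + w) (q + p) := by
  have hU : IsOpen (interior P) := isOpen_interior
  have hfin := hc.isFiniteMeasure
  have key : ∀ {a b t : Plane → ℝ}, MemH1 (interior P) a → MemH1 (interior P) b →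
      MemH1 (interior P) t →
      ∫ x in interior P, inner ℝ (weakGrad (interior P) (a + b) x) (weakGrad (interior P) t x) =
      (∫ x in interior P, inner ℝ (weakGrad (interior P) a x) (weakGrad (interior P) t x)) +
      ∫ x in interior P, inner ℝ (weakGrad (interior P) b x) (weakGrad (interior P) t x) := by
    intro a b t ha hb ht
    have ht' := (hasWeakGrad_weakGrad ht).memLp_grad
    rw [← integral_add (memLp_integrable_inner (hasWeakGrad_weakGrad ha).memLp_grad ht')
      (memLp_integrable_inner (hasWeakGrad_weakGrad hb).memLp_grad ht')]
    refine integral_congr_ae ?_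
    filter_upwards [weakGrad_add hU ha hb] with x hx
    rw [hx, Pi.add_apply, inner_add_left]
  have hq := memH1_of_mem_extPoly hΨ hP hc h.mem
  have hp := memH1_of_mem_extPoly hΨ hP hc h'.mem
  have hint : ∀ {a : Plane → ℝ}, MemH1 (interior P) a →
      Integrable a (volume.restrict (interior P)) := fun ha =>
    (hasWeakGrad_weakGrad ha).memLp.integrable (by norm_num)
  refine ⟨add_mem h.mem h'.mem, fun t ht => ?_, ?_⟩
  · have ht' := memH1_of_mem_extPoly hΨ hP hc ht
    rw [key hq hp ht', key hv hw ht', h.grad_eq t ht, h'.grad_eq t ht]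
  · simp only [Pi.add_apply]
    rw [integral_add (hint hq) (hint hp), integral_add (hint hv) (hint hw), h.mean_eq, h'.mean_eq]

theorem IsEllProj.smul (hΨ : IsEnrichment 𝒯 Ψ) (hP : P ∈ 𝒯.cells) (hc : StarCell P x₀ ρ)
    {v q : Plane → ℝ} (c : ℝ) (hv : MemH1 (interior P) v)
    (h : IsEllProj Ψ k P v q) : IsEllProj Ψ k P (c • v) (c • q) := by
  have hU : IsOpen (interior P) := isOpen_interior
  have key : ∀ {a : Plane → ℝ} (t : Plane → ℝ), MemH1 (interior P) a →
      ∫ x in interior P, inner ℝ (weakGrad (interior P) (c • a) x) (weakGrad (interior P) t x) =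
      c * ∫ x in interior P, inner ℝ (weakGrad (interior P) a x)
        (weakGrad (interior P) t x) := by
    intro a t ha
    rw [← integral_const_mul]
    refine integral_congr_ae ?_
    filter_upwards [weakGrad_smul hU c ha] with x hx
    rw [hx, Pi.smul_apply, real_inner_smul_left]
  refine ⟨Submodule.smul_mem _ c h.mem, fun t ht => ?_, ?_⟩
  · rw [key t (memH1_of_mem_extPoly hΨ hP hc h.mem), key t hv, h.grad_eq t ht]
  · simp only [Pi.smul_apply, smul_eq_mul]
    rw [integral_const_mul, integral_const_mul, h.mean_eq]

theorem IsEllProj.congr {v w q : Plane → ℝ} (hv : MemH1 (interior P) v)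
    (h : IsEllProj Ψ k P v q) (hvw : v =ᵐ[volume.restrict (interior P)] w) :
    IsEllProj Ψ k P w q := by
  have hg := (((hasWeakGrad_weakGrad hv).congr hvw).weakGrad_ae isOpen_interior)
  refine ⟨h.mem, fun t ht => ?_, ?_⟩
  · rw [h.grad_eq t ht]
    refine integral_congr_ae ?_
    filter_upwards [hg] with x hx
    rw [hx]
  · rw [h.mean_eq]
    exact integral_congr_ae hvw

theorem isEllProj_self {q : Plane → ℝ} (hq : q ∈ extPoly Ψ k) : IsEllProj Ψ k P q q :=
  ⟨hq, fun _ _ => rfl, rfl⟩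

theorem isEllProj_ellProj (hΨ : IsEnrichment 𝒯 Ψ) [FiniteDimensional ℝ Ψ] (hP : P ∈ 𝒯.cells)
    (hc : PolyCell P x₀ ρ Es) {v : Plane → ℝ} (hv : MemH1 (interior P) v) :
    IsEllProj Ψ k P v (ellProj Ψ k P v) :=
  Classical.epsilon_spec (exists_isEllProj hΨ hP hc hv)

theorem isLapProj_lapProj (hΨ : IsEnrichment 𝒯 Ψ) [FiniteDimensional ℝ Ψ] (hP : P ∈ 𝒯.cells)
    (hc : StarCell P x₀ ρ) {v : Plane → ℝ} {l : ℕ}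
    (hv : MemLp v 2 (volume.restrict (interior P))) : IsLapProj Ψ l P v (lapProj Ψ l P v) :=
  Classical.epsilon_spec (exists_isLapProj hΨ hP hc hv)

theorem hasTrace_trace {v : Plane → ℝ} (hv : v ∈ localSpace 𝒯 Ψ k P) :
    HasTrace (interior P) v (trace (interior P) v) :=
  Classical.epsilon_spec ⟨_, hv.2.choose_spec.1⟩

end EllProj

end XVEM

/-! ### The local seminorm as the norm of a linear map, and its kernel. -/

namespace XVEM

open scoped ENNReal NNReal

section Local

variable {Ω : Set Plane} {𝒯 : PolygonalMesh Ω} {Ψ : Submodule ℝ (Plane → ℝ)}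
  {P : Set Plane} {x₀ : Plane} {ρ : ℝ} {Es : Finset (Plane × Plane)} {k : ℕ}

theorem HasTrace.congr_trace {U : Set Plane} {v g g' : Plane → ℝ} (h : HasTrace U v g)
    (hg : g =ᵐ[bdryMeasure U] g') : HasTrace U v g' := by
  obtain ⟨G, hG, hgL, φ, hφ, a1, a2, a3⟩ := h
  refine ⟨G, hG, hgL.ae_eq hg, φ, hφ, a1, a2, a3.congr fun n => eLpNorm_congr_ae ?_⟩
  exact hg.mono fun x hx => by simp only [Pi.sub_apply, hx]

theorem HasTrace.memLp {U : Set Plane} {v g : Plane → ℝ} (h : HasTrace U v g) :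
    MemLp g 2 (bdryMeasure U) := h.choose_spec.2.1

theorem ae_eq_of_eqOn_cell {v w : Plane → ℝ} (h : EqOn v w P) :
    v =ᵐ[volume.restrict (interior P)] w := by
  filter_upwards [ae_restrict_mem isOpen_interior.measurableSet] with x hx
  exact h (interior_subset hx)

theorem IsLpGraph.toLp_congr {V F : Type*} [AddCommGroup V] [Module ℝ V] [NormedAddCommGroup F]
    [NormedSpace ℝ F] {μ : Measure Plane} {R : V → (Plane → F) → Prop} (h : IsLpGraph μ R)
    {u v : V} (huv : ∀ g, R u g → R v g) : h.toLp u = h.toLp v := by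
  obtain ⟨g, hg⟩ := h.exists_rel u
  rw [h.toLp_eq hg, h.toLp_eq (huv g hg)]

theorem memLp_of_mem_localSpace {v : Plane → ℝ} (hv : v ∈ localSpace 𝒯 Ψ k P) :
    MemLp v 2 (volume.restrict (interior P)) :=
  (hasWeakGrad_weakGrad (memH1_of_mem_localSpace hv)).memLp

variable [FiniteDimensional ℝ Ψ]

theorem isLpGraph_ellProj (hΨ : IsEnrichment 𝒯 Ψ) (hP : P ∈ 𝒯.cells) (hc : PolyCell P x₀ ρ Es)
    (k : ℕ) : IsLpGraph (volume.restrict (interior P))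
      fun (v : localSpace 𝒯 Ψ k P) (G : Plane → Plane) =>
        ∃ q, IsEllProj Ψ k P v q ∧ HasWeakGrad (interior P) q G where
  exists_rel v := by
    obtain ⟨q, hq⟩ := exists_isEllProj hΨ hP hc (memH1_of_mem_localSpace v.2)
    exact ⟨_, q, hq, hasWeakGrad_weakGrad (memH1_of_mem_extPoly hΨ hP hc.toStarCell hq.mem)⟩
  memLp := by
    rintro v g ⟨q, -, hq⟩
    exact hq.memLp_grad
  unique := by
    rintro v g g' ⟨q, hq, hg⟩ ⟨q', hq', hg'⟩
    exact (hg.congr (ae_eq_of_eqOn_cell (hq.eqOn hΨ hP hc hq'))).unique isOpen_interior hg'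
  add := by
    rintro v w g h ⟨q, hq, hg⟩ ⟨p, hp, hh⟩
    exact ⟨q + p, hq.add hΨ hP hc.toStarCell (memH1_of_mem_localSpace v.2)
      (memH1_of_mem_localSpace w.2) hp, hg.add hh⟩
  smul := by
    rintro c v g ⟨q, hq, hg⟩
    exact ⟨c • q, hq.smul hΨ hP hc.toStarCell c (memH1_of_mem_localSpace v.2), hg.smul c⟩

theorem isLpGraph_lapProj (hΨ : IsEnrichment 𝒯 Ψ) (hP : P ∈ 𝒯.cells) (hc : PolyCell P x₀ ρ Es)
    (k : ℕ) : IsLpGraph (volume.restrict (interior P))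
      fun (v : localSpace 𝒯 Ψ k P) (r : Plane → ℝ) =>
        ∃ q, IsEllProj Ψ k P v q ∧ IsLapProj Ψ (k - 2) P (v - q) r := by
  have hL : ∀ {v : localSpace 𝒯 Ψ k P} {q : Plane → ℝ}, IsEllProj Ψ k P v q →
      MemLp ((v : Plane → ℝ) - q) 2 (volume.restrict (interior P)) := fun {v q} hq =>
    memLp_of_mem_localSpace (sub_mem v.2 (hΨ.mem_localSpace hP hc hq.mem))
  refine ⟨fun v => ?_, ?_, ?_, ?_, ?_⟩
  · obtain ⟨q, hq⟩ := exists_isEllProj hΨ hP hc (memH1_of_mem_localSpace v.2)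
    obtain ⟨r, hr⟩ := exists_isLapProj (l := k - 2) hΨ hP hc.toStarCell (hL hq)
    exact ⟨r, q, hq, hr⟩
  · rintro v g ⟨q, -, hr⟩
    exact hr.memLp hc.toStarCell
  · rintro v r r' ⟨q, hq, hr⟩ ⟨q', hq', hr'⟩
    refine (hr.congr ?_).unique hc.toStarCell (hL hq') hr'
    filter_upwards [ae_eq_of_eqOn_cell (hq.eqOn hΨ hP hc hq')] with x hx
    simp only [Pi.sub_apply, hx]
  · rintro v w r s ⟨q, hq, hr⟩ ⟨p, hp, hs⟩
    refine ⟨q + p, hq.add hΨ hP hc.toStarCell (memH1_of_mem_localSpace v.2)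
      (memH1_of_mem_localSpace w.2) hp, ?_⟩
    rw [Submodule.coe_add, add_sub_add_comm]
    exact hr.add hc.toStarCell (hL hq) (hL hp) hs
  · rintro c v r ⟨q, hq, hr⟩
    refine ⟨c • q, hq.smul hΨ hP hc.toStarCell c (memH1_of_mem_localSpace v.2), ?_⟩
    rw [Submodule.coe_smul, ← smul_sub]
    exact hr.smul c

theorem isLpGraph_trace (hΨ : IsEnrichment 𝒯 Ψ) (hP : P ∈ 𝒯.cells) (hc : PolyCell P x₀ ρ Es)
    (k : ℕ) : IsLpGraph (bdryMeasure (interior P))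
      fun (v : localSpace 𝒯 Ψ k P) (g : Plane → ℝ) =>
        ∃ q, IsEllProj Ψ k P v q ∧ HasTrace (interior P) (v - q) g where
  exists_rel v := by
    obtain ⟨q, hq⟩ := exists_isEllProj hΨ hP hc (memH1_of_mem_localSpace v.2)
    exact ⟨_, q, hq, hasTrace_trace (sub_mem v.2 (hΨ.mem_localSpace hP hc hq.mem))⟩
  memLp := by
    rintro v g ⟨q, -, hg⟩
    exact hg.memLp
  unique := by
    rintro v g g' ⟨q, hq, hg⟩ ⟨q', hq', hg'⟩
    refine hc.hasTrace_unique (hg.congr ?_) hg'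
    filter_upwards [ae_eq_of_eqOn_cell (hq.eqOn hΨ hP hc hq')] with x hx
    simp only [Pi.sub_apply, hx]
  add := by
    rintro v w g h ⟨q, hq, hg⟩ ⟨p, hp, hh⟩
    refine ⟨q + p, hq.add hΨ hP hc.toStarCell (memH1_of_mem_localSpace v.2)
      (memH1_of_mem_localSpace w.2) hp, ?_⟩
    rw [Submodule.coe_add, add_sub_add_comm]
    exact hg.add hh
  smul := by
    rintro c v g ⟨q, hq, hg⟩
    refine ⟨c • q, hq.smul hΨ hP hc.toStarCell c (memH1_of_mem_localSpace v.2), ?_⟩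
    rw [Submodule.coe_smul, ← smul_sub]
    exact hg.smul c

/-- The gradient of the elliptic projection, the projection of the remainder and the trace of the
remainder, scaled so as to give the local discrete seminorm. -/
noncomputable def localMap (hΨ : IsEnrichment 𝒯 Ψ) (hP : P ∈ 𝒯.cells) (hc : PolyCell P x₀ ρ Es)
    (k : ℕ) : localSpace 𝒯 Ψ k P →ₗ[ℝ]
      WithLp 2 (Lp Plane 2 (volume.restrict (interior P) : Measure Plane) ×
        WithLp 2 (Lp ℝ 2 (volume.restrict (interior P) : Measure Plane) ×
          Lp ℝ 2 (bdryMeasure (interior P)))) :=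
  (WithLp.linearEquiv 2 ℝ _).symm.toLinearMap ∘ₗ (isLpGraph_ellProj hΨ hP hc k).toLp.prod
    ((WithLp.linearEquiv 2 ℝ _).symm.toLinearMap ∘ₗ
      ((Metric.diam P)⁻¹ • (isLpGraph_lapProj hΨ hP hc k).toLp).prod
        (√(Metric.diam P)⁻¹ • (isLpGraph_trace hΨ hP hc k).toLp))

theorem localMap_apply (hΨ : IsEnrichment 𝒯 Ψ) (hP : P ∈ 𝒯.cells) (hc : PolyCell P x₀ ρ Es)
    (v : localSpace 𝒯 Ψ k P) : localMap hΨ hP hc k v =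
      WithLp.toLp 2 ((isLpGraph_ellProj hΨ hP hc k).toLp v,
        WithLp.toLp 2 ((Metric.diam P)⁻¹ • (isLpGraph_lapProj hΨ hP hc k).toLp v,
          √(Metric.diam P)⁻¹ • (isLpGraph_trace hΨ hP hc k).toLp v)) := rfl

theorem norm_localMap_sq (hΨ : IsEnrichment 𝒯 Ψ) (hP : P ∈ 𝒯.cells) (hc : PolyCell P x₀ ρ Es)
    (v : localSpace 𝒯 Ψ k P) : ‖localMap hΨ hP hc k v‖ ^ 2 = localNormSq Ψ k P v := by
  have hq := isEllProj_ellProj (k := k) hΨ hP hc (memH1_of_mem_localSpace v.2)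
  have hd := sub_mem v.2 (hΨ.mem_localSpace hP hc hq.mem)
  rw [localMap_apply, WithLp.prod_norm_sq_eq_of_L2, WithLp.prod_norm_sq_eq_of_L2]
  change ‖(isLpGraph_ellProj hΨ hP hc k).toLp v‖ ^ 2 +
    (‖(Metric.diam P)⁻¹ • (isLpGraph_lapProj hΨ hP hc k).toLp v‖ ^ 2 +
      ‖√(Metric.diam P)⁻¹ • (isLpGraph_trace hΨ hP hc k).toLp v‖ ^ 2) = _
  rw [norm_smul, norm_smul, mul_pow, mul_pow,
    (isLpGraph_ellProj hΨ hP hc k).norm_toLp_sq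
      ⟨_, hq, hasWeakGrad_weakGrad (memH1_of_mem_extPoly hΨ hP hc.toStarCell hq.mem)⟩,
    (isLpGraph_lapProj hΨ hP hc k).norm_toLp_sq
      ⟨_, hq, isLapProj_lapProj hΨ hP hc.toStarCell (memLp_of_mem_localSpace hd)⟩,
    (isLpGraph_trace hΨ hP hc k).norm_toLp_sq ⟨_, hq, hasTrace_trace hd⟩]
  have hs : √(Metric.diam P)⁻¹ ^ 2 = (Metric.diam P)⁻¹ :=
    Real.sq_sqrt (inv_nonneg.2 Metric.diam_nonneg)
  simp only [Real.norm_eq_abs, sq_abs, localNormSq, penalty, inv_pow, hs]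

/-- Members of the global space are classes in `L²`, whose chosen representatives add only almost
everywhere; the local map must ignore this to descend to a linear map. -/
theorem localMap_congr (hΨ : IsEnrichment 𝒯 Ψ) (hP : P ∈ 𝒯.cells) (hc : PolyCell P x₀ ρ Es)
    {u v : localSpace 𝒯 Ψ k P}
    (h : (u : Plane → ℝ) =ᵐ[volume.restrict (interior P)] (v : Plane → ℝ)) :
    localMap hΨ hP hc k u = localMap hΨ hP hc k v := by
  have hu := memH1_of_mem_localSpace u.2
  have h' : ∀ q : Plane → ℝ,
      (u : Plane → ℝ) - q =ᵐ[volume.restrict (interior P)] (v : Plane → ℝ) - q := fun q =>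
    h.mono fun x hx => by simp only [Pi.sub_apply, hx]
  have e1 : (isLpGraph_ellProj hΨ hP hc k).toLp u = (isLpGraph_ellProj hΨ hP hc k).toLp v :=
    IsLpGraph.toLp_congr _ fun g ⟨q, hq, hg⟩ => ⟨q, hq.congr hu h, hg⟩
  have e2 : (isLpGraph_lapProj hΨ hP hc k).toLp u = (isLpGraph_lapProj hΨ hP hc k).toLp v :=
    IsLpGraph.toLp_congr _ fun g ⟨q, hq, hg⟩ => ⟨q, hq.congr hu h, hg.congr (h' q)⟩
  have e3 : (isLpGraph_trace hΨ hP hc k).toLp u = (isLpGraph_trace hΨ hP hc k).toLp v :=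
    IsLpGraph.toLp_congr _ fun g ⟨q, hq, hg⟩ => ⟨q, hq.congr hu h, hg.congr (h' q)⟩
  rw [localMap_apply, localMap_apply, e1, e2, e3]

/-- By Green's formula, a function whose trace vanishes and which is orthogonal to its own
Laplacian has zero gradient, up to the addition of a function of zero gradient. -/
theorem PolyCell.hasWeakGrad_zero (hc : PolyCell P x₀ ρ Es) {v q r : Plane → ℝ}
    (hv : HasWeakLaplacian (interior P) v r) (hq : HasWeakGrad (interior P) q 0)
    (ht : HasTrace (interior P) (v - q) 0) (hr : ∫ x in interior P, r x * (v - q) x = 0) :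
    HasWeakGrad (interior P) v 0 := by
  obtain ⟨G, hG⟩ := hv.memH1
  have hd : HasWeakGrad (interior P) (v - q) G := by
    have := hG.add (hq.smul (-1))
    rwa [neg_one_smul, smul_zero, add_zero, ← sub_eq_add_neg] at this
  have h := hc.green hd ht hG.memLp_grad hv.memLp (hv.integral_eq isOpen_interior hG)
  rw [hr, neg_zero] at h
  simp only [real_inner_self_eq_norm_sq] at h
  exact hG.congr_grad (ae_eq_zero_of_integral_norm_sq hG.memLp_grad h)

/-- Each of the three nonnegative contributions vanishes: the projection q has zero gradient, v - q
has zero trace, and v - q is orthogonal to ℙ_l + ΔΨ, hence to Δv. These are the hypotheses of the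
Green argument. -/
theorem hasWeakGrad_zero_of_localNormSq (hΨ : IsEnrichment 𝒯 Ψ) (hP : P ∈ 𝒯.cells)
    (hc : PolyCell P x₀ ρ Es) {v : Plane → ℝ} (hv : v ∈ localSpace 𝒯 Ψ k P)
    (h : localNormSq Ψ k P v = 0) : HasWeakGrad (interior P) v 0 := by
  obtain ⟨r, hr, hvr⟩ := hv.1
  have hq := isEllProj_ellProj (k := k) hΨ hP hc (memH1_of_mem_localSpace hv)
  have hd := sub_mem hv (hΨ.mem_localSpace hP hc hq.mem)
  set q := ellProj Ψ k P v with hqd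
  have hg := hasWeakGrad_weakGrad (memH1_of_mem_extPoly hΨ hP hc.toStarCell hq.mem)
  have hl := isLapProj_lapProj (l := k - 2) hΨ hP hc.toStarCell (memLp_of_mem_localSpace hd)
  have htr := hasTrace_trace hd
  have hdiam : 0 < Metric.diam P := by
    exact Metric.diam_pos (infinite_of_mem_nhds x₀
      (mem_interior_iff_mem_nhds.1 hc.center_mem_interior)).nontrivial hc.isCompact.isBounded
  have n1 : 0 ≤ ∫ x in interior P, ‖weakGrad (interior P) q x‖ ^ 2 :=
    integral_nonneg fun x => by positivity
  have n2 : 0 ≤ ∫ x in interior P, lapProj Ψ (k - 2) P (v - q) x ^ 2 :=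
    integral_nonneg fun x => by positivity
  have n3 : 0 ≤ ∫ x, trace (interior P) (v - q) x ^ 2 ∂(bdryMeasure (interior P)) :=
    integral_nonneg fun x => by positivity
  have m2 : 0 ≤ (Metric.diam P ^ 2)⁻¹ * ∫ x in interior P, lapProj Ψ (k - 2) P (v - q) x ^ 2 := by
    positivity
  have m3 : 0 ≤ (Metric.diam P)⁻¹ *
      ∫ x, trace (interior P) (v - q) x ^ 2 ∂(bdryMeasure (interior P)) := by positivity
  rw [localNormSq, penalty, ← hqd] at h
  have z1 : ∫ x in interior P, ‖weakGrad (interior P) q x‖ ^ 2 = 0 := by linarith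
  have z2 : ∫ x in interior P, ‖lapProj Ψ (k - 2) P (v - q) x‖ ^ 2 = 0 := by
    have : (Metric.diam P ^ 2)⁻¹ * ∫ x in interior P, lapProj Ψ (k - 2) P (v - q) x ^ 2 = 0 := by
      linarith
    simpa [hdiam.ne'] using this
  have z3 : ∫ x, ‖trace (interior P) (v - q) x‖ ^ 2 ∂(bdryMeasure (interior P)) = 0 := by
    have : (Metric.diam P)⁻¹ *
        ∫ x, trace (interior P) (v - q) x ^ 2 ∂(bdryMeasure (interior P)) = 0 := by
      linarith
    simpa [hdiam.ne'] using this
  have y1 := ae_eq_zero_of_integral_norm_sq hg.memLp_grad z1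
  have y2 := ae_eq_zero_of_integral_norm_sq (hl.memLp hc.toStarCell) z2
  have y3 := ae_eq_zero_of_integral_norm_sq htr.memLp z3
  refine hc.hasWeakGrad_zero hvr (hg.congr_grad y1) (htr.congr_trace y3) ?_
  -- The Laplacian r belongs to the space projected on, so its pairing with v - q is its pairing
  -- with the projection of v - q, which is zero.
  rw [← hl.orthogonal r hr]
  refine integral_congr_ae ?_
  filter_upwards [y2] with x hx
  rw [hx, Pi.zero_apply, sub_zero, mul_comm]

end Local

end XVEM

/-! ### From zero gradient on the elements to zero on the domain. -/

namespace XVEM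

open scoped ENNReal NNReal

variable {Ω : Set Plane} {𝒯 : PolygonalMesh Ω} {P : Set Plane} {x₀ : Plane} {ρ : ℝ}
  {Es : Finset (Plane × Plane)}

theorem volume_seg (e : Plane × Plane) : volume (seg e) = 0 := by
  refine measure_mono_null (affineSegment_eq_segment ℝ e.1 e.2 ▸ affineSegment_subset_affineSpan ℝ e.1 e.2)
    (Measure.addHaar_affineSubspace volume _ fun h => ?_)
  have h1 := collinear_iff_finrank_le_one.1 (collinear_pair ℝ e.1 e.2)
  rw [← direction_affineSpan, h, AffineSubspace.direction_top, finrank_top] at h1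
  simp at h1

theorem volume_biUnion_seg (s : Finset (Plane × Plane)) : volume (⋃ e ∈ s, seg e) = 0 :=
  (measure_biUnion_null_iff s.countable_toSet).2 fun e _ => volume_seg e

/-- The elements cover Ω and their frontiers consist of finitely many segments, which are null sets
for the area. -/
theorem PolygonalMesh.ae_of_cells {p : Plane → Prop}
    (h : ∀ P ∈ 𝒯.cells, ∀ᵐ x ∂volume.restrict (interior P), p x) :
    ∀ᵐ x ∂volume.restrict Ω, p x := by
  refine ae_mono ?_ ((ae_restrict_biUnion_finset_iff interior 𝒯.cells p).2 h)
  refine Measure.restrict_mono_ae ?_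
  have hz : ∀ᵐ x, x ∉ ⋃ e ∈ 𝒯.edges, seg e :=
    measure_eq_zero_iff_ae_notMem.1 (volume_biUnion_seg 𝒯.edges)
  filter_upwards [hz] with x hx hxΩ
  obtain ⟨P, hP, hxP⟩ : ∃ P ∈ 𝒯.cells, x ∈ P := by
    simpa [𝒯.closure_eq] using subset_closure hxΩ
  refine mem_biUnion (x := P) hP ?_
  by_contra hxi
  have hfr : x ∈ frontier P := ⟨subset_closure hxP, hxi⟩
  rw [𝒯.frontier_eq P hP] at hfr
  obtain ⟨e, he, hxe⟩ := mem_iUnion₂.1 hfr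
  exact hx (mem_biUnion (Finset.mem_coe.2 (by simpa using he.1)) hxe)

/-- Let φₙ be the sequence that defines the zero trace on ∂Ω. On the element φₙ - c tends to zero in
`H¹`, so by the trace inequality φₙ tends to c on the edge; but φₙ also tends to 0 there, and the
edge has positive length. -/
theorem PolyCell.eq_zero_of_ae_eq_const (hc : PolyCell P x₀ ρ Es) (hsub : interior P ⊆ Ω)
    {e : Plane × Plane} (he : e ∈ Es) (heΩ : seg e ⊆ frontier Ω) {v : Plane → ℝ}
    (hΩ : IsOpen Ω) (hv : HasTrace Ω v 0) (hg : HasWeakGrad Ω v 0) {c : ℝ}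
    (hvc : v =ᵐ[volume.restrict (interior P)] fun _ => c) : c = 0 := by
  obtain ⟨G, hG, -, φ, hφ, a1, a2, a3⟩ := hv
  have hG0 := hG.unique hΩ hg
  have hle : (volume.restrict (interior P) : Measure Plane) ≤ volume.restrict Ω :=
    Measure.restrict_mono hsub le_rfl
  have hseg : (μH[1] : Measure Plane).restrict (seg e) ≤ bdryMeasure Ω :=
    Measure.restrict_mono heΩ le_rfl
  have t1 : Tendsto (fun n => eLpNorm (fun x => φ n x + -c) 2 (volume.restrict (interior P)))
      atTop (𝓝 0) := by
    refine tendsto_of_tendsto_of_tendsto_of_le_of_le tendsto_const_nhds a1 (fun n => zero_le)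
      fun n => ?_
    refine le_trans (eLpNorm_congr_ae ?_).le (eLpNorm_mono_measure _ hle)
    filter_upwards [hvc] with x hx
    rw [Pi.sub_apply, hx, sub_eq_add_neg]
  have t2 : Tendsto (fun n => eLpNorm (gradient (fun x => φ n x + -c)) 2
      (volume.restrict (interior P))) atTop (𝓝 0) := by
    refine tendsto_of_tendsto_of_tendsto_of_le_of_le tendsto_const_nhds a2 (fun n => zero_le)
      fun n => ?_
    rw [gradient_const_add]
    refine (eLpNorm_mono_measure _ hle).trans (eLpNorm_congr_ae ?_).le
    filter_upwards [hG0] with x hx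
    rw [Pi.sub_apply, hx, Pi.zero_apply, sub_zero]
  have t3 := hc.tendsto_eLpNorm_seg he (fun n => (hφ n).add contDiff_const) t1 t2
  have t4 : Tendsto (fun n => eLpNorm (φ n) 2 (μH[1].restrict (seg e))) atTop (𝓝 0) := by
    refine tendsto_of_tendsto_of_tendsto_of_le_of_le tendsto_const_nhds a3 (fun n => zero_le)
      fun n => ?_
    rw [sub_zero]
    exact eLpNorm_mono_measure _ hseg
  have t5 := t4.add t3
  rw [add_zero] at t5
  have hle : eLpNorm (fun _ : Plane => c) 2 (μH[1].restrict (seg e)) ≤ 0 := by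
    refine ge_of_tendsto' t5 fun n => ?_
    have h1 : (fun _ : Plane => c) = φ n - fun x => φ n x + -c := by
      funext x
      simp
    rw [h1]
    exact eLpNorm_sub_le (hφ n).continuous.aestronglyMeasurable
      ((hφ n).continuous.add continuous_const).aestronglyMeasurable (by norm_num)
  by_contra hc0
  have hne : (μH[1] : Measure Plane).restrict (seg e) ≠ 0 := by
    rw [Ne, Measure.restrict_eq_zero, hausdorffMeasure_segment, edist_eq_zero]
    exact hc.edge_ne e he
  rw [nonpos_iff_eq_zero, eLpNorm_const c (by norm_num) hne] at hle
  have h0 : (μH[1] : Measure Plane).restrict (seg e) univ ≠ 0 := by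
    rwa [Ne, Measure.measure_univ_eq_zero]
  have htop : (μH[1] : Measure Plane).restrict (seg e) univ ≠ ⊤ := by
    rw [Measure.restrict_apply_univ, hausdorffMeasure_segment]
    exact edist_ne_top _ _
  rw [mul_eq_zero] at hle
  rcases hle with hle | hle
  · exact hc0 (by simpa using hle)
  · exact (ENNReal.rpow_pos (pos_iff_ne_zero.2 h0) htop).ne' hle

/-- A bounded open subset of the plane with finite frontier is empty. -/
theorem eq_empty_of_finite_frontier {W : Set Plane} (hW : IsOpen W)
    (hb : Bornology.IsBounded W) {F : Set Plane} (hF : F.Finite) (hfr : frontier W ⊆ F) :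
    W = ∅ := by
  by_contra hne
  obtain ⟨z, hz⟩ := nonempty_iff_ne_empty.2 hne
  have hconn : IsPreconnected Fᶜ :=
    (hF.countable.isConnected_compl_of_one_lt_rank
      (by rw [← Module.finrank_eq_rank]; simp)).isPreconnected
  have hinf : W.Infinite := infinite_of_mem_nhds z (hW.mem_nhds hz)
  obtain ⟨y, hyW, hyF⟩ := hinf.exists_notMem_finite hF
  -- Off F there are no frontier points of W, so the complement of F is covered by the disjoint open
  -- sets W and the complement of its closure. It is connected and meets W, hence lies in W, and the
  -- plane would be bounded.
  have hsub : Fᶜ ⊆ W := by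
    refine hconn.subset_left_of_subset_union hW (isClosed_closure (s := W)).isOpen_compl
      (disjoint_compl_right.mono_left subset_closure) (fun x hx => ?_) ⟨y, hyF, hyW⟩
    by_contra h
    rw [mem_union, not_or, notMem_compl_iff] at h
    exact hx (hfr ⟨h.2, fun hi => h.1 (interior_subset hi)⟩)
  have hu : Bornology.IsBounded (univ : Set Plane) := by
    rw [← union_compl_self F]
    exact hF.isBounded.union (hb.subset hsub)
  exact NoncompactSpace.noncompact_univ (X := Plane)
    ((Metric.isBounded_iff_subset_closedBall 0).1 hu |>.elim fun r hr =>
      (isCompact_closedBall 0 r).of_isClosed_subset isClosed_univ hr)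

/-- A function with zero trace on the boundary of the domain and zero gradient vanishes. -/
theorem ae_eq_zero_of_hasTrace_zero (hΩ : IsPolygonalDomain Ω) {ϱ : ℝ} (hϱ : 0 < ϱ)
    (h𝒯 : 𝒯.IsRegular ϱ) {v : Plane → ℝ} (hv : HasTrace Ω v 0)
    (hg : ∀ P ∈ 𝒯.cells, HasWeakGrad (interior P) v 0) : v =ᵐ[volume.restrict Ω] 0 := by
  -- A weak gradient on all of Ω is part of `HasTrace`; it vanishes almost everywhere because it
  -- does on each element. This excludes jumps of v across interior edges.
  have hgΩ : HasWeakGrad Ω v 0 := by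
    obtain ⟨G, hG, -⟩ := hv
    refine hG.congr_grad (𝒯.ae_of_cells fun P hP => ?_)
    exact (hG.mono hΩ.isOpen (𝒯.interior_subset P hP)).unique isOpen_interior (hg P hP)
  have hconst : ∀ P ∈ 𝒯.cells, ∃ c : ℝ, v =ᵐ[volume.restrict (interior P)] fun _ => c := by
    intro P hP
    obtain ⟨x₀, ρ, Es, hc, -⟩ := h𝒯.polyCell hϱ hP
    exact hc.ae_eq_const (hg P hP) ae_eq_rfl
  choose! c hcst using hconst
  -- W is the part of Ω outside the elements of constant zero. It is shown to be empty through its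
  -- frontier.
  set W : Set Plane := Ω \ ⋃ P ∈ {P | P ∈ 𝒯.cells ∧ c P = 0}, P with hWd
  have hfin : {P | P ∈ 𝒯.cells ∧ c P = 0}.Finite := 𝒯.cells.finite_toSet.subset fun P hP => hP.1
  have hWo : IsOpen W := hΩ.isOpen.sdiff
    (hfin.isClosed_biUnion fun P hP => (𝒯.isCompact P hP.1).isClosed)
  have hWc : closure W ⊆ ⋃ P ∈ {P | P ∈ 𝒯.cells ∧ c P ≠ 0}, P := by
    have hfin' : {P | P ∈ 𝒯.cells ∧ c P ≠ 0}.Finite :=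
      𝒯.cells.finite_toSet.subset fun P hP => hP.1
    refine closure_minimal (fun x hx => ?_)
      (hfin'.isClosed_biUnion fun P hP => (𝒯.isCompact P hP.1).isClosed)
    obtain ⟨P, hP, hxP⟩ : ∃ P ∈ 𝒯.cells, x ∈ P := by
      simpa [𝒯.closure_eq] using subset_closure hx.1
    exact mem_biUnion (x := P) ⟨hP, fun h0 => hx.2 (mem_biUnion (x := P) ⟨hP, h0⟩ hxP)⟩ hxP
  have hfr : frontier W ⊆ ⋃ e ∈ 𝒯.edges, {e.1, e.2} := by
    intro x hx
    obtain ⟨P, ⟨hP, hcP⟩, hxP⟩ := mem_iUnion₂.1 (hWc hx.1)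
    have hxW : x ∉ W := fun h => hx.2 (hWo.interior_eq.symm ▸ h)
    by_cases hxΩ : x ∈ Ω
    · exfalso
      -- At a point of Ω, v is constant on a disc d. Every element containing the point is the
      -- closure of its interior, so it meets the disc in positive measure and has the same
      -- constant. A frontier point of W would touch both kinds of elements.
      obtain ⟨r, hr, hrΩ⟩ := Metric.nhds_basis_closedBall.mem_iff.1 (hΩ.isOpen.mem_nhds hxΩ)
      have hball := starCell_closedBall x hr
      obtain ⟨d, hd⟩ := hball.ae_eq_const
        (hgΩ.mono hΩ.isOpen (interior_subset.trans hrΩ)) ae_eq_rfl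
      have hcd : ∀ Q ∈ 𝒯.cells, x ∈ Q → c Q = d := by
        intro Q hQ hxQ
        rw [← 𝒯.closure_interior Q hQ] at hxQ
        have hne := mem_closure_iff.1 hxQ _ isOpen_interior hball.center_mem_interior
        have h0 : volume.restrict (interior (Metric.closedBall x r) ∩ interior Q) ≠ 0 := by
          rw [Ne, Measure.restrict_eq_zero]
          exact ((isOpen_interior.inter isOpen_interior).measure_pos volume hne).ne'
        have := ae_neBot.2 h0
        obtain ⟨z, h1, h2⟩ := ((ae_restrict_of_ae_restrict_of_subset inter_subset_left hd).and
          (ae_restrict_of_ae_restrict_of_subset inter_subset_right (hcst Q hQ))).exists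
        exact h2.symm.trans h1
      refine hxW ⟨hxΩ, fun hxU => ?_⟩
      obtain ⟨Q, hQ, hxQ⟩ := mem_iUnion₂.1 hxU
      exact hcP (((hcd P hP hxP).trans (hcd Q hQ.1 hxQ).symm).trans hQ.2)
    -- At a point outside Ω, the element of nonzero constant has an edge through it. That edge
    -- cannot be on ∂Ω, so its open segment lies in Ω and the point must be an endpoint.
    · have hfrP : x ∈ frontier P :=
        ⟨subset_closure hxP, fun hi => hxΩ (𝒯.interior_subset P hP hi)⟩
      obtain ⟨x₀, ρ, Es, hc, hEs⟩ := h𝒯.polyCell hϱ hP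
      rw [hc.frontier_eq] at hfrP
      obtain ⟨e, he, hxe⟩ := mem_iUnion₂.1 hfrP
      have he' := ((hEs e).1 he).1
      rcases 𝒯.edge_bdry e he' with h | h
      · exact absurd (hc.eq_zero_of_ae_eq_const (𝒯.interior_subset P hP) he h hΩ.isOpen hv hgΩ
          (hcst P hP)) hcP
      · rw [seg, ← insert_endpoints_openSegment] at hxe
        rcases hxe with h1 | h1 | h1
        · exact mem_biUnion (Finset.mem_coe.2 he') (Or.inl h1)
        · exact mem_biUnion (Finset.mem_coe.2 he') (Or.inr h1)
        · exact absurd (h h1) hxΩ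
  have hWe : W = ∅ := eq_empty_of_finite_frontier hWo (hΩ.isBounded.subset sdiff_subset)
    (𝒯.edges.finite_toSet.biUnion fun e _ => by simp) hfr
  refine 𝒯.ae_of_cells fun P hP => ?_
  have hcP : c P = 0 := by
    by_contra hne
    obtain ⟨z, hz⟩ := 𝒯.interior_nonempty P hP
    have hzW : z ∈ W := by
      refine ⟨𝒯.interior_subset P hP hz, fun hzU => ?_⟩
      obtain ⟨Q, hQ, hzQ⟩ := mem_iUnion₂.1 hzU
      have hPQ : P ≠ Q := fun h => hne (h ▸ hQ.2)
      -- An open set disjoint from the interior of Q is disjoint from its closure, which is Q.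
      have hd := (𝒯.disjoint_interior P hP Q hQ.1 hPQ).closure_right isOpen_interior
      rw [𝒯.closure_interior Q hQ.1] at hd
      exact disjoint_left.1 hd hz hzQ
    rw [hWe] at hzW
    exact hzW
  have := hcst P hP
  rwa [hcP] at this

end XVEM

/-! ### The global discrete norm. -/

namespace XVEM

open scoped ENNReal NNReal

section Global

variable {Ω : Set Plane} {𝒯 : PolygonalMesh Ω} {Ψ : Submodule ℝ (Plane → ℝ)}
  {P : Set Plane} {x₀ : Plane} {ρ : ℝ} {Es : Finset (Plane × Plane)} {k : ℕ}

/-- The restriction of a function of the global space to an element. -/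
noncomputable def cellRestrict (hP : P ∈ 𝒯.cells) (v : globalSpaceZero 𝒯 Ψ k) : localSpace 𝒯 Ψ k P :=
  ⟨(v : L2 Ω), v.2.1.2 P hP⟩

theorem cellRestrict_add (hP : P ∈ 𝒯.cells) (u v : globalSpaceZero 𝒯 Ψ k) :
    (cellRestrict hP (u + v) : Plane → ℝ) =ᵐ[volume.restrict (interior P)]
      (cellRestrict hP u + cellRestrict hP v : localSpace 𝒯 Ψ k P) :=
  ae_cell 𝒯 hP (Lp.coeFn_add (u : L2 Ω) v)

theorem cellRestrict_smul (hP : P ∈ 𝒯.cells) (c : ℝ) (v : globalSpaceZero 𝒯 Ψ k) :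
    (cellRestrict hP (c • v) : Plane → ℝ) =ᵐ[volume.restrict (interior P)]
      (c • cellRestrict hP v : localSpace 𝒯 Ψ k P) :=
  ae_cell 𝒯 hP (Lp.coeFn_smul c (v : L2 Ω))

/-- The linear map on the global space induced by a linear map on a local space that does not
distinguish functions equal almost everywhere. -/
noncomputable def liftCell {E : Type*} [AddCommGroup E] [Module ℝ E] (hP : P ∈ 𝒯.cells)
    (T : localSpace 𝒯 Ψ k P →ₗ[ℝ] E)
    (hT : ∀ u v : localSpace 𝒯 Ψ k P,
      (u : Plane → ℝ) =ᵐ[volume.restrict (interior P)] (v : Plane → ℝ) → T u = T v) :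
    globalSpaceZero 𝒯 Ψ k →ₗ[ℝ] E where
  toFun v := T (cellRestrict hP v)
  map_add' u v := by rw [hT _ _ (cellRestrict_add hP u v), map_add]
  map_smul' c v := by rw [hT _ _ (cellRestrict_smul hP c v), map_smul, RingHom.id_apply]

theorem liftCell_apply {E : Type*} [AddCommGroup E] [Module ℝ E] (hP : P ∈ 𝒯.cells)
    (T : localSpace 𝒯 Ψ k P →ₗ[ℝ] E)
    (hT : ∀ u v : localSpace 𝒯 Ψ k P,
      (u : Plane → ℝ) =ᵐ[volume.restrict (interior P)] (v : Plane → ℝ) → T u = T v)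
    (v : globalSpaceZero 𝒯 Ψ k) : liftCell hP T hT v = T (cellRestrict hP v) := rfl

variable [FiniteDimensional ℝ Ψ] {X : 𝒯.cells → Plane} {r : 𝒯.cells → ℝ}
  {E : 𝒯.cells → Finset (Plane × Plane)}

/-- A linear map on the global space whose norm is the discrete norm. -/
noncomputable def discreteMap (hΨ : IsEnrichment 𝒯 Ψ)
    (hc : ∀ P : 𝒯.cells, PolyCell P.1 (X P) (r P) (E P)) (k : ℕ) :
    globalSpaceZero 𝒯 Ψ k →ₗ[ℝ] PiLp 2 fun P : 𝒯.cells =>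
      WithLp 2 (Lp Plane 2 (volume.restrict (interior P.1) : Measure Plane) ×
        WithLp 2 (Lp ℝ 2 (volume.restrict (interior P.1) : Measure Plane) ×
          Lp ℝ 2 (bdryMeasure (interior P.1)))) :=
  (WithLp.linearEquiv 2 ℝ _).symm.toLinearMap ∘ₗ LinearMap.pi fun P : 𝒯.cells =>
    liftCell P.2 (localMap hΨ P.2 (hc P) k) fun _ _ => localMap_congr hΨ P.2 (hc P)

theorem discreteMap_apply (hΨ : IsEnrichment 𝒯 Ψ)
    (hc : ∀ P : 𝒯.cells, PolyCell P.1 (X P) (r P) (E P)) (v : globalSpaceZero 𝒯 Ψ k)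
    (P : 𝒯.cells) : discreteMap hΨ hc k v P = localMap hΨ P.2 (hc P) k (cellRestrict P.2 v) := rfl

theorem norm_discreteMap (hΨ : IsEnrichment 𝒯 Ψ)
    (hc : ∀ P : 𝒯.cells, PolyCell P.1 (X P) (r P) (E P)) (v : globalSpaceZero 𝒯 Ψ k) :
    ‖discreteMap hΨ hc k v‖ = discreteNorm 𝒯 Ψ k (v : L2 Ω) := by
  rw [discreteNorm, PiLp.norm_eq_of_L2,
    ← Finset.sum_coe_sort 𝒯.cells fun P => localNormSq Ψ k P (v : L2 Ω)]
  simp only [discreteMap_apply, norm_localMap_sq]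
  rfl

theorem norm_discreteMap_sq (hΨ : IsEnrichment 𝒯 Ψ)
    (hc : ∀ P : 𝒯.cells, PolyCell P.1 (X P) (r P) (E P)) (v : globalSpaceZero 𝒯 Ψ k) :
    ‖discreteMap hΨ hc k v‖ ^ 2 = ∑ P : 𝒯.cells, localNormSq Ψ k P.1 (v : L2 Ω) := by
  rw [PiLp.norm_sq_eq_of_L2]
  simp only [discreteMap_apply, norm_localMap_sq]
  rfl

theorem discreteMap_injective (hΩ : IsPolygonalDomain Ω) {ϱ : ℝ} (hϱ : 0 < ϱ)
    (h𝒯 : 𝒯.IsRegular ϱ) (hΨ : IsEnrichment 𝒯 Ψ)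
    (hc : ∀ P : 𝒯.cells, PolyCell P.1 (X P) (r P) (E P)) :
    Function.Injective (discreteMap hΨ hc k) := by
  rw [injective_iff_map_eq_zero]
  intro v hv
  refine Subtype.ext (Lp.ext ?_)
  refine (ae_eq_zero_of_hasTrace_zero hΩ hϱ h𝒯 v.2.2 fun P hP => ?_).trans
    (Lp.coeFn_zero ℝ 2 (volume.restrict Ω)).symm
  refine hasWeakGrad_zero_of_localNormSq hΨ hP (hc ⟨P, hP⟩) (v.2.1.2 P hP) ?_
  have h := norm_localMap_sq (k := k) hΨ hP (hc ⟨P, hP⟩) (cellRestrict hP v)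
  rw [← discreteMap_apply hΨ hc v ⟨P, hP⟩, hv] at h
  rw [← show localNormSq Ψ k P (cellRestrict hP v) = localNormSq Ψ k P (v : L2 Ω) from rfl, ← h]
  simp

end Global

/-! ### Finite dimension of the space with zero boundary values. -/

section FiniteDimensional

variable {Ω : Set Plane} {𝒯 : PolygonalMesh Ω} {Ψ : Submodule ℝ (Plane → ℝ)}
  {P : Set Plane} {x₀ : Plane} {ρ : ℝ} {Es : Finset (Plane × Plane)} {k : ℕ}
  {e : Plane × Plane}

theorem isLpGraph_localLaplacian (𝒯 : PolygonalMesh Ω) (Ψ : Submodule ℝ (Plane → ℝ)) (k : ℕ)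
    (P : Set Plane) : IsLpGraph (volume.restrict (interior P))
      fun (v : localSpace 𝒯 Ψ k P) (s : Plane → ℝ) => HasWeakLaplacian (interior P) v s where
  exists_rel v := ⟨_, v.2.1.choose_spec.2⟩
  memLp _ _ h := h.memLp
  unique _ _ _ h h' := h.unique isOpen_interior h'
  add _ _ _ _ h h' := h.add h'
  smul c _ _ h := h.smul c

theorem PolyCell.isLpGraph_edgeTrace (hc : PolyCell P x₀ ρ Es) (he : e ∈ Es)
    (𝒯 : PolygonalMesh Ω) (Ψ : Submodule ℝ (Plane → ℝ)) (k : ℕ) :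
    IsLpGraph (μH[1].restrict (seg e))
      fun (v : localSpace 𝒯 Ψ k P) (g : Plane → ℝ) => HasTrace (interior P) v g where
  exists_rel v := ⟨_, hasTrace_trace v.2⟩
  memLp _ _ h := h.memLp.mono_measure (hc.restrict_seg_le he)
  unique _ _ _ h h' := ae_mono (hc.restrict_seg_le he) (hc.hasTrace_unique h h')
  add _ _ _ _ h h' := h.add h'
  smul c _ _ h := h.smul c

theorem isLpGraph_extPoly_edge (hΨ : IsEnrichment 𝒯 Ψ) (hP : P ∈ 𝒯.cells)
    (hc : PolyCell P x₀ ρ Es) (he : e ∈ Es) (k : ℕ) : IsLpGraph (μH[1].restrict (seg e))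
      fun (q : extPoly Ψ k) (g : Plane → ℝ) => g = q where
  exists_rel q := ⟨q, rfl⟩
  memLp q g hg := hg ▸ (hΨ.hasTrace_self hP hc q.2).memLp.mono_measure (hc.restrict_seg_le he)
  unique q g g' hg hg' := by rw [hg, hg']
  add := by rintro v w _ _ rfl rfl; rfl
  smul := by rintro c v _ rfl; rfl

theorem laplacian_mem_extLapLp (hΨ : IsEnrichment 𝒯 Ψ) (hP : P ∈ 𝒯.cells)
    (hc : StarCell P x₀ ρ) (v : localSpace 𝒯 Ψ k P) :
    (isLpGraph_localLaplacian 𝒯 Ψ k P).toLp v ∈ extLapLp hΨ hP hc (k - 2) := by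
  obtain ⟨s, hs, hv⟩ := v.2.1
  rw [(isLpGraph_localLaplacian 𝒯 Ψ k P).toLp_eq hv]
  exact toLp_mem_extLapLp hΨ hP hc hs

theorem edgeTrace_mem_range (hΨ : IsEnrichment 𝒯 Ψ) (hP : P ∈ 𝒯.cells)
    (hc : PolyCell P x₀ ρ Es) (he : e ∈ Es) (he' : e ∈ 𝒯.edges) (v : localSpace 𝒯 Ψ k P) :
    (hc.isLpGraph_edgeTrace he 𝒯 Ψ k).toLp v ∈
      LinearMap.range (isLpGraph_extPoly_edge hΨ hP hc he k).toLp := by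
  obtain ⟨g, hg, -, hge⟩ := v.2.2
  obtain ⟨q, hq, hgq⟩ := hge e he' (hc.edge_subset e he)
  refine ⟨⟨q, hq⟩, ?_⟩
  rw [(hc.isLpGraph_edgeTrace he 𝒯 Ψ k).toLp_eq hg,
    (isLpGraph_extPoly_edge hΨ hP hc he k).toLp_eq (v := ⟨q, hq⟩) rfl]
  refine MemLp.toLp_congr _ _ ?_
  have hm : MeasurableSet (seg e) := by
    rw [seg, ← Path.range_segment]
    exact (isCompact_range (Path.segment e.1 e.2).continuous).isClosed.measurableSet
  filter_upwards [ae_restrict_mem hm] with x hx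
  exact (hgq hx).symm

/-- The Laplacian and the traces on the edges of a function of the local space. -/
noncomputable def dataMap (hΨ : IsEnrichment 𝒯 Ψ) (hP : P ∈ 𝒯.cells) (hc : PolyCell P x₀ ρ Es)
    (hEs : ∀ e ∈ Es, e ∈ 𝒯.edges) (k : ℕ) : localSpace 𝒯 Ψ k P →ₗ[ℝ]
      extLapLp hΨ hP hc.toStarCell (k - 2) ×
        ∀ e : Es, LinearMap.range (isLpGraph_extPoly_edge hΨ hP hc e.2 k).toLp :=
  LinearMap.prod
    ((isLpGraph_localLaplacian 𝒯 Ψ k P).toLp.codRestrict _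
      (laplacian_mem_extLapLp hΨ hP hc.toStarCell))
    (LinearMap.pi fun e => (hc.isLpGraph_edgeTrace e.2 𝒯 Ψ k).toLp.codRestrict _
      (edgeTrace_mem_range hΨ hP hc e.2 (hEs e e.2)))

theorem dataMap_congr (hΨ : IsEnrichment 𝒯 Ψ) (hP : P ∈ 𝒯.cells) (hc : PolyCell P x₀ ρ Es)
    (hEs : ∀ e ∈ Es, e ∈ 𝒯.edges) {u v : localSpace 𝒯 Ψ k P}
    (h : (u : Plane → ℝ) =ᵐ[volume.restrict (interior P)] (v : Plane → ℝ)) :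
    dataMap hΨ hP hc hEs k u = dataMap hΨ hP hc hEs k v := by
  refine Prod.ext (Subtype.ext ?_) (funext fun e => Subtype.ext ?_)
  · exact IsLpGraph.toLp_congr (isLpGraph_localLaplacian 𝒯 Ψ k P) fun g hg => hg.congr h
  · exact IsLpGraph.toLp_congr (hc.isLpGraph_edgeTrace e.2 𝒯 Ψ k) fun g hg => hg.congr h

/-- Zero Laplacian and zero trace on every edge: Green's formula applies with q = 0. -/
theorem hasWeakGrad_zero_of_dataMap (hΨ : IsEnrichment 𝒯 Ψ) (hP : P ∈ 𝒯.cells)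
    (hc : PolyCell P x₀ ρ Es) (hEs : ∀ e ∈ Es, e ∈ 𝒯.edges) {v : localSpace 𝒯 Ψ k P}
    (h : dataMap hΨ hP hc hEs k v = 0) : HasWeakGrad (interior P) v 0 := by
  obtain ⟨s, -, hs⟩ := v.2.1
  have h1 : (isLpGraph_localLaplacian 𝒯 Ψ k P).toLp v = 0 :=
    congrArg Subtype.val (congrArg Prod.fst h)
  have hs0 : s =ᵐ[volume.restrict (interior P)] 0 := by
    refine ((isLpGraph_localLaplacian 𝒯 Ψ k P).coeFn_toLp hs).symm.trans ?_
    rw [h1]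
    exact Lp.coeFn_zero ℝ 2 _
  have ht := hasTrace_trace v.2
  have ht0 : trace (interior P) v =ᵐ[bdryMeasure (interior P)] 0 := by
    refine hc.ae_bdry_iff.2 fun e he => ?_
    have h2 : (hc.isLpGraph_edgeTrace he 𝒯 Ψ k).toLp v = 0 :=
      congrArg Subtype.val (congrFun (congrArg Prod.snd h) ⟨e, he⟩)
    refine ((hc.isLpGraph_edgeTrace he 𝒯 Ψ k).coeFn_toLp ht).symm.trans ?_
    rw [h2]
    exact Lp.coeFn_zero ℝ 2 _
  refine hc.hasWeakGrad_zero (q := 0) hs (HasWeakGrad.zero _) ?_ ?_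
  · rw [sub_zero]
    exact ht.congr_trace ht0
  · refine integral_eq_zero_of_ae ?_
    filter_upwards [hs0] with x hx
    simp [hx]

/-- The Laplacians and edge traces on all elements form an injective linear map into a
finite-dimensional space, so no degrees of freedom need be counted and no boundary value problem
solved. -/
theorem finiteDimensional_globalSpaceZero [FiniteDimensional ℝ Ψ] (hΩ : IsPolygonalDomain Ω)
    {ϱ : ℝ} (hϱ : 0 < ϱ) (h𝒯 : 𝒯.IsRegular ϱ) (hΨ : IsEnrichment 𝒯 Ψ) (k : ℕ) :
    FiniteDimensional ℝ (globalSpaceZero 𝒯 Ψ k) := by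
  choose X r E hc hE using fun P : 𝒯.cells => h𝒯.polyCell hϱ P.2
  have hE' : ∀ P : 𝒯.cells, ∀ e ∈ E P, e ∈ 𝒯.edges := fun P e he => ((hE P e).1 he).1
  refine Module.Finite.of_injective (LinearMap.pi fun P : 𝒯.cells =>
    liftCell P.2 (dataMap hΨ P.2 (hc P) (hE' P) k)
      fun _ _ => dataMap_congr hΨ P.2 (hc P) (hE' P)) ?_
  rw [injective_iff_map_eq_zero]
  intro v hv
  refine Subtype.ext (Lp.ext ?_)
  refine (ae_eq_zero_of_hasTrace_zero hΩ hϱ h𝒯 v.2.2 fun P hP => ?_).trans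
    (Lp.coeFn_zero ℝ 2 (volume.restrict Ω)).symm
  exact hasWeakGrad_zero_of_dataMap hΨ hP (hc ⟨P, hP⟩) (hE' ⟨P, hP⟩)
    (v := cellRestrict hP v) (congrFun hv ⟨P, hP⟩)

end FiniteDimensional

end XVEM

/-! ### Well-posedness of the scheme. -/

namespace XVEM

open scoped ENNReal NNReal

section Scheme

variable {Ω : Set Plane} {𝒯 : PolygonalMesh Ω} {Ψ : Submodule ℝ (Plane → ℝ)}
  {P : Set Plane} {x₀ : Plane} {ρ : ℝ} {Es : Finset (Plane × Plane)} {k : ℕ}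
  {S : ∀ P : Set Plane, LinearMap.BilinForm ℝ (localSpace 𝒯 Ψ k P)}

theorem penalty_nonneg (v : Plane → ℝ) : 0 ≤ penalty Ψ k P v := by
  have n1 : 0 ≤ ∫ x in interior P, lapProj Ψ (k - 2) P v x ^ 2 :=
    integral_nonneg fun x => by positivity
  have n2 : 0 ≤ ∫ x, trace (interior P) v x ^ 2 ∂(bdryMeasure (interior P)) :=
    integral_nonneg fun x => by positivity
  have n3 : 0 ≤ Metric.diam P := Metric.diam_nonneg
  rw [penalty]
  positivity

theorem IsStabilisation.isSymm (hS : IsStabilisation 𝒯 Ψ k S) (hP : P ∈ 𝒯.cells) :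
    LinearMap.IsSymm (S P) := ⟨fun u v => hS.symm P hP u v⟩

theorem IsStabilisation.consistent_right (hS : IsStabilisation 𝒯 Ψ k S) (hP : P ∈ 𝒯.cells)
    (v w : localSpace 𝒯 Ψ k P) (hw : (w : Plane → ℝ) ∈ extPoly Ψ k) : S P v w = 0 := by
  rw [hS.symm P hP, hS.consistent P hP w v hw]

theorem memLp_cell (hP : P ∈ 𝒯.cells) (f : L2 Ω) : MemLp f 2 (volume.restrict (interior P)) :=
  (Lp.memLp f).mono_measure (Measure.restrict_mono (𝒯.interior_subset P hP) le_rfl)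

theorem isLpGraph_cell (hP : P ∈ 𝒯.cells) : IsLpGraph (volume.restrict (interior P))
    fun (f : L2 Ω) (g : Plane → ℝ) => f =ᵐ[volume.restrict (interior P)] g where
  exists_rel f := ⟨f, ae_eq_rfl⟩
  memLp f _ h := (memLp_cell hP f).ae_eq h
  unique _ _ _ h h' := h.symm.trans h'
  add f g _ _ h h' := (ae_cell 𝒯 hP (Lp.coeFn_add f g)).trans (h.add h')
  smul c f _ h := (ae_cell 𝒯 hP (Lp.coeFn_smul c f)).trans (h.const_smul c)

theorem norm_toLp_cell_le (hP : P ∈ 𝒯.cells) (f : L2 Ω) :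
    ‖(memLp_cell hP f).toLp f‖ ≤ ‖f‖ := by
  rw [Lp.norm_toLp, Lp.norm_def]
  exact ENNReal.toReal_mono (Lp.eLpNorm_ne_top f)
    (eLpNorm_mono_measure _ (Measure.restrict_mono (𝒯.interior_subset P hP) le_rfl))

theorem norm_lapProj_le {l : ℕ} {f s : Plane → ℝ} (hf : MemLp f 2 (volume.restrict (interior P)))
    (hs : MemLp s 2 (volume.restrict (interior P))) (h : IsLapProj Ψ l P f s) :
    ‖hs.toLp s‖ ≤ ‖hf.toLp f‖ := by
  have h1 : inner ℝ (hs.toLp s) (hf.toLp f) = ‖hs.toLp s‖ ^ 2 := by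
    have h2 : inner ℝ (hs.toLp s) (hf.toLp f - hs.toLp s) = 0 := by
      rw [← MemLp.toLp_sub, ← integral_inner_toLp, ← h.orthogonal s h.mem]
      exact integral_congr_ae (ae_of_all _ fun x => by simp)
    rw [inner_sub_right, real_inner_self_eq_norm_sq, sub_eq_zero] at h2
    exact h2
  have h3 := real_inner_le_norm (hs.toLp s) (hf.toLp f)
  rw [h1, sq] at h3
  by_contra hlt
  rw [not_le] at hlt
  have h4 : 0 < ‖hs.toLp s‖ := (norm_nonneg _).trans_lt hlt
  exact absurd (le_of_mul_le_mul_left h3 h4) (not_le.2 hlt)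

variable [FiniteDimensional ℝ Ψ]

theorem penalty_eq_zero (hΨ : IsEnrichment 𝒯 Ψ) (hP : P ∈ 𝒯.cells) (hc : PolyCell P x₀ ρ Es)
    {d : Plane → ℝ} (hd : d ∈ localSpace 𝒯 Ψ k P)
    (h : 0 =ᵐ[volume.restrict (interior P)] d) : penalty Ψ k P d = 0 := by
  have hdL := memLp_of_mem_localSpace hd
  have h0 : IsLapProj Ψ (k - 2) P 0 0 := ⟨zero_mem _, fun s _ => by simp⟩
  have h1 := (isLapProj_lapProj (l := k - 2) hΨ hP hc.toStarCell hdL).unique hc.toStarCell hdL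
    (h0.congr h)
  have h2 := hc.hasTrace_unique (hasTrace_trace hd) ((HasTrace.zero _).congr h)
  have e1 : ∫ x in interior P, lapProj Ψ (k - 2) P d x ^ 2 = 0 := by
    refine integral_eq_zero_of_ae ?_
    filter_upwards [h1] with x hx
    simp [hx]
  have e2 : ∫ x, trace (interior P) d x ^ 2 ∂(bdryMeasure (interior P)) = 0 := by
    refine integral_eq_zero_of_ae ?_
    filter_upwards [h2] with x hx
    simp [hx]
  rw [penalty, e1, e2, mul_zero, mul_zero, add_zero]

/-- The stabilisation is given on functions, not on classes. A difference vanishing almost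
everywhere has elliptic projection zero and zero penalty, so the upper bound gives S(d, d) = 0; for
a positive semi-definite symmetric form this puts d in the kernel. -/
theorem IsStabilisation.congr_left (hS : IsStabilisation 𝒯 Ψ k S) (hΨ : IsEnrichment 𝒯 Ψ)
    (hP : P ∈ 𝒯.cells) (hc : PolyCell P x₀ ρ Es) {u v : localSpace 𝒯 Ψ k P}
    (h : (u : Plane → ℝ) =ᵐ[volume.restrict (interior P)] (v : Plane → ℝ)) : S P u = S P v := by
  obtain ⟨c, -, C, -, hcC⟩ := hS.coercive_bounded
  have hd : 0 =ᵐ[volume.restrict (interior P)] ((u - v : localSpace 𝒯 Ψ k P) : Plane → ℝ) := by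
    filter_upwards [h] with x hx
    simp [hx]
  have h0 : IsEllProj Ψ k P (u - v : localSpace 𝒯 Ψ k P) 0 :=
    (isEllProj_self (zero_mem _)).congr ⟨0, HasWeakGrad.zero _⟩ hd
  have h1 := (hcC P hP (u - v) h0).2
  rw [penalty_eq_zero hΨ hP hc (u - v).2 hd, mul_zero] at h1
  have h2 := (LinearMap.BilinForm.apply_apply_same_eq_zero_iff (S P) (hS.nonneg P hP)
    (hS.isSymm hP)).1 (le_antisymm h1 (hS.nonneg P hP _))
  rw [LinearMap.mem_ker, map_sub, sub_eq_zero] at h2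
  exact h2

/-- The stabilisation term of an element, as a bilinear form on the global space. -/
noncomputable def stabForm (hS : IsStabilisation 𝒯 Ψ k S) (hΨ : IsEnrichment 𝒯 Ψ)
    (hP : P ∈ 𝒯.cells) (hc : PolyCell P x₀ ρ Es) :
    LinearMap.BilinForm ℝ (globalSpaceZero 𝒯 Ψ k) :=
  -- The descent to classes is carried out one argument at a time, with symmetry reducing the second
  -- argument to the first.
  LinearMap.flip (liftCell hP (LinearMap.flip (liftCell hP (S P)
    fun _ _ h => hS.congr_left hΨ hP hc h)) fun u v h => by
      refine LinearMap.ext fun w => ?_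
      change S P (cellRestrict hP w) u = S P (cellRestrict hP w) v
      rw [hS.symm P hP, hS.symm P hP _ v, hS.congr_left hΨ hP hc h])

theorem stabForm_apply (hS : IsStabilisation 𝒯 Ψ k S) (hΨ : IsEnrichment 𝒯 Ψ)
    (hP : P ∈ 𝒯.cells) (hc : PolyCell P x₀ ρ Es) (u v : globalSpaceZero 𝒯 Ψ k) :
    stabForm hS hΨ hP hc u v = S P (cellRestrict hP u) (cellRestrict hP v) := rfl

/-- By consistency and symmetry, S(v, v) = S(v - q, v - q) with q the elliptic projection; v - q has
projection zero, so the lower bound applies to it. -/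
theorem IsStabilisation.le_apply (hS : IsStabilisation 𝒯 Ψ k S) (hΨ : IsEnrichment 𝒯 Ψ)
    {c : ℝ} (hcS : ∀ P ∈ 𝒯.cells, ∀ v : localSpace 𝒯 Ψ k P,
      IsEllProj Ψ k P v 0 → c * penalty Ψ k P v ≤ S P v v)
    (hP : P ∈ 𝒯.cells) (hc : PolyCell P x₀ ρ Es) (v : localSpace 𝒯 Ψ k P) :
    c * penalty Ψ k P (v - ellProj Ψ k P v) ≤ S P v v := by
  have hv := memH1_of_mem_localSpace v.2
  have hq := isEllProj_ellProj (k := k) hΨ hP hc hv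
  set q : localSpace 𝒯 Ψ k P := ⟨_, hΨ.mem_localSpace hP hc hq.mem⟩ with hqd
  have hd : IsEllProj Ψ k P (v - q : localSpace 𝒯 Ψ k P) 0 := by
    have h1 := (isEllProj_self (P := P) hq.mem).smul hΨ hP hc.toStarCell (-1)
      (memH1_of_mem_extPoly hΨ hP hc.toStarCell hq.mem)
    have h2 := hq.add hΨ hP hc.toStarCell hv
      ((memH1_of_mem_extPoly hΨ hP hc.toStarCell hq.mem).smul (-1)) h1
    rwa [neg_one_smul, add_neg_cancel, ← sub_eq_add_neg] at h2
  refine (hcS P hP _ hd).trans_eq ?_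
  have h3 : S P q = 0 := LinearMap.ext fun w => hS.consistent P hP q w hq.mem
  rw [map_sub (S P), h3, sub_zero, map_sub, hS.consistent_right hP _ q hq.mem, sub_zero]

variable {X : 𝒯.cells → Plane} {r : 𝒯.cells → ℝ} {E : 𝒯.cells → Finset (Plane × Plane)}

/-- The discrete bilinear form on the space with zero boundary values. -/
noncomputable def schemeForm (hS : IsStabilisation 𝒯 Ψ k S) (hΨ : IsEnrichment 𝒯 Ψ)
    (hc : ∀ P : 𝒯.cells, PolyCell P.1 (X P) (r P) (E P)) :
    LinearMap.BilinForm ℝ (globalSpaceZero 𝒯 Ψ k) :=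
  ∑ P : 𝒯.cells, ((innerₗ _).compl₁₂
      (liftCell P.2 (isLpGraph_ellProj hΨ P.2 (hc P) k).toLp fun u _ h =>
        IsLpGraph.toLp_congr _ fun _ ⟨q, hq, hg⟩ =>
          ⟨q, hq.congr (memH1_of_mem_localSpace u.2) h, hg⟩)
      (liftCell P.2 (isLpGraph_ellProj hΨ P.2 (hc P) k).toLp fun u _ h =>
        IsLpGraph.toLp_congr _ fun _ ⟨q, hq, hg⟩ =>
          ⟨q, hq.congr (memH1_of_mem_localSpace u.2) h, hg⟩) +
    stabForm hS hΨ P.2 (hc P))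

theorem schemeForm_apply (hS : IsStabilisation 𝒯 Ψ k S) (hΨ : IsEnrichment 𝒯 Ψ)
    (hc : ∀ P : 𝒯.cells, PolyCell P.1 (X P) (r P) (E P)) (u v : globalSpaceZero 𝒯 Ψ k) :
    schemeForm hS hΨ hc u v = discreteForm S ⟨u, u.2.1⟩ ⟨v, v.2.1⟩ := by
  rw [schemeForm, LinearMap.sum_apply, LinearMap.sum_apply, discreteForm]
  refine Finset.sum_congr rfl fun P _ => ?_
  rw [LinearMap.add_apply, LinearMap.add_apply, stabForm_apply, LinearMap.compl₁₂_apply,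
    liftCell_apply, liftCell_apply, innerₗ_apply_apply]
  refine congrArg₂ (· + ·) ?_ rfl
  have h : ∀ w : globalSpaceZero 𝒯 Ψ k, ∃ q, IsEllProj Ψ k P.1 (cellRestrict P.2 w) q ∧
      HasWeakGrad (interior P.1) q
        (weakGrad (interior P.1) (ellProj Ψ k P.1 (w : L2 Ω))) := fun w => by
    have hq := isEllProj_ellProj (k := k) hΨ P.2 (hc P)
      (memH1_of_mem_localSpace (cellRestrict P.2 w).2)
    exact ⟨_, hq, hasWeakGrad_weakGrad (memH1_of_mem_extPoly hΨ P.2 (hc P).toStarCell hq.mem)⟩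
  rw [IsLpGraph.toLp_eq _ (h u), IsLpGraph.toLp_eq _ (h v), ← integral_inner_toLp]

theorem schemeForm_coercive (hS : IsStabilisation 𝒯 Ψ k S) (hΨ : IsEnrichment 𝒯 Ψ)
    (hc : ∀ P : 𝒯.cells, PolyCell P.1 (X P) (r P) (E P)) : ∃ α > 0, ∀ v,
      α * ‖discreteMap hΨ hc k v‖ ^ 2 ≤ schemeForm hS hΨ hc v v := by
  obtain ⟨c, hc0, C, -, hcC⟩ := hS.coercive_bounded
  -- The gradient term enters form and norm with the same coefficient 1; the penalty is controlled
  -- with c.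
  refine ⟨min 1 c, lt_min one_pos hc0, fun v => ?_⟩
  rw [norm_discreteMap_sq, schemeForm_apply, discreteForm, Finset.mul_sum]
  refine Finset.sum_le_sum fun P _ => ?_
  have h1 := hS.le_apply hΨ (fun P hP v hv => (hcC P hP v hv).1) P.2 (hc P) (cellRestrict P.2 v)
  have h2 : 0 ≤ penalty Ψ k P.1
      ((cellRestrict P.2 v : Plane → ℝ) - ellProj Ψ k P.1 (cellRestrict P.2 v)) :=
    penalty_nonneg _
  have h3 : 0 ≤ ∫ x in interior P.1, ‖weakGrad (interior P.1)
      (ellProj Ψ k P.1 (cellRestrict P.2 v)) x‖ ^ 2 := integral_nonneg fun x => by positivity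
  simp only [real_inner_self_eq_norm_sq]
  change min 1 c * localNormSq Ψ k P.1 (cellRestrict P.2 v) ≤
    (∫ x in interior P.1, ‖weakGrad (interior P.1)
      (ellProj Ψ k P.1 (cellRestrict P.2 v)) x‖ ^ 2) +
      S P.1 (cellRestrict P.2 v) (cellRestrict P.2 v)
  rw [localNormSq, mul_add]
  refine add_le_add ?_ ((mul_le_mul_of_nonneg_right (min_le_right 1 c) h2).trans h1)
  exact (mul_le_mul_of_nonneg_right (min_le_left 1 c) h3).trans_eq (one_mul _)

theorem memLp_lapProj (hΨ : IsEnrichment 𝒯 Ψ) (hP : P ∈ 𝒯.cells) (hc : PolyCell P x₀ ρ Es)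
    (l : ℕ) (f : L2 Ω) : MemLp (lapProj Ψ l P f) 2 (volume.restrict (interior P)) :=
  (isLapProj_lapProj hΨ hP hc.toStarCell (memLp_cell hP f)).memLp hc.toStarCell

/-- The discrete right-hand side as a linear form. -/
noncomputable def schemeRhs (hΨ : IsEnrichment 𝒯 Ψ)
    (hc : ∀ P : 𝒯.cells, PolyCell P.1 (X P) (r P) (E P)) (k : ℕ) (f : L2 Ω) :
    Module.Dual ℝ (globalSpaceZero 𝒯 Ψ k) :=
  ∑ P : 𝒯.cells, innerₗ _ ((memLp_lapProj hΨ P.2 (hc P) (k - 2) f).toLp _) ∘ₗ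
    (isLpGraph_cell P.2).toLp ∘ₗ (globalSpaceZero 𝒯 Ψ k).subtype

theorem schemeRhs_apply_eq_sum (hΨ : IsEnrichment 𝒯 Ψ)
    (hc : ∀ P : 𝒯.cells, PolyCell P.1 (X P) (r P) (E P)) (f : L2 Ω)
    (v : globalSpaceZero 𝒯 Ψ k) : schemeRhs hΨ hc k f v =
      ∑ P : 𝒯.cells, inner ℝ ((memLp_lapProj hΨ P.2 (hc P) (k - 2) f).toLp _)
        ((memLp_cell P.2 (v : L2 Ω)).toLp _) := by
  rw [schemeRhs, LinearMap.sum_apply]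
  refine Finset.sum_congr rfl fun P _ => ?_
  rw [LinearMap.comp_apply, LinearMap.comp_apply, innerₗ_apply_apply, Submodule.subtype_apply,
    (isLpGraph_cell P.2).toLp_eq ae_eq_rfl]

theorem schemeRhs_apply (hΨ : IsEnrichment 𝒯 Ψ)
    (hc : ∀ P : 𝒯.cells, PolyCell P.1 (X P) (r P) (E P)) (f : L2 Ω)
    (v : globalSpaceZero 𝒯 Ψ k) : schemeRhs hΨ hc k f v = discreteRhs 𝒯 Ψ k f v := by
  rw [schemeRhs_apply_eq_sum, discreteRhs, ← Finset.sum_coe_sort 𝒯.cells]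
  refine Finset.sum_congr rfl fun P _ => ?_
  rw [← integral_inner_toLp]
  exact integral_congr_ae (ae_of_all _ fun x => by simp [mul_comm])

theorem schemeRhs_le (hΨ : IsEnrichment 𝒯 Ψ)
    (hc : ∀ P : 𝒯.cells, PolyCell P.1 (X P) (r P) (E P)) (f : L2 Ω)
    (v : globalSpaceZero 𝒯 Ψ k) : schemeRhs hΨ hc k f v ≤ 𝒯.cells.card * (‖f‖ * ‖v‖) := by
  rw [schemeRhs_apply_eq_sum, ← Fintype.card_coe, ← nsmul_eq_mul]
  refine Finset.sum_le_card_nsmul _ _ _ fun P _ => (real_inner_le_norm _ _).trans ?_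
  have h := isLapProj_lapProj (l := k - 2) hΨ P.2 (hc P).toStarCell (memLp_cell P.2 f)
  exact mul_le_mul ((norm_lapProj_le (memLp_cell P.2 f) _ h).trans (norm_toLp_cell_le P.2 f))
    (norm_toLp_cell_le P.2 _) (norm_nonneg _) (norm_nonneg _)

/-- Coercivity for a norm gives an injective map into the dual, which is surjective by equality of
finite dimensions. Testing the equation with the solution itself gives the bound. -/
theorem exists_unique_isDiscreteSolution (hΩ : IsPolygonalDomain Ω) {ϱ : ℝ} (hϱ : 0 < ϱ)
    (h𝒯 : 𝒯.IsRegular ϱ) (hΨ : IsEnrichment 𝒯 Ψ) (hS : IsStabilisation 𝒯 Ψ k S) :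
    ∃ C : ℝ, ∀ f : L2 Ω, ∃ u : globalSpaceZero 𝒯 Ψ k, IsDiscreteSolution S f u ∧
      (∀ u', IsDiscreteSolution S f u' → u' = u) ∧
      discreteNorm 𝒯 Ψ k (u : L2 Ω) ≤ C * ‖f‖ := by
  choose X r E hc hE using fun P : 𝒯.cells => h𝒯.polyCell hϱ P.2
  have hfin := finiteDimensional_globalSpaceZero hΩ hϱ h𝒯 hΨ k
  have hinj := discreteMap_injective (k := k) hΩ hϱ h𝒯 hΨ hc
  obtain ⟨α, hα, hco⟩ := schemeForm_coercive hS hΨ hc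
  -- In finite dimension the injective map is bounded below, so K bounds the `L²` norm by the
  -- discrete norm, in place of a Poincaré inequality.
  obtain ⟨K, -, hK⟩ := (discreteMap hΨ hc k).exists_antilipschitzWith (LinearMap.ker_eq_bot.2 hinj)
  have hBinj : Function.Injective (schemeForm hS hΨ hc) := by
    rw [injective_iff_map_eq_zero]
    intro u hu
    have h1 := hco u
    rw [hu, LinearMap.zero_apply] at h1
    have h2 : ‖discreteMap hΨ hc k u‖ ^ 2 ≤ 0 := nonpos_of_mul_nonpos_right h1 hα
    have h3 : discreteMap hΨ hc k u = 0 := by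
      rw [← norm_eq_zero, ← sq_eq_zero_iff]
      exact le_antisymm h2 (sq_nonneg _)
    exact hinj (h3.trans (map_zero _).symm)
  have hBsurj : Function.Surjective (schemeForm hS hΨ hc) :=
    (LinearMap.injective_iff_surjective_of_finrank_eq_finrank
      Subspace.dual_finrank_eq.symm).1 hBinj
  have hsol : ∀ (f : L2 Ω) (u : globalSpaceZero 𝒯 Ψ k),
      IsDiscreteSolution S f u ↔ schemeForm hS hΨ hc u = schemeRhs hΨ hc k f := by
    intro f u
    simp only [IsDiscreteSolution, LinearMap.ext_iff, schemeForm_apply, schemeRhs_apply]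
  refine ⟨𝒯.cells.card * K / α, fun f => ?_⟩
  obtain ⟨u, hu⟩ := hBsurj (schemeRhs hΨ hc k f)
  refine ⟨u, (hsol f u).2 hu, fun u' hu' => hBinj (((hsol f u').1 hu').trans hu.symm), ?_⟩
  rw [← norm_discreteMap hΨ hc u]
  set N := ‖discreteMap hΨ hc k u‖ with hN
  have hN0 : 0 ≤ N := norm_nonneg _
  have h1 : α * N ^ 2 ≤ 𝒯.cells.card * (‖f‖ * ‖u‖) := by
    refine (hco u).trans ?_
    rw [hu]
    exact schemeRhs_le hΨ hc f u
  have h2 : ‖u‖ ≤ K * N := hK.le_mul_norm (map_zero _) u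
  have h3 : α * N ^ 2 ≤ (𝒯.cells.card * K * ‖f‖) * N := by
    refine h1.trans ?_
    calc (𝒯.cells.card : ℝ) * (‖f‖ * ‖u‖) ≤ 𝒯.cells.card * (‖f‖ * (K * N)) := by gcongr
      _ = _ := by ring
  rw [div_mul_eq_mul_div, le_div_iff₀ hα]
  -- One factor N is to be cancelled from the estimate, so N = 0 is treated apart.
  rcases hN0.eq_or_lt with h0 | h0
  · rw [← h0, zero_mul]
    positivity
  · refine le_of_mul_le_mul_right (le_trans (le_of_eq ?_) h3) h0
    ring

theorem exists_seminorm_eq_discreteNorm (hΩ : IsPolygonalDomain Ω) {ϱ : ℝ} (hϱ : 0 < ϱ)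
    (h𝒯 : 𝒯.IsRegular ϱ) (hΨ : IsEnrichment 𝒯 Ψ) (k : ℕ) :
    ∃ N : Seminorm ℝ (globalSpaceZero 𝒯 Ψ k),
      (∀ v, N v = discreteNorm 𝒯 Ψ k (v : L2 Ω)) ∧ ∀ v, N v = 0 → v = 0 := by
  choose X r E hc hE using fun P : 𝒯.cells => h𝒯.polyCell hϱ P.2
  refine ⟨(normSeminorm ℝ _).comp (discreteMap hΨ hc k), norm_discreteMap hΨ hc, fun v hv => ?_⟩
  exact discreteMap_injective hΩ hϱ h𝒯 hΨ hc
    ((norm_eq_zero.1 hv).trans (map_zero (discreteMap hΨ hc k)).symm)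

end Scheme

end XVEM

theorem mainTheorem5 {Ω : Set XVEM.Plane} (hΩ : XVEM.IsPolygonalDomain Ω)
    (𝒯 : XVEM.PolygonalMesh Ω) (ϱ : ℝ) (hϱ : 0 < ϱ) (h𝒯 : 𝒯.IsRegular ϱ)
    (Ψ : Submodule ℝ (XVEM.Plane → ℝ)) [FiniteDimensional ℝ Ψ] (hΨ : XVEM.IsEnrichment 𝒯 Ψ)
    (k : ℕ) (hk : 1 ≤ k) :
    -- the traces and projections entering the discrete norm exist and are unique
    (∀ P ∈ 𝒯.cells,
      (∀ q ∈ XVEM.extPoly Ψ k, q ∈ XVEM.localSpace 𝒯 Ψ k P) ∧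
      (∀ v ∈ XVEM.localSpace 𝒯 Ψ k P,
        (∃ q, XVEM.IsEllProj Ψ k P v q) ∧
        (∀ q q', XVEM.IsEllProj Ψ k P v q → XVEM.IsEllProj Ψ k P v q' → Set.EqOn q q' P)) ∧
      (∀ v, MemLp v 2 (volume.restrict (interior P)) →
        (∃ r, XVEM.IsLapProj Ψ (k - 2) P v r) ∧
        (∀ r r', XVEM.IsLapProj Ψ (k - 2) P v r → XVEM.IsLapProj Ψ (k - 2) P v r' →
          r =ᵐ[volume.restrict (interior P)] r')) ∧
      (∀ v g g', XVEM.HasTrace (interior P) v g → XVEM.HasTrace (interior P) v g' →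
        g =ᵐ[XVEM.bdryMeasure (interior P)] g')) ∧
    -- the discrete norm is a norm on the space with zero boundary values
    (∃ N : Seminorm ℝ (XVEM.globalSpaceZero 𝒯 Ψ k),
      (∀ v, N v = XVEM.discreteNorm 𝒯 Ψ k (v : XVEM.L2 Ω)) ∧ ∀ v, N v = 0 → v = 0) ∧
    -- the scheme is well posed
    (∀ S : ∀ P : Set XVEM.Plane, LinearMap.BilinForm ℝ (XVEM.localSpace 𝒯 Ψ k P),
      XVEM.IsStabilisation 𝒯 Ψ k S →
      ∃ C : ℝ, ∀ f : XVEM.L2 Ω, ∃ u : XVEM.globalSpaceZero 𝒯 Ψ k,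
        XVEM.IsDiscreteSolution S f u ∧
        (∀ u', XVEM.IsDiscreteSolution S f u' → u' = u) ∧
        XVEM.discreteNorm 𝒯 Ψ k (u : XVEM.L2 Ω) ≤ C * ‖f‖) := by
  refine ⟨fun P hP => ?_, XVEM.exists_seminorm_eq_discreteNorm hΩ hϱ h𝒯 hΨ k,
    fun S hS => XVEM.exists_unique_isDiscreteSolution hΩ hϱ h𝒯 hΨ hS⟩
  obtain ⟨x₀, ρ, Es, hc, -⟩ := h𝒯.polyCell hϱ hP
  exact ⟨fun q hq => hΨ.mem_localSpace hP hc hq,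
    fun v hv => ⟨XVEM.exists_isEllProj hΨ hP hc (XVEM.memH1_of_mem_localSpace hv),
      fun q q' hq hq' => hq.eqOn hΨ hP hc hq'⟩,
    fun v hv => ⟨XVEM.exists_isLapProj hΨ hP hc.toStarCell hv,
      fun r r' hr hr' => hr.unique hc.toStarCell hv hr'⟩,
    fun v g g' hg hg' => hc.hasTrace_unique hg hg'⟩
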